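/- Let $k=\mathbb R$ or $\mathbb C$, and let $G$ be a finite-dimensional Lie group over $k$ with Lie algebra $\mathfrak g=T_eG$. Let $r\in\mathfrak g\wedge\mathfrak g\subset\mathfrak g\otimes\mathfrak g$ be a skew-symmetric solution of the classical Yang--Baxter equation $$[r_{12},r_{13}]+[r_{12},r_{23}]+[r_{13},r_{23}]=0 .$$ Let $L_r$ and $R_r$ be the left- and right-invariant bivector fields on $G$ with value $r$ at $e$, and let $\pi_r=L_r-R_r$, so that $(G,\pi_r)$ is a triangular Poisson Lie group. Let $$\mathfrak p=\operatorname{span}\{(\xi\otimes\mathrm{Id})(r)\mid \xi\in\mathfrak g^*\},$$ which is a Lie subalgebra of $\mathfrak g$, and let $P$ be the connected (not necessarily closed) subgroup of $G$ with Lie algebra $\mathfrak p$, i.e. the subgroup generated by $\exp\mathfrak p$. Then for every $t\in G$ the double coset $PtP$ is a complete Poisson submanifold of $(G,\pi_r)$. That is: 1. $PtP$ is a (not necessarily closed) submanifold of $G$, i.e. the image of an injective immersion of a second countable manifold over $k$; 2. $PtP$ is stable under all Hamiltonian flows: if $U\subset G$ is open, $f\colon U\to k$ is smooth (holomorphic if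 $k=\mathbb C$), $S\subset k$ is open and connected, and $\gamma\colon S\to U$ is an integral curve of the Hamiltonian vector field $X_f=df\rfloor\pi_r=(df\otimes\mathrm{Id})\pi_r$ with $\gamma(\tau_0)\in PtP$ for some $\tau_0\in S$, then $\gamma(\tau)\in PtP$ for all $\tau\in S$. -/

import Mathlib

open scoped Manifold ContDiff TensorProduct

noncomputable section

universe u

/-! ### The classical Yang--Baxter equation in a Lie algebra -/

section YangBaxter

variable {R : Type*} [CommRing R] {L : Type*} [LieRing L] [LieAlgebra R L]

/-- The Lie bracket as a linear map `L ⊗ L → L`. -/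
def bracketMap (R L : Type*) [CommRing R] [LieRing L] [LieAlgebra R L] : L ⊗[R] L →ₗ[R] L :=
  TensorProduct.lift (LieModule.toEnd R L L : L →ₗ[R] Module.End R L)

/-- `(a ⊗ b) ⊗ (c ⊗ d) ↦ [a, c] ⊗ b ⊗ d`; its value at `r ⊗ r` is `[r₁₂, r₁₃]`. -/
def bracket1213 (R L : Type*) [CommRing R] [LieRing L] [LieAlgebra R L] :
    (L ⊗[R] L) ⊗[R] (L ⊗[R] L) →ₗ[R] L ⊗[R] (L ⊗[R] L) :=
  TensorProduct.map (bracketMap R L) LinearMap.id ∘ₗ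
    (TensorProduct.tensorTensorTensorComm R L L L L).toLinearMap

/-- `(a ⊗ b) ⊗ (c ⊗ d) ↦ a ⊗ [b, c] ⊗ d`; its value at `r ⊗ r` is `[r₁₂, r₂₃]`. -/
def bracket1223 (R L : Type*) [CommRing R] [LieRing L] [LieAlgebra R L] :
    (L ⊗[R] L) ⊗[R] (L ⊗[R] L) →ₗ[R] L ⊗[R] (L ⊗[R] L) :=
  TensorProduct.map LinearMap.id
      (TensorProduct.map (bracketMap R L) LinearMap.id ∘ₗ
        (TensorProduct.assoc R L L L).symm.toLinearMap) ∘ₗ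
    (TensorProduct.assoc R L L (L ⊗[R] L)).toLinearMap

/-- `(a ⊗ b) ⊗ (c ⊗ d) ↦ a ⊗ c ⊗ [b, d]`; its value at `r ⊗ r` is `[r₁₃, r₂₃]`. -/
def bracket1323 (R L : Type*) [CommRing R] [LieRing L] [LieAlgebra R L] :
    (L ⊗[R] L) ⊗[R] (L ⊗[R] L) →ₗ[R] L ⊗[R] (L ⊗[R] L) :=
  (TensorProduct.assoc R L L L).toLinearMap ∘ₗ
    TensorProduct.map LinearMap.id (bracketMap R L) ∘ₗ
      (TensorProduct.tensorTensorTensorComm R L L L L).toLinearMap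

/-- The element `[r₁₂, r₁₃] + [r₁₂, r₂₃] + [r₁₃, r₂₃]` of `L ⊗ L ⊗ L`. -/
def yangBaxterElement (r : L ⊗[R] L) : L ⊗[R] (L ⊗[R] L) :=
  bracket1213 R L (r ⊗ₜ[R] r) + bracket1223 R L (r ⊗ₜ[R] r) + bracket1323 R L (r ⊗ₜ[R] r)

theorem bracket1213_tmul (a b c d : L) :
    bracket1213 R L ((a ⊗ₜ[R] b) ⊗ₜ[R] (c ⊗ₜ[R] d)) = ⁅a, c⁆ ⊗ₜ[R] (b ⊗ₜ[R] d) := by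
  simp [bracket1213, bracketMap]

theorem bracket1223_tmul (a b c d : L) :
    bracket1223 R L ((a ⊗ₜ[R] b) ⊗ₜ[R] (c ⊗ₜ[R] d)) = a ⊗ₜ[R] (⁅b, c⁆ ⊗ₜ[R] d) := by
  simp [bracket1223, bracketMap]

theorem bracket1323_tmul (a b c d : L) :
    bracket1323 R L ((a ⊗ₜ[R] b) ⊗ₜ[R] (c ⊗ₜ[R] d)) = a ⊗ₜ[R] (c ⊗ₜ[R] ⁅b, d⁆) := by
  simp [bracket1323, bracketMap]

/-- `r` is a skew-symmetric tensor (that is, an element of `L ∧ L`, where `a ∧ b` stands for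
`a ⊗ b - b ⊗ a`) and solves the classical Yang--Baxter equation. -/
structure IsSkewYangBaxterSolution (r : L ⊗[R] L) : Prop where
  skew : TensorProduct.comm R L L r = -r
  yangBaxter : yangBaxterElement r = 0

end YangBaxter

/-! ### Contraction of a bivector with a covector -/

/-- `(ξ ⊗ id) w`, the contraction of `w ∈ V ⊗ V` with the covector `ξ` in the first factor. -/
def covectorContract {𝕜 V : Type*} [Field 𝕜] [AddCommGroup V] [Module 𝕜 V]
    (ξ : Module.Dual 𝕜 V) (w : V ⊗[𝕜] V) : V :=
  TensorProduct.lid 𝕜 V (TensorProduct.map ξ (LinearMap.id : V →ₗ[𝕜] V) w)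

/-- The span of all components `(ξ ⊗ id) r`, `ξ ∈ V^*`, of the tensor `r ∈ V ⊗ V`. -/
def componentSpan {𝕜 V : Type*} [Field 𝕜] [AddCommGroup V] [Module 𝕜 V]
    (r : V ⊗[𝕜] V) : Submodule 𝕜 V :=
  Submodule.span 𝕜 (Set.range fun ξ : Module.Dual 𝕜 V => covectorContract ξ r)

/-! ### Submanifolds and Hamiltonian flows

The manifolds are modelled on a finite-dimensional vector space `E` over `𝕜 = ℝ` or `ℂ`.
Over `ℂ`, the maps of class `C^∞` are the holomorphic ones. -/

section Manifolds

variable {𝕜 : Type*} [RCLike 𝕜] {E : Type*} [NormedAddCommGroup E] [NormedSpace 𝕜 E]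
  {M : Type*} [TopologicalSpace M] [ChartedSpace E M]

/-- The differential of `f : M → 𝕜` at `x`, as a covector. -/
def differentialAt (f : M → 𝕜) (x : M) : Module.Dual 𝕜 (TangentSpace 𝓘(𝕜, E) x) :=
  (mfderiv 𝓘(𝕜, E) 𝓘(𝕜, 𝕜) f x).toLinearMap

/-- The Hamiltonian vector field `X_f = df ⌟ π` of `f` for the bivector field `π`. -/
def hamiltonianField
    (π : (x : M) → TangentSpace 𝓘(𝕜, E) x ⊗[𝕜] TangentSpace 𝓘(𝕜, E) x) (f : M → 𝕜) (x : M) :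
    TangentSpace 𝓘(𝕜, E) x :=
  covectorContract (differentialAt f x) (π x)

/-- `γ` is an integral curve of the vector field `v` on the set `s` of times
(a set of real times if `𝕜 = ℝ`, of complex times if `𝕜 = ℂ`). -/
def IsIntegralCurveIn (v : (x : M) → TangentSpace 𝓘(𝕜, E) x) (γ : 𝕜 → M) (s : Set 𝕜) : Prop :=
  ∀ τ ∈ s, HasMFDerivAt 𝓘(𝕜, 𝕜) 𝓘(𝕜, E) γ τ
    ((1 : 𝕜 →L[𝕜] 𝕜).smulRight (v (γ τ)))

/-- `X` is stable under all Hamiltonian flows: an integral curve, defined for a connected open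
set of times, of the Hamiltonian vector field of a (possibly only locally defined) smooth
function lies in `X` as soon as it meets `X`. -/
def IsHamiltonianFlowStable
    (π : (x : M) → TangentSpace 𝓘(𝕜, E) x ⊗[𝕜] TangentSpace 𝓘(𝕜, E) x) (X : Set M) : Prop :=
  ∀ (U : Set M) (f : M → 𝕜), IsOpen U → ContMDiffOn 𝓘(𝕜, E) 𝓘(𝕜, 𝕜) ∞ f U →
    ∀ (γ : 𝕜 → M) (s : Set 𝕜), IsOpen s → IsPreconnected s → Set.MapsTo γ s U →
      IsIntegralCurveIn (hamiltonianField π f) γ s →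
        ∀ τ₀ ∈ s, γ τ₀ ∈ X → ∀ τ ∈ s, γ τ ∈ X

variable (𝕜 E) in
/-- `X ⊆ M` is a (not necessarily closed, nor embedded) submanifold: it is the image of an
injective immersion of a second countable manifold. Equivalently, `X` carries the structure of
a second countable manifold for which the inclusion into `M` is an immersion. -/
def IsImmersedSubmanifold {M : Type u} [TopologicalSpace M] [ChartedSpace E M]
    (X : Set M) : Prop :=
  ∃ (d : ℕ) (N : Type u) (_ : TopologicalSpace N) (_ : ChartedSpace (EuclideanSpace 𝕜 (Fin d)) N)
    (ι : N → M),
    SecondCountableTopology N ∧ IsManifold 𝓘(𝕜, EuclideanSpace 𝕜 (Fin d)) ∞ N ∧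
    ContMDiff 𝓘(𝕜, EuclideanSpace 𝕜 (Fin d)) 𝓘(𝕜, E) ∞ ι ∧
    (∀ y : N, Function.Injective (mfderiv 𝓘(𝕜, EuclideanSpace 𝕜 (Fin d)) 𝓘(𝕜, E) ι y)) ∧
    Function.Injective ι ∧ Set.range ι = X

/-- `X` is a complete Poisson submanifold of `(M, π)`: a submanifold which is stable under all
Hamiltonian flows on `M`. -/
structure IsCompletePoissonSubmanifold
    (π : (x : M) → TangentSpace 𝓘(𝕜, E) x ⊗[𝕜] TangentSpace 𝓘(𝕜, E) x) (X : Set M) : Prop where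
  submanifold : IsImmersedSubmanifold 𝕜 E X
  stable : IsHamiltonianFlowStable π X

end Manifolds

/-! ### Triangular Poisson Lie groups -/

section LieGroups

variable {𝕜 : Type*} [RCLike 𝕜] {E : Type*} [NormedAddCommGroup E] [NormedSpace 𝕜 E]
  {G : Type*} [TopologicalSpace G] [ChartedSpace E G] [Group G]

/-- A smooth Lie group over `ℝ` or `ℂ` is regular enough for Mathlib's Lie algebra. -/
instance lieGroupMinSmoothness [LieGroup 𝓘(𝕜, E) ∞ G] :
    LieGroup 𝓘(𝕜, E) (minSmoothness 𝕜 3) G := by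
  rw [minSmoothness_of_isRCLikeNormedField]
  infer_instance

/-- `r ∈ 𝔤 ⊗ 𝔤`, where `𝔤 = T_e G` is the Lie algebra of `G`, is a skew-symmetric solution of
the classical Yang--Baxter equation, so that it makes `G` a triangular Poisson Lie group. -/
def IsTriangular [FiniteDimensional 𝕜 E] [LieGroup 𝓘(𝕜, E) ∞ G]
    (r : GroupLieAlgebra 𝓘(𝕜, E) G ⊗[𝕜] GroupLieAlgebra 𝓘(𝕜, E) G) : Prop :=
  haveI : CompleteSpace E := FiniteDimensional.complete 𝕜 E
  IsSkewYangBaxterSolution r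

/-- The differential `𝔤 → T_g G` of the left translation `h ↦ g h` at the identity; it sends `v`
to the value at `g` of the left invariant vector field induced by `v`. -/
def leftTranslation (g : G) : GroupLieAlgebra 𝓘(𝕜, E) G →ₗ[𝕜] TangentSpace 𝓘(𝕜, E) g where
  toFun v := mfderiv 𝓘(𝕜, E) 𝓘(𝕜, E) (fun h : G => g * h) 1 v
  map_add' v w := map_add (mfderiv 𝓘(𝕜, E) 𝓘(𝕜, E) (fun h : G => g * h) 1) v w
  map_smul' c v := map_smul (mfderiv 𝓘(𝕜, E) 𝓘(𝕜, E) (fun h : G => g * h) 1) c v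

/-- The differential `𝔤 → T_g G` of the right translation `h ↦ h g` at the identity; it sends `v`
to the value at `g` of the right invariant vector field induced by `v`. -/
def rightTranslation (g : G) : GroupLieAlgebra 𝓘(𝕜, E) G →ₗ[𝕜] TangentSpace 𝓘(𝕜, E) g where
  toFun v := mfderiv 𝓘(𝕜, E) 𝓘(𝕜, E) (fun h : G => h * g) 1 v
  map_add' v w := map_add (mfderiv 𝓘(𝕜, E) 𝓘(𝕜, E) (fun h : G => h * g) 1) v w
  map_smul' c v := map_smul (mfderiv 𝓘(𝕜, E) 𝓘(𝕜, E) (fun h : G => h * g) 1) c v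

/-- The bivector field `π_r = L_r - R_r`, where `L_r` and `R_r` are the left and the right
invariant bivector fields with value `r` at the identity. -/
def triangularBivector (r : GroupLieAlgebra 𝓘(𝕜, E) G ⊗[𝕜] GroupLieAlgebra 𝓘(𝕜, E) G) (g : G) :
    TangentSpace 𝓘(𝕜, E) g ⊗[𝕜] TangentSpace 𝓘(𝕜, E) g :=
  TensorProduct.map (leftTranslation g) (leftTranslation g) r -
    TensorProduct.map (rightTranslation g) (rightTranslation g) r

/-- The exponential image of a subspace `𝔭` of the Lie algebra: the set of all `exp v = γ 1`,
where `v ∈ 𝔭` and `γ` is the integral curve with `γ 0 = 1` of the left invariant vector field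
induced by `v` (that is, the one-parameter subgroup with velocity `v`). -/
def expImage (p : Submodule 𝕜 (GroupLieAlgebra 𝓘(𝕜, E) G)) : Set G :=
  {g | ∃ v ∈ p, ∃ γ : 𝕜 → G, γ 0 = 1 ∧
    IsIntegralCurveIn (fun x : G => leftTranslation x v) γ Set.univ ∧ γ 1 = g}

/-- The connected (not necessarily closed) subgroup of `G` with Lie algebra `𝔭`, for a Lie
subalgebra `𝔭` of the Lie algebra of `G`: it is the subgroup generated by `exp 𝔭`. -/
def connectedSubgroup (p : Submodule 𝕜 (GroupLieAlgebra 𝓘(𝕜, E) G)) : Subgroup G :=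
  Subgroup.closure (expImage p)

end LieGroups

end

/-!
Why double cosets of `P` are complete Poisson submanifolds.

All of the calculus on `G` is done with left logarithmic derivatives: `HasLog f x A` says that `A`
is the derivative at `x` of `y ↦ (f x)⁻¹ f y`, read in the chart at `1`. They obey a product rule
twisted by `Ad` (`HasLog.mul`), they determine a map up to a constant (`HasLog.eqOn`), and every
continuous curve in the Lie algebra is locally a logarithmic derivative (`exists_hasLog_curve`).

Contracting the Yang--Baxter equation with `ξ ⊗ η ⊗ id` shows that the span `p` of the components
of `r` is a subalgebra (`lie_mem_componentSpan`).

*Hamiltonian flows.* In the left trivialization, the Hamiltonian field of `f` at `g` is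
`u - Ad g⁻¹ w`, where `u` and `w` are components of `r`, hence in `p` (`hamiltonianField_eq`).
If `α` and `b` solve `α⁻¹ α' = w` and `b⁻¹ b' = u`, then `α γ b⁻¹` is constant along an integral
curve `γ`; as `α` and `b` run in `P`, the curve stays in its double coset
(`IsBracketClosed.eventually_mem_doubleCoset`).

*Submanifolds.* Products of one-parameter groups give a chart `φ : p → G` of the leaf through `1` of
the left invariant distribution `p` (`exists_isLeafChart`). It is part of a foliated chart
(`IsLeafChart.exists_foliated_chart`): a map whose logarithmic derivatives lie in `p`, and which
passes through `1`, factors locally through `φ`. Therefore the filter `𝓕 = map φ (𝓝 0)` satisfies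
`𝓕 * 𝓕 = 𝓕` and `a 𝓕 = 𝓕 a` for `a ∈ P`, and the filters `𝓕 g 𝓕` are the neighbourhood filters of
a topology on `G` in which `P t P` is open. For a complement `m` in `p` of the subalgebra
`{v ∈ p | Ad t v ∈ p}`, the map `(x, y) ↦ φ x * t * χ y` on `p × m` is an immersion into `G`, and a
local homeomorphism for the new topology (`IsLeafChart.exists_slice`); its translates by pairs of
elements of `P` form an atlas of `P t P`. Second countability holds because `P t P` is a countable
union of continuous images of finite-dimensional spaces, each element of `P` being a finite product
of values of `φ`.
-/

open Filter Set
open scoped Topology Pointwise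

noncomputable section


/-! ### The chart at the identity -/

section Coordinates

variable (E : Type*) [NormedAddCommGroup E] (G : Type*) [TopologicalSpace G] [ChartedSpace E G]
  [Group G]

variable {G} in
/-- The preferred chart of `G` at `1`, translated so that it sends `1` to `0`; its values outside
the source of the chart are junk. The model space `E` is identified with the Lie algebra `T₁ G`
through this chart. -/
def lg (g : G) : E := chartAt E (1 : G) g - chartAt E (1 : G) 1

variable {E} in
/-- The inverse of the chart `lg`, with junk values outside the range of the chart. -/
def ex (x : E) : G := (chartAt E (1 : G)).symm (x + chartAt E (1 : G) 1)

@[simp] theorem lg_one : lg E (1 : G) = 0 := by simp [lg]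

@[simp] theorem ex_zero : ex G (0 : E) = 1 := by
  simp [ex, (chartAt E (1 : G)).left_inv (mem_chart_source E (1 : G))]

variable {G} in
theorem ex_lg {g : G} (hg : g ∈ (chartAt E (1 : G)).source) : ex G (lg E g) = g := by
  simp [ex, lg, (chartAt E (1 : G)).left_inv hg]

theorem eventually_ex_lg : ∀ᶠ g in 𝓝 (1 : G), ex G (lg E g) = g := by
  filter_upwards [chart_source_mem_nhds E (1 : G)] with g hg using ex_lg E hg

theorem eventually_lg_ex : ∀ᶠ x in 𝓝 (0 : E), lg E (ex G x) = x := by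
  have h : Tendsto (fun x : E => x + chartAt E (1 : G) 1) (𝓝 0) (𝓝 (chartAt E (1 : G) 1)) := by
    have : Continuous (fun x : E => x + chartAt E (1 : G) 1) := by fun_prop
    simpa using this.tendsto 0
  filter_upwards [h (chart_target_mem_nhds E (1 : G))] with x hx
  simp [ex, lg, (chartAt E (1 : G)).right_inv hx]

theorem eventually_continuousAt_ex : ∀ᶠ x in 𝓝 (0 : E), ContinuousAt (ex G) x := by
  have hc : Continuous (fun x : E => x + chartAt E (1 : G) 1) := by fun_prop
  have h : Tendsto (fun x : E => x + chartAt E (1 : G) 1) (𝓝 0) (𝓝 (chartAt E (1 : G) 1)) := by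
    simpa using hc.tendsto 0
  filter_upwards [h (chart_target_mem_nhds E (1 : G))] with x hx
  exact ContinuousAt.comp (f := fun x : E => x + chartAt E (1 : G) 1)
    ((chartAt E (1 : G)).continuousAt_symm hx) hc.continuousAt

variable {𝕜 : Type*} [NontriviallyNormedField 𝕜] [NormedSpace 𝕜 E]

variable (𝕜) in
theorem contMDiffAt_lg [IsManifold 𝓘(𝕜, E) ∞ G] : ContMDiffAt 𝓘(𝕜, E) 𝓘(𝕜, E) ∞ (lg E) (1 : G) := by
  have h1 : ContMDiffAt 𝓘(𝕜, E) 𝓘(𝕜, E) ∞ (chartAt E (1 : G)) (1 : G) :=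
    contMDiffAt_extChartAt (I := 𝓘(𝕜, E))
  have h2 : ContMDiffAt 𝓘(𝕜, E) 𝓘(𝕜, E) ∞ (fun y : E => y - chartAt E (1 : G) 1)
      (chartAt E (1 : G) 1) := (contDiff_id.sub contDiff_const).contDiffAt.contMDiffAt
  exact h2.comp (1 : G) h1

variable (𝕜) in
theorem contMDiffAt_ex [IsManifold 𝓘(𝕜, E) ∞ G] : ContMDiffAt 𝓘(𝕜, E) 𝓘(𝕜, E) ∞ (ex G) (0 : E) := by
  have h1 : ContMDiffAt 𝓘(𝕜, E) 𝓘(𝕜, E) ∞ (chartAt E (1 : G)).symm (0 + chartAt E (1 : G) 1) := by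
    rw [zero_add]
    have := contMDiffOn_extChartAt_symm (I := 𝓘(𝕜, E)) (n := ∞) (1 : G)
    exact (this _ (mem_extChartAt_target (I := 𝓘(𝕜, E)) (1 : G))).contMDiffAt
      (extChartAt_target_mem_nhds (I := 𝓘(𝕜, E)) (1 : G))
  have h2 : ContMDiffAt 𝓘(𝕜, E) 𝓘(𝕜, E) ∞ (fun y : E => y + chartAt E (1 : G) 1) 0 :=
    (contDiff_id.add contDiff_const).contDiffAt.contMDiffAt
  exact h1.comp (0 : E) h2

variable (𝕜) in
theorem continuousAt_lg [IsManifold 𝓘(𝕜, E) ∞ G] : ContinuousAt (lg E) (1 : G) :=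
  (contMDiffAt_lg E G 𝕜).continuousAt

variable (𝕜) in
theorem continuousAt_ex [IsManifold 𝓘(𝕜, E) ∞ G] : ContinuousAt (ex G) (0 : E) :=
  (contMDiffAt_ex E G 𝕜).continuousAt

end Coordinates

section Calculus

variable {𝕜 : Type*} [RCLike 𝕜] {E : Type*} [NormedAddCommGroup E] [NormedSpace 𝕜 E]
  {G : Type*} [TopologicalSpace G] [ChartedSpace E G] [Group G]

/-- Composing a smooth map into `G` with value `1` with the chart at `1`. -/
theorem contDiffAt_lg_comp [LieGroup 𝓘(𝕜, E) ∞ G] {F : Type*} [NormedAddCommGroup F]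
    [NormedSpace 𝕜 F] {f : F → G} {x : F} (hf : ContMDiffAt 𝓘(𝕜, F) 𝓘(𝕜, E) ∞ f x)
    (h1 : f x = 1) : ContDiffAt 𝕜 ∞ (fun y => lg E (f y)) x := by
  have h := contMDiffAt_lg E G 𝕜
  rw [← h1] at h
  exact (h.comp x hf).contDiffAt

theorem contMDiffAt_ex_comp [LieGroup 𝓘(𝕜, E) ∞ G] {F : Type*} [NormedAddCommGroup F]
    [NormedSpace 𝕜 F] {f : F → E} {x : F} (hf : ContDiffAt 𝕜 ∞ f x)
    (h0 : f x = 0) : ContMDiffAt 𝓘(𝕜, F) 𝓘(𝕜, E) ∞ (fun y => ex G (f y)) x := by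
  have h := contMDiffAt_ex E G 𝕜
  rw [← h0] at h
  exact h.comp x hf.contMDiffAt

variable (E G) in
/-- The multiplication of `G` in the chart `lg`. -/
def mulC (p : E × E) : E := lg E (ex G p.1 * ex G p.2)

variable (E) in
/-- Conjugation by `a` in the chart `lg`. -/
def conjC (a : G) (x : E) : E := lg E (a * ex G x * a⁻¹)

variable (𝕜 E) in
/-- The adjoint representation of `G` on the model space `E`: the derivative of conjugation at the
identity, computed in the chart. -/
def Ad (a : G) : E →L[𝕜] E := fderiv 𝕜 (conjC E a) 0

variable (𝕜) in
theorem contDiffAt_mulC [LieGroup 𝓘(𝕜, E) ∞ G] : ContDiffAt 𝕜 ∞ (mulC E G) (0, 0) := by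
  apply contDiffAt_lg_comp _ (by simp)
  exact (contMDiffAt_ex_comp contDiffAt_fst rfl).mul (contMDiffAt_ex_comp contDiffAt_snd rfl)

variable (𝕜) in
theorem contDiffAt_conjC [LieGroup 𝓘(𝕜, E) ∞ G] (a : G) : ContDiffAt 𝕜 ∞ (conjC E a) 0 := by
  apply contDiffAt_lg_comp _ (by simp)
  exact (contMDiffAt_const.mul (contMDiffAt_ex_comp contDiffAt_id rfl)).mul contMDiffAt_const

theorem hasFDerivAt_conjC [LieGroup 𝓘(𝕜, E) ∞ G] (a : G) :
    HasFDerivAt (conjC E a) (Ad 𝕜 E a) 0 :=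
  ((contDiffAt_conjC 𝕜 a).differentiableAt (by simp)).hasFDerivAt

@[simp] theorem conjC_zero (a : G) : conjC E a 0 = 0 := by simp [conjC]

theorem eventually_mulC_right : ∀ᶠ x in 𝓝 (0 : E), mulC E G (x, 0) = x := by
  filter_upwards [eventually_lg_ex E G] with x hx using by simp [mulC, hx]

theorem eventually_mulC_left : ∀ᶠ x in 𝓝 (0 : E), mulC E G (0, x) = x := by
  filter_upwards [eventually_lg_ex E G] with x hx using by simp [mulC, hx]

theorem hasFDerivAt_mulC [LieGroup 𝓘(𝕜, E) ∞ G] :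
    HasFDerivAt (mulC E G) (ContinuousLinearMap.fst 𝕜 E E + ContinuousLinearMap.snd 𝕜 E E)
      (0, 0) := by
  have hd := ((contDiffAt_mulC (E := E) (G := G) 𝕜).differentiableAt (by simp)).hasFDerivAt
  refine hd.congr_fderiv ?_
  have h1 : HasFDerivAt (fun x : E => mulC E G (x, 0)) ((fderiv 𝕜 (mulC E G) (0, 0)).comp
      (ContinuousLinearMap.inl 𝕜 E E)) 0 :=
    HasFDerivAt.comp (g := mulC E G) (f := fun x : E => (x, (0 : E))) (0 : E) hd
      (hasFDerivAt_prodMk_left (0 : E) (0 : E))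
  have h2 : HasFDerivAt (fun x : E => mulC E G (0, x)) ((fderiv 𝕜 (mulC E G) (0, 0)).comp
      (ContinuousLinearMap.inr 𝕜 E E)) 0 :=
    HasFDerivAt.comp (g := mulC E G) (f := fun x : E => ((0 : E), x)) (0 : E) hd
      (hasFDerivAt_prodMk_right (0 : E) (0 : E))
  have e1 := h1.unique ((hasFDerivAt_id (𝕜 := 𝕜) (0 : E)).congr_of_eventuallyEq eventually_mulC_right)
  have e2 := h2.unique ((hasFDerivAt_id (𝕜 := 𝕜) (0 : E)).congr_of_eventuallyEq eventually_mulC_left)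
  ext v
  · simpa using DFunLike.congr_fun e1 v
  · simpa using DFunLike.congr_fun e2 v

/-! ### Left logarithmic derivatives -/

/-- `f : F → G` has left logarithmic derivative `A : F → 𝔤` at `x` over the field `K` (which is
`𝕜` or `ℝ`): `A` is the derivative at `x` of `y ↦ (f x)⁻¹ f y`, read in the chart at `1`. -/
structure HasLog {K : Type*} [NontriviallyNormedField K] [NormedSpace K E] {F : Type*}
    [NormedAddCommGroup F] [NormedSpace K F] (f : F → G) (x : F) (A : F →L[K] E) : Prop where
  continuousAt : ContinuousAt f x
  hasFDerivAt : HasFDerivAt (fun y => lg E ((f x)⁻¹ * f y)) A x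

variable {K : Type*} [NontriviallyNormedField K] [NormedSpace K E]
  {F : Type*} [NormedAddCommGroup F] [NormedSpace K F]

theorem HasLog.tendsto_one [LieGroup 𝓘(𝕜, E) ∞ G] {f : F → G} {x : F} {A : F →L[K] E}
    (hf : HasLog f x A) : Tendsto (fun y => (f x)⁻¹ * f y) (𝓝 x) (𝓝 1) := by
  have := topologicalGroup_of_lieGroup 𝓘(𝕜, E) ∞ (G := G)
  simpa using (tendsto_const_nhds (x := (f x)⁻¹)).mul hf.continuousAt.tendsto

theorem hasLog_const (a : G) (x : F) : HasLog (fun _ : F => a) x (0 : F →L[K] E) :=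
  ⟨continuousAt_const, by simpa using hasFDerivAt_const (𝕜 := K) (0 : E) x⟩

variable [NormedAlgebra K 𝕜] [IsScalarTower K 𝕜 E]

/-- The product rule for left logarithmic derivatives, from
`(f x g x)⁻¹ f y g y = (g x)⁻¹ ((f x)⁻¹ f y) g x * (g x)⁻¹ g y`. -/
theorem HasLog.mul [LieGroup 𝓘(𝕜, E) ∞ G] {f g : F → G} {x : F} {A B : F →L[K] E}
    (hf : HasLog f x A) (hg : HasLog g x B) :
    HasLog (fun y => f y * g y) x (((Ad 𝕜 E (g x)⁻¹).restrictScalars K).comp A + B) := by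
  have := topologicalGroup_of_lieGroup 𝓘(𝕜, E) ∞ (G := G)
  refine ⟨hf.1.mul hg.1, ?_⟩
  have h1 := hf.tendsto_one (𝕜 := 𝕜) (eventually_ex_lg E G)
  have h2 := hg.tendsto_one (𝕜 := 𝕜) (eventually_ex_lg E G)
  have h3 : Tendsto (fun y => (g x)⁻¹ * ((f x)⁻¹ * f y) * g x) (𝓝 x) (𝓝 1) := by
    simpa using ((tendsto_const_nhds (x := (g x)⁻¹)).mul (hf.tendsto_one (𝕜 := 𝕜))).mul
      (tendsto_const_nhds (x := g x))
  have hc : HasFDerivAt (fun y => conjC E (g x)⁻¹ (lg E ((f x)⁻¹ * f y)))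
      (((Ad 𝕜 E (g x)⁻¹).restrictScalars K).comp A) x := by
    refine HasFDerivAt.comp x (g := conjC E (g x)⁻¹) ?_ hf.2
    simpa using (hasFDerivAt_conjC (𝕜 := 𝕜) (E := E) (g x)⁻¹).restrictScalars K
  have hm : HasFDerivAt (fun y => mulC E G (conjC E (g x)⁻¹ (lg E ((f x)⁻¹ * f y)),
      lg E ((g x)⁻¹ * g y))) ((((Ad 𝕜 E (g x)⁻¹).restrictScalars K).comp A) + B) x := by
    have := (hasFDerivAt_mulC (𝕜 := 𝕜) (E := E) (G := G)).restrictScalars K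
    refine (HasFDerivAt.comp x (g := mulC E G) (by simpa using this)
      (hc.prodMk hg.2)).congr_fderiv ?_
    ext v
    simp
  refine hm.congr_of_eventuallyEq ?_
  filter_upwards [h1, h2, h3 (eventually_ex_lg E G)] with y e1 e2 e3
  simp only [mem_ofPred_eq, mem_preimage] at e1 e2 e3
  simp only [mulC, conjC, e1, e2, inv_inv, e3]
  congr 1
  group

theorem eventually_ex_inv_lg [LieGroup 𝓘(𝕜, E) ∞ G] :
    ∀ᶠ x in 𝓝 (0 : E), ex G (lg E (ex G x)⁻¹) = (ex G x)⁻¹ := by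
  have := topologicalGroup_of_lieGroup 𝓘(𝕜, E) ∞ (G := G)
  have h : Tendsto (fun x : E => (ex G x)⁻¹) (𝓝 0) (𝓝 1) := by
    simpa using (continuousAt_ex E G 𝕜).tendsto.inv
  exact h (eventually_ex_lg E G)

theorem hasFDerivAt_invC [LieGroup 𝓘(𝕜, E) ∞ G] :
    HasFDerivAt (fun x : E => lg E (ex G x)⁻¹) (-ContinuousLinearMap.id 𝕜 E) 0 := by
  have hc : ContDiffAt 𝕜 ∞ (fun x : E => lg E (ex G x)⁻¹) 0 :=
    contDiffAt_lg_comp (contMDiffAt_ex_comp contDiffAt_id rfl).inv (by simp)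
  have hd := (hc.differentiableAt (by simp)).hasFDerivAt
  have h1 : HasFDerivAt (fun x : E => mulC E G (x, lg E (ex G x)⁻¹))
      (ContinuousLinearMap.id 𝕜 E + fderiv 𝕜 (fun x : E => lg E (ex G x)⁻¹) 0) 0 := by
    refine (HasFDerivAt.comp (0 : E) (g := mulC E G) (by simpa using hasFDerivAt_mulC)
      ((hasFDerivAt_id (0 : E)).prodMk hd)).congr_fderiv ?_
    ext v
    simp
  have h2 : HasFDerivAt (fun x : E => mulC E G (x, lg E (ex G x)⁻¹)) (0 : E →L[𝕜] E) 0 := by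
    refine (hasFDerivAt_const (0 : E) (0 : E)).congr_of_eventuallyEq ?_
    filter_upwards [eventually_ex_inv_lg (𝕜 := 𝕜) (E := E) (G := G)] with x hx
    simp [mulC, hx]
  have h3 := h1.unique h2
  rwa [eq_neg_of_add_eq_zero_right h3] at hd

/-- The inverse rule for left logarithmic derivatives, from
`f x (f y)⁻¹ = f x ((f x)⁻¹ f y)⁻¹ (f x)⁻¹`. -/
theorem HasLog.inv [LieGroup 𝓘(𝕜, E) ∞ G] {f : F → G} {x : F} {A : F →L[K] E}
    (hf : HasLog f x A) :
    HasLog (fun y => (f y)⁻¹) x (-((Ad 𝕜 E (f x)).restrictScalars K).comp A) := by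
  have := topologicalGroup_of_lieGroup 𝓘(𝕜, E) ∞ (G := G)
  refine ⟨hf.1.inv, ?_⟩
  have h1 := hf.tendsto_one (𝕜 := 𝕜) (eventually_ex_lg E G)
  have h2 : Tendsto (fun y => lg E ((f x)⁻¹ * f y)) (𝓝 x) (𝓝 0) := by
    simpa using hf.2.continuousAt.tendsto
  have hc : HasFDerivAt (fun y => conjC E (f x) (lg E (ex G (lg E ((f x)⁻¹ * f y)))⁻¹))
      (-((Ad 𝕜 E (f x)).restrictScalars K).comp A) x := by
    have hi := (hasFDerivAt_invC (𝕜 := 𝕜) (E := E) (G := G)).restrictScalars K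
    have h3 : HasFDerivAt (fun y => lg E (ex G (lg E ((f x)⁻¹ * f y)))⁻¹) (-A) x := by
      refine (HasFDerivAt.comp x (g := fun z : E => lg E (ex G z)⁻¹) (by simpa using hi)
        hf.2).congr_fderiv ?_
      ext v
      simp
    refine (HasFDerivAt.comp x (g := conjC E (f x))
      (g' := (Ad 𝕜 E (f x)).restrictScalars K) ?_ h3).congr_fderiv ?_
    · simpa using (hasFDerivAt_conjC (𝕜 := 𝕜) (E := E) (f x)).restrictScalars K
    · ext v
      simp
  refine hc.congr_of_eventuallyEq ?_
  filter_upwards [h1, h2 (eventually_ex_inv_lg (𝕜 := 𝕜) (G := G))] with y e1 e2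
  simp only [mem_ofPred_eq, mem_preimage] at e1 e2
  simp only [conjC, e2]
  simp only [e1]
  congr 1
  group

end Calculus

section LogCalculus

variable {𝕜 : Type*} [RCLike 𝕜] {E : Type*} [NormedAddCommGroup E] [NormedSpace 𝕜 E]
  {G : Type*} [TopologicalSpace G] [ChartedSpace E G] [Group G]

section General

variable {K : Type*} [NontriviallyNormedField K] [NormedSpace K E]
  {F : Type*} [NormedAddCommGroup F] [NormedSpace K F]
  {F' : Type*} [NormedAddCommGroup F'] [NormedSpace K F']

theorem HasLog.congr_of_eventuallyEq {f g : F → G} {x : F} {A : F →L[K] E}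
    (hf : HasLog f x A) (h : g =ᶠ[𝓝 x] f) : HasLog g x A := by
  refine ⟨hf.1.congr h.symm, hf.2.congr_of_eventuallyEq ?_⟩
  filter_upwards [h] with y hy
  rw [hy, h.self_of_nhds]

theorem HasLog.congr_log {f : F → G} {x : F} {A B : F →L[K] E}
    (hf : HasLog f x A) (h : A = B) : HasLog f x B := h ▸ hf

theorem HasLog.unique {f : F → G} {x : F} {A B : F →L[K] E}
    (hf : HasLog f x A) (hf' : HasLog f x B) : A = B := hf.2.unique hf'.2

theorem HasLog.comp {f : F → G} {A : F →L[K] E} {h : F' → F} {h' : F' →L[K] F} {x : F'}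
    (hf : HasLog f (h x) A) (hh : HasFDerivAt h h' x) :
    HasLog (fun y => f (h y)) x (A.comp h') :=
  ⟨hf.1.comp hh.continuousAt,
    HasFDerivAt.comp x (g := fun y => lg E ((f (h x))⁻¹ * f y)) hf.2 hh⟩

theorem HasLog.restrictScalars [NormedAlgebra K 𝕜] [NormedSpace 𝕜 F] [IsScalarTower K 𝕜 E]
    [IsScalarTower K 𝕜 F] {f : F → G} {x : F} {A : F →L[𝕜] E} (hf : HasLog f x A) :
    HasLog f x (A.restrictScalars K) :=
  ⟨hf.1, hf.2.restrictScalars K⟩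

variable (𝕜) in
theorem HasLog.const_mul [LieGroup 𝓘(𝕜, E) ∞ G] {f : F → G} {x : F} {A : F →L[K] E}
    (hf : HasLog f x A) (a : G) : HasLog (fun y => a * f y) x A := by
  have := topologicalGroup_of_lieGroup 𝓘(𝕜, E) ∞ (G := G)
  refine ⟨hf.1.const_mul a, ?_⟩
  convert hf.2 using 3
  group

end General

/-! ### The adjoint representation -/

variable [LieGroup 𝓘(𝕜, E) ∞ G]

variable (𝕜) in
include 𝕜 in
theorem tendsto_conj_ex (a : G) : Tendsto (fun x : E => a * ex G x * a⁻¹) (𝓝 0) (𝓝 1) := by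
  have := topologicalGroup_of_lieGroup 𝓘(𝕜, E) ∞ (G := G)
  simpa using ((tendsto_const_nhds (x := a)).mul (continuousAt_ex E G 𝕜).tendsto).mul
    (tendsto_const_nhds (x := a⁻¹))

variable (𝕜 E) in
theorem Ad_one : Ad 𝕜 E (1 : G) = ContinuousLinearMap.id 𝕜 E := by
  refine (hasFDerivAt_conjC (𝕜 := 𝕜) (E := E) (1 : G)).unique
    ((hasFDerivAt_id (0 : E)).congr_of_eventuallyEq ?_)
  filter_upwards [eventually_lg_ex E G] with x hx
  simp [conjC, hx]

variable (𝕜 E) in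
theorem Ad_mul (a b : G) : Ad 𝕜 E (a * b) = (Ad 𝕜 E a).comp (Ad 𝕜 E b) := by
  refine (hasFDerivAt_conjC (𝕜 := 𝕜) (E := E) (a * b)).unique
    ((HasFDerivAt.comp (0 : E) (g := conjC E a) (by simpa using hasFDerivAt_conjC a)
      (hasFDerivAt_conjC b)).congr_of_eventuallyEq ?_)
  filter_upwards [tendsto_conj_ex 𝕜 b (eventually_ex_lg E G)] with x hx
  simp only [mem_ofPred_eq, mem_preimage] at hx
  simp only [Function.comp_apply, conjC, hx]
  congr 1
  group

theorem Ad_mul_apply (a b : G) (v : E) : Ad 𝕜 E (a * b) v = Ad 𝕜 E a (Ad 𝕜 E b v) := by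
  rw [Ad_mul]; rfl

@[simp] theorem Ad_inv_apply_self (a : G) (v : E) : Ad 𝕜 E a⁻¹ (Ad 𝕜 E a v) = v := by
  rw [← Ad_mul_apply]; simp [Ad_one]

@[simp] theorem Ad_apply_inv_self (a : G) (v : E) : Ad 𝕜 E a (Ad 𝕜 E a⁻¹ v) = v := by
  rw [← Ad_mul_apply]; simp [Ad_one]

/-! ### Left invariant fields in the chart -/

variable (𝕜 G) in
/-- `frame z v` is the value at `z`, in the chart at `1`, of the left invariant vector field
with value `v` at the identity. -/
def frame (z : E) : E →L[𝕜] E := fderiv 𝕜 (fun y => mulC E G (z, y)) 0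

variable (𝕜 E G) in
theorem contDiffAt_frame : ContDiffAt 𝕜 ∞ (frame 𝕜 G : E → E →L[𝕜] E) 0 := by
  have h : ContDiffAt 𝕜 ∞ (Function.uncurry fun z y : E => mulC E G (z, y)) (0, (0 : E)) :=
    contDiffAt_mulC 𝕜
  exact ContDiffAt.fderiv h contDiffAt_const (by simp)

variable (𝕜 E G) in
theorem eventually_hasFDerivAt_frame :
    ∀ᶠ z in 𝓝 (0 : E), HasFDerivAt (fun y => mulC E G (z, y)) (frame 𝕜 G z) 0 := by
  have h1 : ∀ᶠ p in 𝓝 ((0 : E), (0 : E)), ContDiffAt 𝕜 1 (mulC E G) p :=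
    ((contDiffAt_mulC 𝕜).of_le (by simp)).eventually (by simp)
  have h2 : Tendsto (fun z : E => (z, (0 : E))) (𝓝 0) (𝓝 (0, 0)) :=
    (Continuous.prodMk_left (0 : E)).tendsto 0
  filter_upwards [h2 h1] with z hz
  simp only [mem_ofPred_eq, mem_preimage] at hz
  have h3 : DifferentiableAt 𝕜 (fun y => mulC E G (z, y)) 0 :=
    DifferentiableAt.comp (g := mulC E G) (f := fun y : E => (z, y)) (0 : E)
      (ContDiffAt.differentiableAt hz (by simp)) (by fun_prop)
  exact h3.hasFDerivAt

variable (𝕜 E G) in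
theorem frame_zero : frame 𝕜 G (0 : E) = ContinuousLinearMap.id 𝕜 E := by
  have h := (eventually_hasFDerivAt_frame 𝕜 E G).self_of_nhds
  exact h.unique ((hasFDerivAt_id (0 : E)).congr_of_eventuallyEq eventually_mulC_left)

variable (𝕜 E G) in
/-- Near `1` a map with left logarithmic derivative `A` has, in the chart at `1`, the derivative
`frame ∘ A`. -/
theorem eventually_lg_comp {K : Type*} [NontriviallyNormedField K] [NormedAlgebra K 𝕜]
    [NormedSpace K E] [IsScalarTower K 𝕜 E] (F : Type*) [NormedAddCommGroup F] [NormedSpace K F] :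
    ∀ᶠ g in 𝓝 (1 : G), ∀ (f : F → G) (x : F) (A : F →L[K] E), f x = g → HasLog f x A →
      HasFDerivAt (fun y => lg E (f y)) (((frame 𝕜 G (lg E g)).restrictScalars K).comp A) x := by
  have h1 : Tendsto (lg E : G → E) (𝓝 1) (𝓝 0) := by
    simpa using (continuousAt_lg E G 𝕜).tendsto
  filter_upwards [eventually_ex_lg E G, h1 (eventually_hasFDerivAt_frame 𝕜 E G)] with g hg hF
    f x A hfx hf
  simp only [mem_ofPred_eq, mem_preimage] at hF
  have h2 : HasFDerivAt (fun y => mulC E G (lg E g, lg E ((f x)⁻¹ * f y)))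
      (((frame 𝕜 G (lg E g)).restrictScalars K).comp A) x := by
    refine HasFDerivAt.comp x (g := fun y => mulC E G (lg E g, y))
      (g' := (frame 𝕜 G (lg E g)).restrictScalars K) ?_ hf.2
    simpa using hF.restrictScalars K
  refine h2.congr_of_eventuallyEq ?_
  filter_upwards [hf.tendsto_one (𝕜 := 𝕜) (eventually_ex_lg E G)] with y hy
  simp only [mem_ofPred_eq, mem_preimage] at hy
  simp only [mulC, hg, hy]
  rw [← hfx, mul_inv_cancel_left]

variable (𝕜 E G) in
include 𝕜 in
theorem tendsto_ex_mul_ex :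
    Tendsto (fun p : E × E => ex G p.1 * ex G p.2) (𝓝 (0, 0)) (𝓝 1) := by
  have := topologicalGroup_of_lieGroup 𝓘(𝕜, E) ∞ (G := G)
  have h : Tendsto (ex G) (𝓝 (0 : E)) (𝓝 1) := by simpa using (continuousAt_ex E G 𝕜).tendsto
  rw [nhds_prod_eq]
  simpa using (h.comp tendsto_fst).mul (h.comp tendsto_snd)

variable (𝕜 E G) in
/-- Near `0` a map with derivative `frame ∘ A` in the chart at `1` has left logarithmic
derivative `A`. -/
theorem eventually_hasLog_ex {K : Type*} [NontriviallyNormedField K] [NormedAlgebra K 𝕜]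
    [NormedSpace K E] [IsScalarTower K 𝕜 E] (F : Type*) [NormedAddCommGroup F] [NormedSpace K F] :
    ∀ᶠ z in 𝓝 (0 : E), ∀ (f : F → E) (x : F) (A : F →L[K] E), f x = z →
      HasFDerivAt f (((frame 𝕜 G z).restrictScalars K).comp A) x →
      HasLog (fun y => ex G (f y)) x A := by
  have htg := topologicalGroup_of_lieGroup 𝓘(𝕜, E) ∞ (G := G)
  -- `L z y` is the chart of `(ex z)⁻¹ * ex y`, inverse to `y ↦ mulC (z, y)`
  let L : E × E → E := fun p => lg E ((ex G p.1)⁻¹ * ex G p.2)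
  have hL : ContDiffAt 𝕜 ∞ L (0, 0) := by
    apply contDiffAt_lg_comp _ (by simp)
    exact (contMDiffAt_ex_comp contDiffAt_fst rfl).inv.mul
      (contMDiffAt_ex_comp contDiffAt_snd rfl)
  have hL1 : ∀ᶠ p in 𝓝 ((0 : E), (0 : E)), ContDiffAt 𝕜 1 L p :=
    (hL.of_le (by simp)).eventually (by simp)
  have hd : Tendsto (fun z : E => (z, z)) (𝓝 0) (𝓝 ((0 : E), (0 : E))) := by
    have : Continuous (fun z : E => (z, z)) := by fun_prop
    exact this.tendsto 0
  have hm : ∀ᶠ p in 𝓝 ((0 : E), (0 : E)), ex G (mulC E G p) = ex G p.1 * ex G p.2 ∧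
      lg E (ex G p.2) = p.2 := by
    refine ((tendsto_ex_mul_ex 𝕜 E G).eventually (eventually_ex_lg E G)).and ?_
    rw [nhds_prod_eq]
    exact tendsto_snd.eventually (eventually_lg_ex E G)
  have hm' : ∀ᶠ z in 𝓝 (0 : E), ∀ᶠ y in 𝓝 (0 : E), ex G (mulC E G (z, y)) = ex G z * ex G y ∧
      lg E (ex G y) = y := by
    rw [nhds_prod_eq] at hm
    exact hm.curry
  have hmr := eventually_mulC_right (E := E) (G := G)
  have hc := eventually_continuousAt_ex E G
  filter_upwards [eventually_hasFDerivAt_frame 𝕜 E G, hd hL1, hm', hmr, hc]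
    with z hF hLz hmz hrz hcz f x A hfx hf
  simp only [mem_ofPred_eq, mem_preimage] at hLz
  have hLd : HasFDerivAt (fun y => L (z, y)) (fderiv 𝕜 (fun y => L (z, y)) z) z := by
    have : DifferentiableAt 𝕜 (fun y => L (z, y)) z :=
      DifferentiableAt.comp (g := L) (f := fun y : E => (z, y)) z
        (hLz.differentiableAt (by simp)) (by fun_prop)
    exact this.hasFDerivAt
  have hcomp : (fderiv 𝕜 (fun y => L (z, y)) z).comp (frame 𝕜 G z) =
      ContinuousLinearMap.id 𝕜 E := by
    have h1 : HasFDerivAt (fun y => L (z, mulC E G (z, y)))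
        ((fderiv 𝕜 (fun y => L (z, y)) z).comp (frame 𝕜 G z)) 0 := by
      refine HasFDerivAt.comp (0 : E) (g := fun y => L (z, y)) ?_ hF
      simpa [hrz] using hLd
    refine h1.unique ((hasFDerivAt_id (0 : E)).congr_of_eventuallyEq ?_)
    filter_upwards [hmz] with y hy
    simp [L, hy.1, hy.2]
  subst hfx
  refine ⟨ContinuousAt.comp (g := ex G) hcz hf.continuousAt, ?_⟩
  refine (HasFDerivAt.comp x (g := fun y => L (f x, y)) (hLd.restrictScalars K) hf).congr_fderiv ?_
  ext v
  simpa using DFunLike.congr_fun hcomp (A v)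

/-! ### Maps with vanishing logarithmic derivative -/

theorem HasLog.eventually_eq_of_zero {K : Type*} [RCLike K] [NormedAlgebra K 𝕜]
    [NormedSpace K E] [IsScalarTower K 𝕜 E] {F : Type*} [NormedAddCommGroup F] [NormedSpace K F]
    {f : F → G} {x : F} (hf : ∀ᶠ y in 𝓝 x, HasLog f y (0 : F →L[K] E)) :
    ∀ᶠ y in 𝓝 x, f y = f x := by
  let _ : NormedSpace ℝ F := NormedSpace.restrictScalars ℝ K F
  have h1 := hf.self_of_nhds.tendsto_one (𝕜 := 𝕜)
  have h2 := h1 (eventually_lg_comp 𝕜 E G (K := K) F)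
  have h3 := h1 (eventually_ex_lg E G)
  obtain ⟨δ, hδ, hball⟩ := Metric.eventually_nhds_iff_ball.1 ((hf.and h2).and h3)
  have hder : ∀ y ∈ Metric.ball x δ, HasFDerivAt (fun y => lg E ((f x)⁻¹ * f y))
      (0 : F →L[K] E) y := by
    intro y hy
    simpa using (hball y hy).1.2 _ y 0 rfl ((hball y hy).1.1.const_mul 𝕜 (f x)⁻¹)
  rw [Metric.eventually_nhds_iff_ball]
  refine ⟨δ, hδ, fun y hy => ?_⟩
  have h4 : lg E ((f x)⁻¹ * f y) = lg E ((f x)⁻¹ * f x) :=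
    Metric.isOpen_ball.is_const_of_fderiv_eq_zero (𝕜 := K)
      (f := fun y => lg E ((f x)⁻¹ * f y)) (convex_ball x δ).isPreconnected
      (fun z hz => (hder z hz).differentiableAt.differentiableWithinAt)
      (fun z hz => (hder z hz).fderiv) hy (Metric.mem_ball_self hδ)
  have h5 : (f x)⁻¹ * f y = 1 := by
    have := (hball y hy).2
    simp only [mem_ofPred_eq] at this
    rw [← this, h4]
    simp
  exact (inv_mul_eq_one.1 h5).symm

theorem HasLog.eq_of_zero {K : Type*} [RCLike K] [NormedAlgebra K 𝕜]
    [NormedSpace K E] [IsScalarTower K 𝕜 E] {F : Type*} [NormedAddCommGroup F] [NormedSpace K F]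
    {f : F → G} {s : Set F} (hs : IsOpen s) (hc : IsPreconnected s)
    (hf : ∀ y ∈ s, HasLog f y (0 : F →L[K] E)) {x y : F} (hx : x ∈ s) (hy : y ∈ s) :
    f x = f y := by
  refine hc.induction₂ (fun a b => f a = f b) (fun a ha => ?_) (fun _ _ _ _ _ _ => Eq.trans)
    (fun _ _ _ _ => Eq.symm) hx hy
  have : ∀ᶠ b in 𝓝 a, HasLog f b (0 : F →L[K] E) := by
    filter_upwards [hs.mem_nhds ha] with b hb using hf b hb
  filter_upwards [(HasLog.eventually_eq_of_zero (𝕜 := 𝕜) this).filter_mono nhdsWithin_le_nhds]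
    with b hb using hb.symm

/-- Two maps with the same left logarithmic derivative on a connected open set, which agree at a
point, are equal. -/
theorem HasLog.eqOn {K : Type*} [RCLike K] [NormedAlgebra K 𝕜]
    [NormedSpace K E] [IsScalarTower K 𝕜 E] {F : Type*} [NormedAddCommGroup F] [NormedSpace K F]
    {f g : F → G} {A : F → F →L[K] E} {s : Set F} (hs : IsOpen s) (hc : IsPreconnected s)
    (hf : ∀ y ∈ s, HasLog f y (A y)) (hg : ∀ y ∈ s, HasLog g y (A y)) {x : F} (hx : x ∈ s)
    (hxy : f x = g x) : EqOn f g s := by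
  intro y hy
  have h : ∀ z ∈ s, HasLog (fun z => f z * (g z)⁻¹) z (0 : F →L[K] E) := fun z hz => by
    refine ((hf z hz).mul (𝕜 := 𝕜) ((hg z hz).inv (𝕜 := 𝕜))).congr_log ?_
    simp
  have := HasLog.eq_of_zero (𝕜 := 𝕜) hs hc h hx hy
  rw [hxy, mul_inv_cancel] at this
  exact (mul_inv_eq_one.1 this.symm)

end LogCalculus

section Bridge

variable {𝕜 : Type*} [RCLike 𝕜] {E : Type*} [NormedAddCommGroup E] [NormedSpace 𝕜 E]
  {G : Type*} [TopologicalSpace G] [ChartedSpace E G] [Group G]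

/-! ### Logarithmic derivatives and derivatives of maps between manifolds -/

theorem hasMFDerivAt_lg [IsManifold 𝓘(𝕜, E) ∞ G] :
    HasMFDerivAt 𝓘(𝕜, E) 𝓘(𝕜, E) (lg E) (1 : G) (ContinuousLinearMap.id 𝕜 E) := by
  have h : HasFDerivAt (fun y : E => y - chartAt E (1 : G) 1) (ContinuousLinearMap.id 𝕜 E)
    (chartAt E (1 : G) 1) := (hasFDerivAt_id _).sub_const _
  have h2 : HasFDerivWithinAt (writtenInExtChartAt 𝓘(𝕜, E) 𝓘(𝕜, E) (1 : G) (lg E))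
      (ContinuousLinearMap.id 𝕜 E) (range 𝓘(𝕜, E)) (extChartAt 𝓘(𝕜, E) (1 : G) 1) := by
    refine (h.congr_of_eventuallyEq ?_).hasFDerivWithinAt
    filter_upwards [chart_target_mem_nhds E (1 : G)] with y hy
    simp [lg, writtenInExtChartAt, chartAt_self_eq, (chartAt E (1 : G)).right_inv hy]
  exact ⟨continuousAt_lg E G 𝕜, h2⟩

theorem hasMFDerivAt_ex [IsManifold 𝓘(𝕜, E) ∞ G] :
    HasMFDerivAt 𝓘(𝕜, E) 𝓘(𝕜, E) (ex G) (0 : E) (ContinuousLinearMap.id 𝕜 E) := by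
  have h : HasFDerivAt (fun y : E => y + chartAt E (1 : G) 1) (ContinuousLinearMap.id 𝕜 E)
    0 := (hasFDerivAt_id _).add_const _
  have h2 : HasFDerivWithinAt (writtenInExtChartAt 𝓘(𝕜, E) 𝓘(𝕜, E) (0 : E) (ex G))
      (ContinuousLinearMap.id 𝕜 E) (range 𝓘(𝕜, E)) (extChartAt 𝓘(𝕜, E) (0 : E) 0) := by
    refine (h.congr_of_eventuallyEq ?_).hasFDerivWithinAt
    filter_upwards [eventually_lg_ex E G] with y hy
    simp only [lg, sub_eq_iff_eq_add] at hy
    simpa [writtenInExtChartAt, chartAt_self_eq] using hy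
  exact ⟨continuousAt_ex E G 𝕜, h2⟩

/-- Transport of a derivative along an equality of base points. -/
theorem HasMFDerivAt.of_eq {M M' : Type*} [TopologicalSpace M] [ChartedSpace E M]
    {E' : Type*} [NormedAddCommGroup E'] [NormedSpace 𝕜 E'] [TopologicalSpace M']
    [ChartedSpace E' M'] {f : M → M'} {a b : M} {D : E →L[𝕜] E'}
    (h : HasMFDerivAt 𝓘(𝕜, E) 𝓘(𝕜, E') f a D) (hab : a = b) :
    HasMFDerivAt 𝓘(𝕜, E) 𝓘(𝕜, E') f b D := by
  subst hab
  exact h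

variable [LieGroup 𝓘(𝕜, E) ∞ G]

variable (𝕜 E) in
/-- The derivative at `1` of left translation by `g`, as a continuous linear map of the model
space. -/
def dL (g : G) : E →L[𝕜] E := mfderiv 𝓘(𝕜, E) 𝓘(𝕜, E) (fun h : G => g * h) 1

theorem hasMFDerivAt_dL (g : G) :
    HasMFDerivAt 𝓘(𝕜, E) 𝓘(𝕜, E) (fun h : G => g * h) 1 (dL 𝕜 E g) :=
  (contMDiff_mul_left.contMDiffAt.mdifferentiableAt (n := ∞) (by simp)).hasMFDerivAt

/-- The ordinary derivative is the left translate of the logarithmic one. -/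
theorem HasLog.hasMFDerivAt {F : Type*} [NormedAddCommGroup F] [NormedSpace 𝕜 F]
    {f : F → G} {x : F} {A : F →L[𝕜] E} (hf : HasLog f x A) :
    HasMFDerivAt 𝓘(𝕜, F) 𝓘(𝕜, E) f x ((dL 𝕜 E (f x)).comp A) := by
  have h1 : HasMFDerivAt 𝓘(𝕜, F) 𝓘(𝕜, E) (fun y => lg E ((f x)⁻¹ * f y)) x A :=
    hf.2.hasMFDerivAt
  have h2 : HasMFDerivAt 𝓘(𝕜, F) 𝓘(𝕜, E) (fun y => ex G (lg E ((f x)⁻¹ * f y))) x A := by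
    have h3 : HasMFDerivAt 𝓘(𝕜, E) 𝓘(𝕜, E) (ex G) (lg E ((f x)⁻¹ * f x))
        (ContinuousLinearMap.id 𝕜 E) := hasMFDerivAt_ex.of_eq (by simp)
    have h4 := HasMFDerivAt.comp x h3 h1
    exact h4
  have h5 : HasMFDerivAt 𝓘(𝕜, E) 𝓘(𝕜, E) (fun h : G => f x * h)
      (ex G (lg E ((f x)⁻¹ * f x))) (dL 𝕜 E (f x)) :=
    (hasMFDerivAt_dL (𝕜 := 𝕜) (E := E) (f x)).of_eq (by simp)
  refine HasMFDerivAt.congr_of_eventuallyEq (HasMFDerivAt.comp x h5 h2) ?_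
  filter_upwards [(hf.tendsto_one (𝕜 := 𝕜)).eventually (eventually_ex_lg E G)] with y hy
  simp [hy]

/-- The derivative at `g` of left translation by `g⁻¹` is inverse to `dL g`. -/
theorem dL_inv_comp (g : G) :
    HasMFDerivAt 𝓘(𝕜, E) 𝓘(𝕜, E) (fun h : G => g⁻¹ * h) g (dL 𝕜 E g).inverse ∧
      (dL 𝕜 E g).inverse.comp (dL 𝕜 E g) = ContinuousLinearMap.id 𝕜 E ∧
      (dL 𝕜 E g).comp (dL 𝕜 E g).inverse = ContinuousLinearMap.id 𝕜 E := by
  let D : E →L[𝕜] E := mfderiv 𝓘(𝕜, E) 𝓘(𝕜, E) (fun h : G => g⁻¹ * h) g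
  have hD : HasMFDerivAt 𝓘(𝕜, E) 𝓘(𝕜, E) (fun h : G => g⁻¹ * h) g D :=
    (contMDiff_mul_left.contMDiffAt.mdifferentiableAt (n := ∞) (by simp)).hasMFDerivAt
  have h1 : D.comp (dL 𝕜 E g) = ContinuousLinearMap.id 𝕜 E := by
    have h2 : HasMFDerivAt 𝓘(𝕜, E) 𝓘(𝕜, E) (fun h : G => g⁻¹ * h) (g * 1) D :=
      hD.of_eq (by simp)
    have h3 := HasMFDerivAt.comp (1 : G) h2 (hasMFDerivAt_dL (𝕜 := 𝕜) (E := E) g)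
    have h4 : HasMFDerivAt 𝓘(𝕜, E) 𝓘(𝕜, E) ((fun h : G => g⁻¹ * h) ∘ fun h => g * h) 1
        (ContinuousLinearMap.id 𝕜 E) := by
      have : ((fun h : G => g⁻¹ * h) ∘ fun h => g * h) = id := by ext; simp
      rw [this]
      exact hasMFDerivAt_id (1 : G)
    exact hasMFDerivAt_unique h3 h4
  have h2 : (dL 𝕜 E g).comp D = ContinuousLinearMap.id 𝕜 E := by
    have h2 : HasMFDerivAt 𝓘(𝕜, E) 𝓘(𝕜, E) (fun h : G => g * h) (g⁻¹ * g) (dL 𝕜 E g) :=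
      (hasMFDerivAt_dL (𝕜 := 𝕜) (E := E) g).of_eq (by simp)
    have h3 := HasMFDerivAt.comp g h2 hD
    have h4 : HasMFDerivAt 𝓘(𝕜, E) 𝓘(𝕜, E) ((fun h : G => g * h) ∘ fun h => g⁻¹ * h) g
        (ContinuousLinearMap.id 𝕜 E) := by
      have : ((fun h : G => g * h) ∘ fun h => g⁻¹ * h) = id := by ext; simp
      rw [this]
      exact hasMFDerivAt_id g
    exact hasMFDerivAt_unique h3 h4
  have h3 : (dL 𝕜 E g).inverse = D := ContinuousLinearMap.inverse_eq h2 h1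
  rw [h3]
  exact ⟨hD, h1, h2⟩

theorem hasLog_of_hasMFDerivAt {F : Type*} [NormedAddCommGroup F] [NormedSpace 𝕜 F]
    {f : F → G} {x : F} {A : F →L[𝕜] E}
    (hf : HasMFDerivAt 𝓘(𝕜, F) 𝓘(𝕜, E) f x ((dL 𝕜 E (f x)).comp A)) : HasLog f x A := by
  obtain ⟨h1, h2, -⟩ := dL_inv_comp (𝕜 := 𝕜) (E := E) (f x)
  refine ⟨hf.continuousAt, ?_⟩
  have h3 : HasMFDerivAt 𝓘(𝕜, E) 𝓘(𝕜, E) (lg E) ((f x)⁻¹ * f x)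
      (ContinuousLinearMap.id 𝕜 E) :=
    (hasMFDerivAt_lg (𝕜 := 𝕜) (E := E) (G := G)).of_eq (by simp)
  have h4 := HasMFDerivAt.comp x h3 (HasMFDerivAt.comp x h1 hf)
  have h5 := h4.hasFDerivAt
  refine h5.congr_fderiv ?_
  ext v
  exact DFunLike.congr_fun h2 (A v)

theorem contMDiffAt_of_contDiffAt_lg {F : Type*} [NormedAddCommGroup F] [NormedSpace 𝕜 F]
    {f : F → G} {x : F} (hc : ContinuousAt f x)
    (h : ContDiffAt 𝕜 ∞ (fun y => lg E ((f x)⁻¹ * f y)) x) :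
    ContMDiffAt 𝓘(𝕜, F) 𝓘(𝕜, E) ∞ f x := by
  have := topologicalGroup_of_lieGroup 𝓘(𝕜, E) ∞ (G := G)
  have h1 := (contMDiffAt_const (c := f x) (I := 𝓘(𝕜, F)) (I' := 𝓘(𝕜, E)) (n := ∞)).mul
    (contMDiffAt_ex_comp (G := G) h (by simp))
  refine h1.congr_of_eventuallyEq ?_
  have h2 : Tendsto (fun y => (f x)⁻¹ * f y) (𝓝 x) (𝓝 1) := by
    simpa using (tendsto_const_nhds (x := (f x)⁻¹)).mul hc.tendsto
  filter_upwards [h2.eventually (eventually_ex_lg E G)] with y hy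
  simp [hy]

/-! ### The bracket in the chart at the identity -/

variable (𝕜 E G) in
/-- Mathlib's bracket of the Lie algebra of `G`, as an operation on the model space. -/
def brk (v w : E) : E :=
  Bracket.bracket (L := GroupLieAlgebra 𝓘(𝕜, E) G) (M := GroupLieAlgebra 𝓘(𝕜, E) G) v w

variable (𝕜 E G) in
/-- `frame` is the pullback of the left invariant vector fields under the inverse chart, which is
the form in which they enter Mathlib's bracket of vector fields. -/
theorem eventually_mfderivWithin_symm_comp_frame : ∀ᶠ z in 𝓝 (0 : E), ∀ v : E,
    (mfderivWithin 𝓘(𝕜, E) 𝓘(𝕜, E) (extChartAt 𝓘(𝕜, E) (1 : G)).symm (range 𝓘(𝕜, E))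
      (z + extChartAt 𝓘(𝕜, E) (1 : G) 1)).inverse (dL 𝕜 E (ex G z) v) = frame 𝕜 G z v := by
  have htr : Tendsto (fun x : E => x + chartAt E (1 : G) 1) (𝓝 0) (𝓝 (chartAt E (1 : G) 1)) := by
    have : Continuous (fun x : E => x + chartAt E (1 : G) 1) := by fun_prop
    simpa using this.tendsto 0
  have hm : ∀ᶠ z in 𝓝 (0 : E), ∀ᶠ y in 𝓝 (0 : E), ex G (mulC E G (z, y)) = ex G z * ex G y := by
    have := (tendsto_ex_mul_ex 𝕜 E G).eventually (eventually_ex_lg E G)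
    rw [nhds_prod_eq] at this
    exact this.curry
  filter_upwards [htr (extChartAt_target_mem_nhds (I := 𝓘(𝕜, E)) (1 : G)), hm,
    eventually_hasFDerivAt_frame 𝕜 E G, eventually_mulC_right (E := E) (G := G)]
    with z hz hmz hF hzr v
  have hinv := isInvertible_mfderivWithin_extChartAt_symm (I := 𝓘(𝕜, E)) hz
  have hd : MDifferentiableWithinAt 𝓘(𝕜, E) 𝓘(𝕜, E) (extChartAt 𝓘(𝕜, E) (1 : G)).symm
      (range 𝓘(𝕜, E)) (z + chartAt E (1 : G) 1) := mdifferentiableWithinAt_extChartAt_symm hz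
  let D : E →L[𝕜] E := mfderivWithin 𝓘(𝕜, E) 𝓘(𝕜, E) (extChartAt 𝓘(𝕜, E) (1 : G)).symm
      (range 𝓘(𝕜, E)) (z + chartAt E (1 : G) 1)
  have hD : HasMFDerivAt 𝓘(𝕜, E) 𝓘(𝕜, E) (extChartAt 𝓘(𝕜, E) (1 : G)).symm
      (z + chartAt E (1 : G) 1) D :=
    hd.hasMFDerivWithinAt.hasMFDerivAt (by simp)
  have hD2 : HasMFDerivAt 𝓘(𝕜, E) 𝓘(𝕜, E) (ex G) z D := by
    have ht : HasMFDerivAt 𝓘(𝕜, E) 𝓘(𝕜, E) (fun x : E => x + chartAt E (1 : G) 1) z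
        (ContinuousLinearMap.id 𝕜 E) := ((hasFDerivAt_id z).add_const _).hasMFDerivAt
    exact HasMFDerivAt.comp z hD ht
  let Fz : E →L[𝕜] E := frame 𝕜 G z
  have hF1 : HasMFDerivAt 𝓘(𝕜, E) 𝓘(𝕜, E) (fun y => mulC E G (z, y)) 0 Fz :=
    hF.hasMFDerivAt
  have h1 : HasMFDerivAt 𝓘(𝕜, E) 𝓘(𝕜, E) (fun y => ex G (mulC E G (z, y))) 0
      (D.comp Fz) :=
    HasMFDerivAt.comp (g := ex G) (f := fun y => mulC E G (z, y)) (0 : E) (hD2.of_eq hzr.symm) hF1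
  have h2 : HasMFDerivAt 𝓘(𝕜, E) 𝓘(𝕜, E) (fun y : E => ex G z * ex G y) 0
      ((dL 𝕜 E (ex G z)).comp (ContinuousLinearMap.id 𝕜 E)) :=
    HasMFDerivAt.comp (0 : E) ((hasMFDerivAt_dL (ex G z)).of_eq (ex_zero E G).symm)
      hasMFDerivAt_ex
  have h3 := hasMFDerivAt_unique (h1.congr_of_eventuallyEq (hmz.mono fun y hy => hy.symm)) h2
  have h4 : D (frame 𝕜 G z v) = dL 𝕜 E (ex G z) v := DFunLike.congr_fun h3 v
  rw [← h4]
  exact hinv.inverse_apply_eq.2 rfl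

/-- The bracket of the Lie algebra of `G`, expressed through left invariant fields in the chart. -/
theorem brk_eq_frame (v w : E) : brk 𝕜 E G v w =
    fderiv 𝕜 (fun z => frame 𝕜 G z w) 0 v - fderiv 𝕜 (fun z => frame 𝕜 G z v) 0 w := by
  let e : E := chartAt E (1 : G) 1
  -- near the image `e` of `1` in the chart of Mathlib, the left invariant fields are `frame`
  have key : ∀ u : E, (VectorField.mpullbackWithin 𝓘(𝕜, E) 𝓘(𝕜, E)
      (extChartAt 𝓘(𝕜, E) (1 : G)).symm (mulInvariantVectorField (I := 𝓘(𝕜, E)) (G := G) u)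
      (range 𝓘(𝕜, E)) : E → E) =ᶠ[𝓝 e] fun y => frame 𝕜 G (y - e) u := by
    intro u
    have ht : Tendsto (fun y : E => y - e) (𝓝 e) (𝓝 0) := by
      have : Continuous (fun y : E => y - e) := by fun_prop
      simpa using this.tendsto e
    filter_upwards [ht.eventually (eventually_mfderivWithin_symm_comp_frame 𝕜 E G)] with y hy
    have h1 := hy u
    have h2 : y - e + extChartAt 𝓘(𝕜, E) (1 : G) 1 = y := sub_add_cancel y e
    rw [h2] at h1
    rw [← h1]
    have h3 : ex G (y - e) = (extChartAt 𝓘(𝕜, E) (1 : G)).symm y := by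
      simp [ex, e]
    rw [h3]
    rfl
  have hid : (mfderiv 𝓘(𝕜, E) 𝓘(𝕜, E) (extChartAt 𝓘(𝕜, E) (1 : G)) 1).inverse =
      ContinuousLinearMap.id 𝕜 E := by
    rw [mfderiv_extChartAt_self]
    exact ContinuousLinearMap.inverse_id
  have hfd : ∀ u : E, fderiv 𝕜 (fun y => frame 𝕜 G (y - e) u) e =
      fderiv 𝕜 (fun z => frame 𝕜 G z u) 0 := by
    intro u
    rw [fderiv_comp_sub (f := fun z => frame 𝕜 G z u)]
    simp
  have hval : ∀ u : E, frame 𝕜 G (e - e) u = u := fun u => by simp [frame_zero 𝕜 E G]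
  have hs : (extChartAt 𝓘(𝕜, E) (1 : G)).symm ⁻¹' univ ∩ range 𝓘(𝕜, E) = univ := by simp
  have hVW : ∀ V W : E → E, V =ᶠ[𝓝 e] (fun y => frame 𝕜 G (y - e) v) →
      W =ᶠ[𝓝 e] (fun y => frame 𝕜 G (y - e) w) → ∀ s : Set E, s = univ →
      VectorField.lieBracketWithin 𝕜 V W s e =
      fderiv 𝕜 (fun z => frame 𝕜 G z w) 0 v - fderiv 𝕜 (fun z => frame 𝕜 G z v) 0 w := by
    rintro V W hV hW s rfl
    rw [VectorField.lieBracketWithin_univ, hV.lieBracket_vectorField_eq hW,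
      VectorField.lieBracket_eq]
    simp only [hfd, hval]
  have hL : VectorField.lieBracketWithin 𝕜 (VectorField.mpullbackWithin 𝓘(𝕜, E) 𝓘(𝕜, E)
      (extChartAt 𝓘(𝕜, E) (1 : G)).symm (mulInvariantVectorField (I := 𝓘(𝕜, E)) (G := G) v)
      (range 𝓘(𝕜, E))) (VectorField.mpullbackWithin 𝓘(𝕜, E) 𝓘(𝕜, E)
      (extChartAt 𝓘(𝕜, E) (1 : G)).symm (mulInvariantVectorField (I := 𝓘(𝕜, E)) (G := G) w)
      (range 𝓘(𝕜, E))) ((extChartAt 𝓘(𝕜, E) (1 : G)).symm ⁻¹' univ ∩ range 𝓘(𝕜, E)) e =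
      fderiv 𝕜 (fun z => frame 𝕜 G z w) 0 v - fderiv 𝕜 (fun z => frame 𝕜 G z v) 0 w :=
    hVW _ _ (key v) (key w) _ hs
  have h5 : brk 𝕜 E G v w = (mfderiv 𝓘(𝕜, E) 𝓘(𝕜, E) (extChartAt 𝓘(𝕜, E) (1 : G)) 1).inverse
    (fderiv 𝕜 (fun z => frame 𝕜 G z w) 0 v - fderiv 𝕜 (fun z => frame 𝕜 G z v) 0 w) := by
    rw [← hL]
    rfl
  rw [h5, hid]
  rfl

end Bridge

section AdjointDerivative

variable {𝕜 : Type*} [RCLike 𝕜] {E : Type*} [NormedAddCommGroup E] [NormedSpace 𝕜 E]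
  {G : Type*} [TopologicalSpace G] [ChartedSpace E G] [Group G] [LieGroup 𝓘(𝕜, E) ∞ G]

/-! ### The derivative of the adjoint representation -/

variable (𝕜 E G) in
theorem contDiffAt_Ad_ex (w : E) : ContDiffAt 𝕜 ∞ (fun z : E => Ad 𝕜 E (ex G z) w) 0 := by
  have h : ContDiffAt 𝕜 ∞ (Function.uncurry fun z y : E => conjC E (ex G z) y) (0, (0 : E)) := by
    apply contDiffAt_lg_comp _ (by simp)
    exact ((contMDiffAt_ex_comp contDiffAt_fst rfl).mul
      (contMDiffAt_ex_comp contDiffAt_snd rfl)).mul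
      (contMDiffAt_ex_comp contDiffAt_fst rfl).inv
  have h1 : ContDiffAt 𝕜 ∞ (fun z : E => fderiv 𝕜 (conjC E (ex G z)) 0) 0 :=
    ContDiffAt.fderiv h contDiffAt_const (by simp)
  exact h1.clm_apply contDiffAt_const

variable (𝕜 E G) in
/-- The derivative at `y = 0` of the identity `(g y g⁻¹) g = g y` for `g = ex z`. -/
theorem eventually_Ad_ex : ∀ᶠ z in 𝓝 (0 : E), ∀ w : E,
    fderiv 𝕜 (mulC E G) (0, z) (Ad 𝕜 E (ex G z) w, 0) = frame 𝕜 G z w := by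
  have hd : ∀ᶠ p in 𝓝 ((0 : E), (0 : E)), ContDiffAt 𝕜 1 (mulC E G) p :=
    ((contDiffAt_mulC 𝕜).of_le (by simp)).eventually (by simp)
  have ht : Tendsto (fun z : E => ((0 : E), z)) (𝓝 0) (𝓝 (0, 0)) :=
    (Continuous.prodMk_right (0 : E)).tendsto 0
  filter_upwards [ht.eventually hd, eventually_hasFDerivAt_frame 𝕜 E G] with z hz hF w
  have h1 : HasFDerivAt (fun y => mulC E G (conjC E (ex G z) y, z))
      ((fderiv 𝕜 (mulC E G) (0, z)).comp ((Ad 𝕜 E (ex G z)).prod 0)) 0 := by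
    refine HasFDerivAt.comp (0 : E) (g := mulC E G) (f := fun y => (conjC E (ex G z) y, z)) ?_
      ((hasFDerivAt_conjC _).prodMk (hasFDerivAt_const _ _))
    simpa using (hz.differentiableAt (by simp)).hasFDerivAt
  have h2 := (h1.congr_of_eventuallyEq (f₁ := fun y => mulC E G (z, y)) ?_).unique hF
  · rw [← h2]
    simp
  · filter_upwards [(tendsto_conj_ex 𝕜 (ex G z)).eventually (eventually_ex_lg E G)] with y hy
    simp only [mulC, conjC, hy]
    congr 1
    group

variable (𝕜 E G) in
theorem fderiv_mulC_comp {f : E → E × E} {f' : E →L[𝕜] E × E} (hf : HasFDerivAt f f' 0)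
    (hf0 : f 0 = (0, 0)) {a : E → E × E} {a' : E →L[𝕜] E × E} (ha : HasFDerivAt a a' 0) :
    HasFDerivAt (fun z => fderiv 𝕜 (mulC E G) (f z) (a z))
      ((fderiv 𝕜 (mulC E G) (0, 0)).comp a' +
        ((fderiv 𝕜 (fderiv 𝕜 (mulC E G)) (0, 0)).comp f').flip (a 0)) 0 := by
  have hB : HasFDerivAt (fderiv 𝕜 (mulC E G)) (fderiv 𝕜 (fderiv 𝕜 (mulC E G)) (0, 0)) (f 0) := by
    rw [hf0]
    have := (contDiffAt_mulC (E := E) (G := G) 𝕜).fderiv_right (m := ∞) (by simp)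
    exact (this.differentiableAt (by simp)).hasFDerivAt
  have h1 := (HasFDerivAt.comp (0 : E) hB hf).clm_apply ha
  simp only [Function.comp_apply, hf0] at h1
  exact h1

/-- The derivative of `z ↦ Ad (ex z) w` at `0` is `v ↦ [v, w]`: differentiate `eventually_Ad_ex` in
`z`, and express both sides through the second derivative of the multiplication. -/
theorem fderiv_Ad_ex (v w : E) :
    fderiv 𝕜 (fun z : E => Ad 𝕜 E (ex G z) w) 0 v = brk 𝕜 E G v w := by
  set B := fderiv 𝕜 (fderiv 𝕜 (mulC E G)) (0, 0) with hBdef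
  have hM : fderiv 𝕜 (mulC E G) (0, 0) =
    ContinuousLinearMap.fst 𝕜 E E + ContinuousLinearMap.snd 𝕜 E E := hasFDerivAt_mulC.fderiv
  have hsymm : ∀ x y, B x y = B y x := by
    have : IsSymmSndFDerivAt 𝕜 (mulC E G) (0, 0) :=
      ((contDiffAt_mulC 𝕜).of_le (m := minSmoothness 𝕜 2)
        (by rw [minSmoothness_of_isRCLikeNormedField]
            exact WithTop.coe_le_coe.2 le_top)).isSymmSndFDerivAt le_rfl
    exact fun x y => this.eq x y
  have hframe : ∀ u : E, HasFDerivAt (fun z => frame 𝕜 G z u)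
      ((B.comp (ContinuousLinearMap.inl 𝕜 E E)).flip (0, u)) 0 := by
    intro u
    have h1 := fderiv_mulC_comp 𝕜 E G (f := fun z : E => (z, (0 : E)))
      (hasFDerivAt_prodMk_left (0 : E) (0 : E)) rfl
      (hasFDerivAt_const ((0 : E), u) (0 : E))
    have hd : ∀ᶠ p in 𝓝 ((0 : E), (0 : E)), ContDiffAt 𝕜 1 (mulC E G) p :=
      ((contDiffAt_mulC 𝕜).of_le (by simp)).eventually (by simp)
    have ht : Tendsto (fun z : E => (z, (0 : E))) (𝓝 0) (𝓝 (0, 0)) :=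
      (Continuous.prodMk_left (0 : E)).tendsto 0
    refine (h1.congr_of_eventuallyEq ?_).congr_fderiv (by simp [hBdef])
    filter_upwards [ht.eventually hd, eventually_hasFDerivAt_frame 𝕜 E G] with z hz hF
    have h2 : HasFDerivAt (fun y => mulC E G (z, y))
      ((fderiv 𝕜 (mulC E G) (z, 0)).comp (ContinuousLinearMap.inr 𝕜 E E)) 0 :=
      HasFDerivAt.comp (0 : E) (g := mulC E G) (f := fun y : E => (z, y))
        (hz.differentiableAt (by simp)).hasFDerivAt (hasFDerivAt_prodMk_right z (0 : E))
    rw [hF.unique h2]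
    simp
  have ha : HasFDerivAt (fun z : E => Ad 𝕜 E (ex G z) w)
      (fderiv 𝕜 (fun z : E => Ad 𝕜 E (ex G z) w) 0) 0 :=
    ((contDiffAt_Ad_ex 𝕜 E G w).differentiableAt (by simp)).hasFDerivAt
  have h1 := fderiv_mulC_comp 𝕜 E G (f := fun z : E => ((0 : E), z))
      (hasFDerivAt_prodMk_right (0 : E) (0 : E)) rfl
      (a := fun z => (Ad 𝕜 E (ex G z) w, (0 : E))) (ha.prodMk (hasFDerivAt_const (0 : E) (0 : E)))
  have h2 := (h1.congr_of_eventuallyEq ((eventually_Ad_ex 𝕜 E G).mono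
    fun z hz => (hz w).symm)).unique (hframe w)
  have h3 := DFunLike.congr_fun h2 v
  simp [hM, Ad_one] at h3
  rw [brk_eq_frame, (hframe w).fderiv, (hframe v).fderiv]
  simp only [ContinuousLinearMap.flip_apply, ContinuousLinearMap.comp_apply,
    ContinuousLinearMap.inl_apply]
  rw [← h3, hsymm (w, 0) (0, v), add_sub_cancel_right]

/-- Along a map with logarithmic derivative `A`, the derivative of `Ad (f x) w` is
`h ↦ Ad (f x) [A h, w]`. -/
theorem HasLog.Ad_apply {K : Type*} [NontriviallyNormedField K] [NormedAlgebra K 𝕜]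
    [NormedSpace K E] [IsScalarTower K 𝕜 E] {F : Type*} [NormedAddCommGroup F] [NormedSpace K F]
    {f : F → G} {x : F} {A : F →L[K] E} (hf : HasLog f x A) (w : E) :
    ∃ L : F →L[K] E, (∀ h, L h = Ad 𝕜 E (f x) (brk 𝕜 E G (A h) w)) ∧
      HasFDerivAt (fun y => Ad 𝕜 E (f y) w) L x := by
  have ha : HasFDerivAt (fun z : E => Ad 𝕜 E (ex G z) w)
      (fderiv 𝕜 (fun z : E => Ad 𝕜 E (ex G z) w) 0) 0 :=
    ((contDiffAt_Ad_ex 𝕜 E G w).differentiableAt (by simp)).hasFDerivAt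
  have h1 : HasFDerivAt (fun y => Ad 𝕜 E (ex G (lg E ((f x)⁻¹ * f y))) w)
      (((fderiv 𝕜 (fun z : E => Ad 𝕜 E (ex G z) w) 0).restrictScalars K).comp A) x := by
    refine HasFDerivAt.comp x (g := fun z : E => Ad 𝕜 E (ex G z) w)
      (g' := (fderiv 𝕜 (fun z : E => Ad 𝕜 E (ex G z) w) 0).restrictScalars K) ?_ hf.2
    simpa using ha.restrictScalars K
  refine ⟨((Ad 𝕜 E (f x)).restrictScalars K).comp
    (((fderiv 𝕜 (fun z : E => Ad 𝕜 E (ex G z) w) 0).restrictScalars K).comp A), fun h => ?_, ?_⟩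
  · simp [fderiv_Ad_ex]
  · refine (HasFDerivAt.comp x (((Ad 𝕜 E (f x)).restrictScalars K).hasFDerivAt)
      h1).congr_of_eventuallyEq ?_
    filter_upwards [(hf.tendsto_one (𝕜 := 𝕜)).eventually (eventually_ex_lg E G)] with y hy
    simp [hy, ← Ad_mul_apply]

end AdjointDerivative

section OneParameter

open ContinuousLinearMap (toSpanSingleton)

variable {𝕜 : Type*} [RCLike 𝕜] {E : Type*} [NormedAddCommGroup E] [NormedSpace 𝕜 E]
  {G : Type*} [TopologicalSpace G] [ChartedSpace E G] [Group G] [LieGroup 𝓘(𝕜, E) ∞ G]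

/-! ### Curves with prescribed logarithmic derivative -/

variable (𝕜) in
include 𝕜 in
/-- Every continuous curve in the Lie algebra is, for short times, the left logarithmic
derivative of a curve in the group. -/
theorem exists_hasLog_curve [CompleteSpace E] [NormedSpace ℝ E] [IsScalarTower ℝ 𝕜 E]
    {u : ℝ → E} (hu : ∀ᶠ t in 𝓝 0, ContinuousAt u t) :
    ∃ b : ℝ → G, b 0 = 1 ∧ ∀ᶠ t in 𝓝 0, HasLog b t (toSpanSingleton ℝ (u t)) := by
  obtain ⟨K, S, hS, hLip⟩ :=
    ((contDiffAt_frame 𝕜 E G).of_le (m := 1) (by simp)).exists_lipschitzOnWith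
  -- a bound for the frame near the identity and a bound for `u` near time zero
  have hbF : ∀ᶠ z in 𝓝 (0 : E), ‖frame 𝕜 G z‖ < ‖frame 𝕜 G (0 : E)‖ + 1 :=
    (contDiffAt_frame 𝕜 E G).continuousAt.norm.eventually_lt_const (by simp)
  have hbu : ∀ᶠ t in 𝓝 (0 : ℝ), ‖u t‖ < ‖u 0‖ + 1 :=
    hu.self_of_nhds.norm.eventually_lt_const (by simp)
  set MF := ‖frame 𝕜 G (0 : E)‖ + 1
  set Mu := ‖u 0‖ + 1
  have hMF : 0 < MF := by positivity
  have hMu : 0 < Mu := by positivity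
  obtain ⟨a, ha, hball⟩ := Metric.nhds_basis_closedBall.eventually_iff.1
    ((eventually_mem_set.2 hS).and hbF)
  obtain ⟨ε₁, hε₁, hball'⟩ := Metric.nhds_basis_closedBall.eventually_iff.1 (hu.and hbu)
  set ε := min ε₁ (a / (MF * Mu)) with hεdef
  have hε : 0 < ε := lt_min hε₁ (by positivity)
  have hsub : ∀ t ∈ Icc (-ε) ε, t ∈ Metric.closedBall (0 : ℝ) ε₁ := fun t ht => by
    rw [Metric.mem_closedBall, dist_zero_right, Real.norm_eq_abs]
    exact (abs_le.2 ht).trans (min_le_left _ _)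
  have hPL : IsPicardLindelof (fun t x => frame 𝕜 G x (u t)) (tmin := -ε) (tmax := ε)
      ⟨0, by constructor <;> linarith⟩ (0 : E) a.toNNReal 0 (MF * Mu).toNNReal
      (K * Mu.toNNReal) := by
    have hca : ((a.toNNReal : NNReal) : ℝ) = a := Real.coe_toNNReal _ ha.le
    have hcM : (((MF * Mu).toNNReal : NNReal) : ℝ) = MF * Mu := Real.coe_toNNReal _ (by positivity)
    have hcu : ((Mu.toNNReal : NNReal) : ℝ) = Mu := Real.coe_toNNReal _ hMu.le
    constructor
    · rw [hca]
      intro t ht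
      refine LipschitzOnWith.of_dist_le_mul fun x hx y hy => ?_
      have h1 := hLip.dist_le_mul x (hball hx).1 y (hball hy).1
      rw [dist_eq_norm] at h1 ⊢
      rw [← sub_apply]
      refine ((frame 𝕜 G x - frame 𝕜 G y).le_opNorm _).trans ?_
      have h2 := (hball' (hsub t ht)).2.le
      calc ‖frame 𝕜 G x - frame 𝕜 G y‖ * ‖u t‖ ≤ (K * dist x y) * Mu := by gcongr
        _ = _ := by rw [NNReal.coe_mul, hcu]; ring
    · intro x _ t ht
      exact ((frame 𝕜 G x).continuous.continuousAt.comp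
        (hball' (hsub t ht)).1).continuousWithinAt
    · rw [hca, hcM]
      intro t ht x hx
      refine ((frame 𝕜 G x).le_opNorm _).trans ?_
      have h2 := (hball' (hsub t ht)).2.le
      have h3 := (hball hx).2.le
      gcongr
    · rw [hca, hcM]
      simp only [sub_zero, zero_sub, neg_neg, max_self, NNReal.coe_zero]
      have h4 : ε ≤ a / (MF * Mu) := min_le_right _ _
      rw [le_div_iff₀ (by positivity)] at h4
      linarith
  obtain ⟨α, hα0, hα⟩ := hPL.exists_eq_forall_mem_Icc_hasDerivWithinAt₀
  have hα0 : α 0 = 0 := hα0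
  have hder : ∀ᶠ t in 𝓝 (0 : ℝ), HasDerivAt α (frame 𝕜 G (α t) (u t)) t := by
    filter_upwards [Ioo_mem_nhds (neg_lt_zero.2 hε) hε] with t ht
    exact (hα t (Ioo_subset_Icc_self ht)).hasDerivAt (Icc_mem_nhds ht.1 ht.2)
  have hcont : Tendsto α (𝓝 0) (𝓝 0) := by
    simpa [hα0] using hder.self_of_nhds.continuousAt.tendsto
  refine ⟨fun t => ex G (α t), by simp [hα0], ?_⟩
  filter_upwards [hder, hcont.eventually (eventually_hasLog_ex 𝕜 E G (K := ℝ) ℝ)] with t ht hz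
  refine hz α t _ rfl (ht.hasFDerivAt.congr_fderiv ?_)
  ext
  simp

theorem brk_self (v : E) : brk 𝕜 E G v v = 0 := by simp [brk_eq_frame]

theorem brk_smul_self (c : 𝕜) (v : E) : brk 𝕜 E G (c • v) v = 0 := by
  have hd : DifferentiableAt 𝕜 (fun z => frame 𝕜 G z v) (0 : E) :=
    (((contDiffAt_frame 𝕜 E G).differentiableAt (by simp))).clm_apply
      (differentiableAt_const v)
  simp only [brk_eq_frame, map_smul]
  rw [show (fun z => c • frame 𝕜 G z v) = c • fun z => frame 𝕜 G z v from rfl,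
    fderiv_const_smul hd]
  simp

/-- If `[v, w] = 0` then `w` is fixed by `Ad` along a curve with logarithmic derivative `v`. -/
theorem Ad_apply_eq_of_brk_eq_zero {K : Type*} [RCLike K] [NormedAlgebra K 𝕜]
    [NormedSpace K E] [IsScalarTower K 𝕜 E] {b : K → G} {v w : E} {s : Set K} (hs : IsOpen s)
    (hc : IsPreconnected s) (h0 : 0 ∈ s) (hb0 : b 0 = 1)
    (hb : ∀ t ∈ s, HasLog b t (toSpanSingleton K v)) (hvw : brk 𝕜 E G v w = 0)
    {t : K} (ht : t ∈ s) : Ad 𝕜 E (b t) w = w := by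
  have hd : ∀ t ∈ s, HasFDerivAt (fun t => Ad 𝕜 E (b t) w) (0 : K →L[K] E) t := by
    intro t ht
    obtain ⟨L, hL, hLd⟩ := (hb t ht).Ad_apply (𝕜 := 𝕜) w
    refine hLd.congr_fderiv ?_
    ext
    simp [hL, hvw]
  have := hs.is_const_of_fderiv_eq_zero (𝕜 := K) (f := fun t => Ad 𝕜 E (b t) w) hc
    (fun t ht => (hd t ht).differentiableAt.differentiableWithinAt) (fun t ht => (hd t ht).fderiv)
    ht h0
  simpa [hb0, Ad_one] using this

/-- A map with constant logarithmic derivative is additive. -/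
theorem map_add_of_hasLog {K : Type*} [RCLike K] [NormedAlgebra K 𝕜]
    [NormedSpace K E] [IsScalarTower K 𝕜 E] {b : K → G} {v : E}
    (hb0 : b 0 = 1) (hb : ∀ t, HasLog b t (toSpanSingleton K v)) (s t : K) :
    b (s + t) = b s * b t := by
  refine HasLog.eqOn (𝕜 := 𝕜) (f := fun t => b (s + t)) (g := fun t => b s * b t)
    (A := fun _ => toSpanSingleton K v) isOpen_univ isPreconnected_univ
    (fun t _ => ?_) (fun t _ => (hb t).const_mul 𝕜 _) (mem_univ 0) (by simp [hb0]) (mem_univ t)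
  exact ((hb (s + t)).comp ((hasFDerivAt_id t).const_add s)).congr_log (by ext; simp)

theorem exists_real_oneParameter [CompleteSpace E] [NormedSpace ℝ E] [IsScalarTower ℝ 𝕜 E]
    (v : E) : ∃ b : ℝ → G, b 0 = 1 ∧ ∀ t, HasLog b t (toSpanSingleton ℝ v) := by
  obtain ⟨b, hb0, hb⟩ := exists_hasLog_curve 𝕜 (G := G) (u := fun _ : ℝ => v)
    (Eventually.of_forall fun t => continuousAt_const)
  obtain ⟨ε, hε, hball⟩ := Metric.eventually_nhds_iff_ball.1 hb
  have hbd : ∀ t : ℝ, |t| < ε → HasLog b t (toSpanSingleton ℝ v) := fun t ht =>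
    hball t (by simpa using ht)
  have hAd : ∀ t : ℝ, |t| < ε → Ad 𝕜 E (b t) v = v := fun t ht =>
    Ad_apply_eq_of_brk_eq_zero (𝕜 := 𝕜) (s := Metric.ball (0 : ℝ) ε) Metric.isOpen_ball
      (convex_ball _ _).isPreconnected (Metric.mem_ball_self hε) hb0 hball
      (brk_self v) (by simpa using ht)
  have hadd : ∀ s t : ℝ, |s| < ε → |t| < ε → |s + t| < ε → b (s + t) = b s * b t := by
    intro s t hs ht hst
    refine HasLog.eqOn (𝕜 := 𝕜) (f := fun t => b (s + t)) (g := fun t => b s * b t)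
      (A := fun _ => toSpanSingleton ℝ v) (s := Metric.ball 0 ε ∩ Metric.ball (-s) ε)
      (Metric.isOpen_ball.inter Metric.isOpen_ball)
      ((convex_ball _ _).inter (convex_ball _ _)).isPreconnected (fun t ht => ?_)
      (fun t ht => (hball t ht.1).const_mul 𝕜 _) (x := 0) ⟨by simpa using hε, by simpa using hs⟩
      (by simp [hb0]) ⟨by simpa using ht, ?_⟩
    · have h1 : |s + t| < ε := by
        have := ht.2
        rw [Metric.mem_ball, Real.dist_eq] at this
        rwa [sub_neg_eq_add, add_comm] at this
      exact ((hbd (s + t) h1).comp ((hasFDerivAt_id t).const_add s)).congr_log (by ext; simp)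
    · rw [Metric.mem_ball, Real.dist_eq, sub_neg_eq_add, add_comm]
      exact hst
  -- the local solution `b` extends to all times by `t ↦ b (t / n) ^ n`, for any large `n`
  have hpow : ∀ (k : ℕ) (s : ℝ), |k * s| < ε → b (k * s) = b s ^ k := by
    intro k
    induction k with
    | zero => intro s _; simp [hb0]
    | succ k ih =>
      intro s hs
      rw [abs_mul, Nat.abs_cast] at hs
      push_cast at hs ⊢
      have h0 : 0 ≤ |s| := abs_nonneg s
      have hk : (0 : ℝ) ≤ k := Nat.cast_nonneg k
      have h1 : |(k : ℝ) * s| < ε := by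
        rw [abs_mul, Nat.abs_cast]; nlinarith
      have h2 : |s| < ε := by nlinarith
      have h3 : |(k : ℝ) * s + s| < ε := by
        rw [← add_one_mul, abs_mul, abs_of_nonneg (by positivity)]; exact hs
      rw [add_mul, one_mul, hadd _ _ h1 h2 h3, ih s h1, pow_succ]
  have hwd : ∀ (t : ℝ) (n m : ℕ), 0 < n → 0 < m → |t| < n * ε → |t| < m * ε →
      b (t / n) ^ n = b (t / m) ^ m := by
    have aux : ∀ (t : ℝ) (n m : ℕ), 0 < n → 0 < m → |t| < n * ε →
        b (t / n) ^ n = b (t / (n * m)) ^ (n * m) := by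
      intro t n m hn hm ht
      have hn' : (0 : ℝ) < n := Nat.cast_pos.2 hn
      have hm' : (0 : ℝ) < m := Nat.cast_pos.2 hm
      have h1 : t / n = m * (t / (n * m)) := by field_simp
      have h2 : |(m : ℝ) * (t / (n * m))| < ε := by
        rw [← h1, abs_div, Nat.abs_cast, div_lt_iff₀ hn', mul_comm]
        exact ht
      rw [h1, hpow m _ h2, ← pow_mul, mul_comm m n]
    intro t n m hn hm htn htm
    rw [aux t n m hn hm htn, aux t m n hm hn htm, mul_comm m n, mul_comm (m : ℝ) n]
  let N : ℝ → ℕ := fun t => ⌊|t| / ε⌋₊ + 1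
  have hN : ∀ t, |t| < N t * ε := fun t => by
    rw [← div_lt_iff₀ hε]
    simpa [N] using Nat.lt_floor_add_one (|t| / ε)
  have hN0 : ∀ t, 0 < N t := fun t => Nat.succ_pos _
  refine ⟨fun t => b (t / N t) ^ N t, by simp [hb0], fun t => ?_⟩
  -- near `t` the number of factors may be kept fixed
  have hloc : (fun s => b (s / N s) ^ N s) =ᶠ[𝓝 t] fun s => b (s / N t) ^ N t := by
    filter_upwards [(continuous_abs.tendsto t).eventually_lt_const (hN t)] with s hs
    exact hwd s _ _ (hN0 s) (hN0 t) (hN s) hs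
  refine HasLog.congr_of_eventuallyEq ?_ hloc
  have hNt : (0 : ℝ) < N t := Nat.cast_pos.2 (hN0 t)
  have hlt : |t / N t| < ε := by
    rw [abs_div, Nat.abs_cast, div_lt_iff₀ hNt, mul_comm]
    exact hN t
  have hstep : HasLog (fun s => b (s / N t)) t (toSpanSingleton ℝ ((N t : ℝ)⁻¹ • v)) := by
    refine ((hbd _ hlt).comp (h := fun s : ℝ => s / N t)
      (((hasDerivAt_id t).div_const (N t : ℝ)).hasFDerivAt)).congr_log ?_
    ext
    simp
  have hAdinv : Ad 𝕜 E (b (t / N t))⁻¹ v = v := by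
    have := hAd _ hlt
    nth_rewrite 1 [← this]
    simp
  have hind : ∀ k : ℕ, HasLog (fun s => b (s / N t) ^ k) t
      (toSpanSingleton ℝ ((k * (N t : ℝ)⁻¹) • v)) := by
    intro k
    induction k with
    | zero => simpa using hasLog_const (K := ℝ) (E := E) (1 : G) t
    | succ k ih =>
      simp only [pow_succ]
      refine (ih.mul (𝕜 := 𝕜) hstep).congr_log ?_
      ext
      simp only [add_apply, ContinuousLinearMap.comp_apply,
        ContinuousLinearMap.coe_restrictScalars', ContinuousLinearMap.toSpanSingleton_apply,
        one_smul]
      rw [← algebraMap_smul 𝕜 ((k : ℝ) * (N t : ℝ)⁻¹) v, map_smul, hAdinv, algebraMap_smul,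
        ← add_smul]
      congr 1
      push_cast
      ring
  refine (hind (N t)).congr_log ?_
  rw [mul_inv_cancel₀ hNt.ne', one_smul]

/-- For every `v` in the Lie algebra there is a one-parameter subgroup with velocity `v`, with
real or complex time. -/
theorem exists_oneParameter [CompleteSpace E] (v : E) :
    ∃ b : 𝕜 → G, b 0 = 1 ∧ ∀ t, HasLog b t (toSpanSingleton 𝕜 v) := by
  let _ : NormedSpace ℝ E := NormedSpace.restrictScalars ℝ 𝕜 E
  have _ : IsScalarTower ℝ 𝕜 E := RestrictScalars.isScalarTower ℝ 𝕜 E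
  obtain ⟨α, hα0, hα⟩ := exists_real_oneParameter (𝕜 := 𝕜) (G := G) v
  obtain ⟨β, hβ0, hβ⟩ := exists_real_oneParameter (𝕜 := 𝕜) (G := G) ((RCLike.I : 𝕜) • v)
  -- the real one-parameter groups of `v` and `I • v` commute; if `𝕜 = ℝ`, the second is trivial
  refine ⟨fun z => α (RCLike.re z) * β (RCLike.im z), by simp [hα0, hβ0], fun z => ?_⟩
  have hAd : Ad 𝕜 E (β (RCLike.im z)) v = v := by
    refine Ad_apply_eq_of_brk_eq_zero (𝕜 := 𝕜) (s := univ) isOpen_univ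
      isPreconnected_univ (mem_univ _) hβ0 (fun t _ => hβ t)
      (brk_smul_self _ _) (mem_univ _)
  have hAdinv : Ad 𝕜 E (β (RCLike.im z))⁻¹ v = v := by
    nth_rewrite 1 [← hAd]
    simp
  have h1 : HasLog (fun z : 𝕜 => α (RCLike.re z)) z
      ((toSpanSingleton ℝ v).comp RCLike.reCLM) :=
    HasLog.comp (h := fun z : 𝕜 => RCLike.re z) (hα _) (RCLike.reCLM (K := 𝕜)).hasFDerivAt
  have h2 : HasLog (fun z : 𝕜 => β (RCLike.im z)) z
      ((toSpanSingleton ℝ ((RCLike.I : 𝕜) • v)).comp RCLike.imCLM) :=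
    HasLog.comp (h := fun z : 𝕜 => RCLike.im z) (hβ _) (RCLike.imCLM (K := 𝕜)).hasFDerivAt
  have h3 := h1.mul (𝕜 := 𝕜) h2
  -- the real derivative is `𝕜`-linear, so it is the derivative over `𝕜`
  refine ⟨h3.1, hasFDerivAt_of_restrictScalars ℝ h3.2 ?_⟩
  ext h
  simp only [ContinuousLinearMap.coe_restrictScalars', ContinuousLinearMap.toSpanSingleton_apply,
    add_apply, ContinuousLinearMap.comp_apply, RCLike.reCLM_apply,
    RCLike.imCLM_apply]
  rw [← algebraMap_smul 𝕜 (RCLike.re h) v, map_smul, hAdinv,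
    ← algebraMap_smul 𝕜 (RCLike.im h), smul_smul, ← add_smul]
  congr 1
  exact (RCLike.re_add_im h).symm

/-! ### Smoothness of one-parameter subgroups -/

/-- Solutions of an autonomous differential equation with smooth right hand side are smooth. -/
theorem contDiffAt_of_hasDerivAt_comp {x : 𝕜 → E} {F : E → E} {t₀ : 𝕜}
    (hx : ∀ᶠ t in 𝓝 t₀, HasDerivAt x (F (x t)) t) (hF : ContDiffAt 𝕜 ∞ F (x t₀)) :
    ContDiffAt 𝕜 ∞ x t₀ := by
  have key : ∀ n : ℕ, ContDiffAt 𝕜 n x t₀ := by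
    intro n
    induction n with
    | zero =>
      refine contDiffAt_zero.2 ⟨_, hx, fun t ht => ?_⟩
      exact HasDerivAt.continuousAt (f' := F (x t)) ht |>.continuousWithinAt
    | succ n ih =>
      refine (contDiffAt_succ_iff_hasFDerivAt (n := n)).2
        ⟨fun t => toSpanSingleton 𝕜 (F (x t)), ⟨_, hx, fun t ht => ht⟩, ?_⟩
      have h1 : ContDiffAt 𝕜 n (fun t => F (x t)) t₀ :=
        ContDiffAt.comp t₀ (hF.of_le (WithTop.coe_le_coe.2 le_top)) ih
      exact (ContinuousLinearMap.toSpanSingletonLIE 𝕜 E).contDiff.contDiffAt.comp t₀ h1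
  exact contDiffAt_infty.2 key

theorem contMDiff_of_hasLog {b : 𝕜 → G} {v : E}
    (hb : ∀ t, HasLog b t (toSpanSingleton 𝕜 v)) : ContMDiff 𝓘(𝕜, 𝕜) 𝓘(𝕜, E) ∞ b := by
  intro t₀
  refine contMDiffAt_of_contDiffAt_lg (hb t₀).1 ?_
  have h1 := (hb t₀).tendsto_one (𝕜 := 𝕜)
  refine contDiffAt_of_hasDerivAt_comp (F := fun z => frame 𝕜 G z v) ?_ ?_
  · filter_upwards [h1.eventually (eventually_lg_comp 𝕜 E G (K := 𝕜) 𝕜)] with t ht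
    have := ht _ t _ rfl ((hb t).const_mul 𝕜 (b t₀)⁻¹)
    refine HasFDerivAt.congr_fderiv this ?_
    ext
    simp
  · have : ContDiffAt 𝕜 ∞ (frame 𝕜 G) (lg E ((b t₀)⁻¹ * b t₀)) := by
      simpa using contDiffAt_frame 𝕜 E G
    exact this.clm_apply contDiffAt_const

end OneParameter

section IntegralSubgroup

open ContinuousLinearMap (toSpanSingleton)

variable {𝕜 : Type*} [RCLike 𝕜] {E : Type*} [NormedAddCommGroup E] [NormedSpace 𝕜 E]
  {G : Type*} [TopologicalSpace G] [ChartedSpace E G] [Group G]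

/-! ### The connected subgroup with given Lie algebra -/

variable (G) in
/-- The exponential image of a subspace of the Lie algebra, in terms of logarithmic
derivatives. -/
def expSet (p : Submodule 𝕜 E) : Set G :=
  {g | ∃ v ∈ p, ∃ γ : 𝕜 → G, γ 0 = 1 ∧ (∀ t, HasLog γ t (toSpanSingleton 𝕜 v)) ∧ γ 1 = g}

variable (G) in
/-- The subgroup generated by the exponential image of a subspace of the Lie algebra. -/
def expSubgroup (p : Submodule 𝕜 E) : Subgroup G := Subgroup.closure (expSet G p)

variable (G) in
/-- The subspace `p` of the model space is closed under the bracket of the Lie algebra of `G`. -/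
def IsBracketClosed (p : Submodule 𝕜 E) : Prop := ∀ v ∈ p, ∀ w ∈ p, brk 𝕜 E G v w ∈ p

theorem sum_repr_coe {p : Submodule 𝕜 E} {ι : Type*} [Fintype ι] (B : Module.Basis ι 𝕜 p)
    (x : p) : ∑ j, B.repr x j • (B j : E) = x := by
  have h := congrArg p.subtype (B.sum_repr x)
  rw [map_sum] at h
  exact h

theorem HasLog.comp_ofReal [NormedSpace ℝ E] [IsScalarTower ℝ 𝕜 E] {γ : 𝕜 → G} {v : E} {t : ℝ}
    (h : HasLog γ (t : 𝕜) (toSpanSingleton 𝕜 v)) :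
    HasLog (fun t : ℝ => γ (t : 𝕜)) t (toSpanSingleton ℝ v) := by
  refine (HasLog.comp (h := fun t : ℝ => (t : 𝕜)) (h.restrictScalars (K := ℝ))
    (RCLike.ofRealCLM (K := 𝕜)).hasFDerivAt).congr_log ?_
  ext
  simp

variable [LieGroup 𝓘(𝕜, E) ∞ G]

/-- A subalgebra `p` is stable under `Ad` along one-parameter groups with velocity in `p`. -/
theorem IsBracketClosed.Ad_curve_mem [FiniteDimensional 𝕜 E] [NormedSpace ℝ E]
    [IsScalarTower ℝ 𝕜 E] {p : Submodule 𝕜 E}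
    (hp : IsBracketClosed G p) {b : ℝ → G} {v : E} (hv : v ∈ p) (hb0 : b 0 = 1)
    (hb : ∀ t, HasLog b t (toSpanSingleton ℝ v)) {w : E} (hw : w ∈ p) (t : ℝ) :
    Ad 𝕜 E (b t) w ∈ p := by
  obtain ⟨q, hq⟩ := p.exists_isCompl
  let π : E →L[𝕜] q := (Submodule.projectionOnto q p hq.symm).toContinuousLinearMap
  have hπ : ∀ x, π x = 0 ↔ x ∈ p := fun x => by
    simp [π]
  let B := Module.finBasis 𝕜 p
  let c : Fin (Module.finrank 𝕜 p) → Fin (Module.finrank 𝕜 p) → 𝕜 := fun i =>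
    B.repr ⟨brk 𝕜 E G v (B i), hp v hv _ (B i).2⟩
  have hc : ∀ i, brk 𝕜 E G v (B i) = ∑ j, c i j • (B j : E)  := fun i =>
    (sum_repr_coe B ⟨brk 𝕜 E G v (B i), hp v hv _ (B i).2⟩).symm
  -- the components of `Ad (b t) (B i)` transversal to `p` solve a linear differential equation
  let C : (Fin (Module.finrank 𝕜 p) → q) →L[𝕜] (Fin (Module.finrank 𝕜 p) → q) :=
    ContinuousLinearMap.pi fun i => ∑ j, c i j • ContinuousLinearMap.proj j
  let y : ℝ → Fin (Module.finrank 𝕜 p) → q := fun t i => π (Ad 𝕜 E (b t) (B i))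
  have hy : ∀ t, HasDerivAt y (C (y t)) t := by
    intro t
    rw [hasDerivAt_pi]
    intro i
    obtain ⟨L, hL, hLd⟩ := (hb t).Ad_apply (𝕜 := 𝕜) (B i : E)
    have h1 : HasFDerivAt (fun t => π (Ad 𝕜 E (b t) (B i))) ((π.restrictScalars ℝ).comp L) t :=
      HasFDerivAt.comp t (π.restrictScalars ℝ).hasFDerivAt hLd
    refine h1.congr_fderiv ?_
    ext
    simp [hL, C, y, hc, map_sum]
  have hy0 : y = fun _ => 0 := by
    refine ODE_solution_unique_univ (v := fun _ => C) (s := fun _ => univ) (t₀ := 0)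
      (fun t => C.lipschitz.lipschitzOnWith) (fun t => ⟨hy t, mem_univ _⟩)
      (fun t => ⟨by simpa using hasDerivAt_const t (0 : Fin (Module.finrank 𝕜 p) → q),
        mem_univ _⟩) ?_
    ext i
    simp [y, hb0, Ad_one, (hπ _).2]
  have hw' : (w : E) = ∑ j, B.repr ⟨w, hw⟩ j • (B j : E) :=
    (sum_repr_coe B ⟨w, hw⟩).symm
  rw [← hπ, hw']
  simp only [map_sum, map_smul]
  refine Finset.sum_eq_zero fun j _ => ?_
  have : y t j = 0 := by rw [hy0]; rfl
  rw [show π (Ad 𝕜 E (b t) (B j)) = 0 from this, smul_zero]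

theorem IsBracketClosed.Ad_mem [FiniteDimensional 𝕜 E] {p : Submodule 𝕜 E}
    (hp : IsBracketClosed G p) {a : G} (ha : a ∈ expSubgroup G p) {w : E} (hw : w ∈ p) :
    Ad 𝕜 E a w ∈ p := by
  let _ : NormedSpace ℝ E := NormedSpace.restrictScalars ℝ 𝕜 E
  have _ : IsScalarTower ℝ 𝕜 E := RestrictScalars.isScalarTower ℝ 𝕜 E
  suffices h : ∀ w ∈ p, Ad 𝕜 E a w ∈ p ∧ Ad 𝕜 E a⁻¹ w ∈ p from (h w hw).1
  refine Subgroup.closure_induction (p := fun a _ => ∀ w ∈ p, Ad 𝕜 E a w ∈ p ∧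
    Ad 𝕜 E a⁻¹ w ∈ p) ?_ ?_ ?_ ?_ ha
  · rintro _ ⟨v, hv, γ, hγ0, hγ, rfl⟩ w hw
    have h1 : γ (-1) * γ 1 = 1 := by
      rw [← map_add_of_hasLog (𝕜 := 𝕜) hγ0 hγ, neg_add_cancel, hγ0]
    have h2 := fun t : ℝ => hp.Ad_curve_mem hv (b := fun t : ℝ => γ (t : 𝕜)) (by simpa using hγ0)
      (fun t => (hγ _).comp_ofReal) hw t
    exact ⟨by simpa using h2 1, by simpa [eq_inv_of_mul_eq_one_left h1] using h2 (-1)⟩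
  · intro w hw
    simpa [Ad_one] using hw
  · intro a b _ _ iha ihb w hw
    rw [mul_inv_rev, Ad_mul_apply, Ad_mul_apply]
    exact ⟨(iha _ (ihb w hw).1).1, (ihb _ (iha w hw).2).2⟩
  · intro a _ iha w hw
    rw [inv_inv]
    exact (iha w hw).symm

/-! ### Maps tangent to the left invariant distribution of a subalgebra -/

/-- `f` is a smooth map with values in the connected subgroup with Lie algebra `p`, all of whose
logarithmic derivatives take values in `p`. -/
structure IsTangentMap (p : Submodule 𝕜 E) {F : Type*} [NormedAddCommGroup F] [NormedSpace 𝕜 F]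
    (f : F → G) : Prop where
  contMDiff : ContMDiff 𝓘(𝕜, F) 𝓘(𝕜, E) ∞ f
  mem : ∀ x, f x ∈ expSubgroup G p
  log : ∀ x, ∃ A : F →L[𝕜] E, HasLog f x A ∧ ∀ h, A h ∈ p

variable {F : Type*} [NormedAddCommGroup F] [NormedSpace 𝕜 F]
  {F' : Type*} [NormedAddCommGroup F'] [NormedSpace 𝕜 F']

omit [LieGroup 𝓘(𝕜, E) ∞ G] in
theorem IsTangentMap.const (p : Submodule 𝕜 E) :
    IsTangentMap p (fun _ : F => (1 : G)) :=
  ⟨contMDiff_const, fun _ => one_mem _, fun x => ⟨0, hasLog_const 1 x, fun _ => p.zero_mem⟩⟩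

theorem IsTangentMap.mul [FiniteDimensional 𝕜 E] {p : Submodule 𝕜 E} (hp : IsBracketClosed G p)
    {f g : F → G} (hf : IsTangentMap p f) (hg : IsTangentMap p g) :
    IsTangentMap p (fun x => f x * g x) := by
  refine ⟨hf.1.mul hg.1, fun x => mul_mem (hf.mem x) (hg.mem x), fun x => ?_⟩
  obtain ⟨A, hA, hAp⟩ := hf.log x
  obtain ⟨B, hB, hBp⟩ := hg.log x
  exact ⟨_, hA.mul (𝕜 := 𝕜) hB,
    fun h => p.add_mem (hp.Ad_mem (inv_mem (hg.mem x)) (hAp h)) (hBp h)⟩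

omit [LieGroup 𝓘(𝕜, E) ∞ G] in
theorem IsTangentMap.comp {p : Submodule 𝕜 E} {f : F → G} (hf : IsTangentMap p f)
    (ℓ : F' →L[𝕜] F) : IsTangentMap p (fun x => f (ℓ x)) := by
  refine ⟨hf.1.comp ℓ.contMDiff, fun x => hf.mem _, fun x => ?_⟩
  obtain ⟨A, hA, hAp⟩ := hf.log (ℓ x)
  exact ⟨_, hA.comp ℓ.hasFDerivAt, fun h => hAp _⟩

/-- One-parameter groups with velocity in `p` are tangent to `p`; at time `t` the point is the
exponential of `t • v`. -/
theorem exists_isTangentMap_curve [FiniteDimensional 𝕜 E] {p : Submodule 𝕜 E} {v : E}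
    (hv : v ∈ p) : ∃ γ : 𝕜 → G, γ 0 = 1 ∧ IsTangentMap p γ ∧
      HasLog γ 0 (toSpanSingleton 𝕜 v) := by
  have := FiniteDimensional.complete 𝕜 E
  obtain ⟨γ, hγ0, hγ⟩ := exists_oneParameter (𝕜 := 𝕜) (G := G) v
  refine ⟨γ, hγ0, ⟨contMDiff_of_hasLog hγ, fun t => ?_, fun t => ⟨_, hγ t, fun h => ?_⟩⟩, hγ 0⟩
  · refine Subgroup.subset_closure ⟨t • v, p.smul_mem t hv, fun s => γ (s * t), by simp [hγ0],
      fun s => ?_, by simp⟩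
    refine ((hγ (s * t)).comp (h := fun s => s * t)
      ((hasDerivAt_id s).mul_const t).hasFDerivAt).congr_log ?_
    ext
    simp
  · simpa using p.smul_mem h hv

/-- Coordinates of the second kind: a smooth map `V → G` tangent to the distribution of a
subalgebra `p ≥ V`, whose logarithmic derivative at `0` is the inclusion. -/
theorem exists_isTangentMap [FiniteDimensional 𝕜 E] {p : Submodule 𝕜 E}
    (hp : IsBracketClosed G p) {V : Submodule 𝕜 E} (hV : V ≤ p) :
    ∃ φ : V → G, φ 0 = 1 ∧ IsTangentMap p φ ∧ HasLog φ 0 V.subtypeL := by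
  have key : ∀ l : List (V × (V →L[𝕜] 𝕜)), ∃ φ : V → G, φ 0 = 1 ∧ IsTangentMap p φ ∧
      HasLog φ 0 (l.map fun a => a.2.smulRight (a.1 : E)).sum := by
    intro l
    induction l with
    | nil => exact ⟨fun _ => 1, rfl, IsTangentMap.const p, by simpa using hasLog_const 1 0⟩
    | cons a l ih =>
      obtain ⟨φ, h0, hφ, hlog⟩ := ih
      obtain ⟨γ, hγ0, hγ, hγlog⟩ := exists_isTangentMap_curve (G := G) (hV a.1.2)
      refine ⟨fun x => γ (a.2 x) * φ x, by simp [h0, hγ0], (hγ.comp a.2).mul hp hφ, ?_⟩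
      have h1 : HasLog (fun x => γ (a.2 x)) 0 ((toSpanSingleton 𝕜 (a.1 : E)).comp a.2) :=
        HasLog.comp (h := fun x => a.2 x) (by simpa using hγlog) a.2.hasFDerivAt
      refine (h1.mul (𝕜 := 𝕜) hlog).congr_log ?_
      ext x
      simp [h0, Ad_one]
  let B := Module.finBasis 𝕜 V
  obtain ⟨φ, h0, hφ, hlog⟩ := key (List.ofFn fun i => (B i, (B.coord i).toContinuousLinearMap))
  refine ⟨φ, h0, hφ, hlog.congr_log ?_⟩
  ext x
  simp only [List.map_ofFn, List.sum_ofFn, Function.comp_apply]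
  simpa using sum_repr_coe B x

end IntegralSubgroup

section Leaf

open ContinuousLinearMap (toSpanSingleton)

variable {𝕜 : Type*} [RCLike 𝕜] {E : Type*} [NormedAddCommGroup E] [NormedSpace 𝕜 E]
  [FiniteDimensional 𝕜 E]
  {G : Type*} [TopologicalSpace G] [ChartedSpace E G] [Group G] [LieGroup 𝓘(𝕜, E) ∞ G]

/-! ### The leaf through the identity -/

/-- A chart `φ : p → G` of the leaf through `1` of the left invariant distribution defined by the
subalgebra `p`. -/
structure IsLeafChart {p : Submodule 𝕜 E} (φ : p → G) : Prop where
  map_zero : φ 0 = 1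
  tangent : IsTangentMap p φ
  log_zero : HasLog φ 0 p.subtypeL

theorem exists_isLeafChart {p : Submodule 𝕜 E} (hp : IsBracketClosed G p) :
    ∃ φ : p → G, IsLeafChart φ := by
  obtain ⟨φ, h1, h2, h3⟩ := exists_isTangentMap (G := G) hp le_rfl
  exact ⟨φ, h1, h2, h3⟩

/-- The leaf chart extends to a foliated chart `(Y, S)` of a neighbourhood of `1`: the transversal
coordinate `Y` is constant along the left invariant fields with values in `p`, and `φ ∘ S` is
the identity on the leaf `Y = 0`. -/
theorem IsLeafChart.exists_foliated_chart {p : Submodule 𝕜 E} {φ : p → G} (hφ : IsLeafChart φ) :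
    ∃ (Y : E → E) (S : E → p), Y 0 = 0 ∧ S 0 = 0 ∧ ContDiffAt 𝕜 ∞ S 0 ∧
      (∀ v : p, fderiv 𝕜 S 0 v = v) ∧
      ∀ᶠ z in 𝓝 (0 : E), DifferentiableAt 𝕜 Y z ∧ (∀ v ∈ p, fderiv 𝕜 Y z (frame 𝕜 G z v) = 0) ∧
        (Y z = 0 → lg E (φ (S z)) = z) := by
  have := FiniteDimensional.complete 𝕜 E
  obtain ⟨q, hq⟩ := p.exists_isCompl
  have hcp : CompleteSpace p := FiniteDimensional.complete 𝕜 p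
  have hcq : CompleteSpace q := FiniteDimensional.complete 𝕜 q
  -- the chart is a local inverse of `(y, s) ↦ ex y * φ s`, for a complement `q` of `p`
  let Φ : q × p → G := fun x => ex G (x.1 : E) * φ x.2
  let Θ : q × p → E := fun x => lg E (Φ x)
  have hΦs : ContMDiffAt 𝓘(𝕜, q × p) 𝓘(𝕜, E) ∞ Φ 0 := by
    refine (contMDiffAt_ex_comp (f := fun x : q × p => (x.1 : E)) ?_ rfl).mul ?_
    · exact (q.subtypeL.comp (ContinuousLinearMap.fst 𝕜 q p)).contDiff.contDiffAt
    · exact (hφ.tangent.comp (ContinuousLinearMap.snd 𝕜 q p)).contMDiff 0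
  have hΦ0 : Φ 0 = 1 := by simp [Φ, hφ.map_zero]
  have hΘ0 : Θ 0 = 0 := by simp [Θ, hΦ0]
  have hΘs : ContDiffAt 𝕜 ∞ Θ 0 := contDiffAt_lg_comp hΦs hΦ0
  let e : (q × p) ≃L[𝕜] E := (Submodule.prodEquivOfIsCompl q p hq.symm).toContinuousLinearEquiv
  have he : ∀ x, e x = (x.1 : E) + x.2 := fun x => by simp [e]
  have hlog : HasLog Φ 0 (e : (q × p) →L[𝕜] E) := by
    have h1 : HasLog (fun x : q × p => ex G (x.1 : E)) 0
        (q.subtypeL.comp (ContinuousLinearMap.fst 𝕜 q p)) := by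
      refine (eventually_hasLog_ex 𝕜 E G (K := 𝕜) (q × p)).self_of_nhds
        (fun x => (x.1 : E)) 0 _ rfl ?_
      rw [frame_zero]
      exact (q.subtypeL.comp (ContinuousLinearMap.fst 𝕜 q p)).hasFDerivAt
    have h2 : HasLog (fun x : q × p => φ x.2) 0
        (p.subtypeL.comp (ContinuousLinearMap.snd 𝕜 q p)) :=
      HasLog.comp (h := fun x : q × p => x.2) hφ.log_zero
        (ContinuousLinearMap.snd 𝕜 q p).hasFDerivAt
    refine (h1.mul (𝕜 := 𝕜) h2).congr_log ?_
    refine ContinuousLinearMap.ext fun x => ?_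
    simp [he, hφ.map_zero, Ad_one]
  have hΘd : HasFDerivAt Θ (e : (q × p) →L[𝕜] E) 0 := by
    refine ((eventually_lg_comp 𝕜 E G (K := 𝕜) (q × p)).self_of_nhds Φ 0 _ hΦ0
      hlog).congr_fderiv ?_
    refine ContinuousLinearMap.ext fun x => ?_
    simp [frame_zero]
  have hstrict : HasStrictFDerivAt Θ (e : (q × p) →L[𝕜] E) 0 :=
    hΘs.hasStrictFDerivAt' hΘd (by simp)
  let T : E → q × p := hstrict.localInverse Θ e 0
  have hT0 : T 0 = 0 := by
    have := hstrict.localInverse_apply_image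
    rwa [hΘ0] at this
  have hTd : HasFDerivAt T (e.symm : E →L[𝕜] q × p) 0 := by
    have := hstrict.to_localInverse.hasFDerivAt
    rwa [hΘ0] at this
  have hTs : ContDiffAt 𝕜 ∞ T 0 := by
    have := hΘs.to_localInverse hΘd (by simp)
    rwa [hΘ0] at this
  have hleft : ∀ᶠ x in 𝓝 0, T (Θ x) = x := hstrict.eventually_left_inverse
  have hright : ∀ᶠ z in 𝓝 0, Θ (T z) = z := by
    have := hstrict.eventually_right_inverse
    rwa [hΘ0] at this
  have hTt : Tendsto T (𝓝 0) (𝓝 0) := by simpa [hT0] using hTs.continuousAt.tendsto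
  refine ⟨fun z => ((T z).1 : E), fun z => (T z).2, by simp [hT0], by simp [hT0], ?_, ?_, ?_⟩
  · exact contDiff_snd.contDiffAt.comp 0 hTs
  · intro v
    have h1 : HasFDerivAt (fun z => (T z).2)
      ((ContinuousLinearMap.snd 𝕜 q p).comp (e.symm : E →L[𝕜] q × p)) 0 := hTd.snd
    rw [h1.fderiv]
    have h2 : e.symm (v : E) = (0, v) := by
      rw [ContinuousLinearEquiv.symm_apply_eq, he]
      simp
    simp [h2]
  have hΦt : Tendsto Φ (𝓝 0) (𝓝 1) := by simpa [hΦ0] using hΦs.continuousAt.tendsto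
  have hTs1 : ∀ᶠ z in 𝓝 0, ContDiffAt 𝕜 1 T z :=
    (hTs.of_le (m := 1) (by simp)).eventually (by simp)
  filter_upwards [hright, hTs1, hTt.eventually hleft.eventually_nhds,
    (hΦt.comp hTt).eventually (eventually_lg_comp 𝕜 E G (K := 𝕜) p)] with z hz hzs hzl hzΦ
  have hTz : HasFDerivAt T (fderiv 𝕜 T z) z := (hzs.differentiableAt (by simp)).hasFDerivAt
  have hY : HasFDerivAt (fun z => ((T z).1 : E))
      (q.subtypeL.comp ((ContinuousLinearMap.fst 𝕜 q p).comp (fderiv 𝕜 T z))) z :=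
    HasFDerivAt.comp z q.subtypeL.hasFDerivAt hTz.fst
  refine ⟨hY.differentiableAt, fun v hv => ?_, fun h0 => ?_⟩
  · obtain ⟨B, hB, hBp⟩ := hφ.tangent.log (T z).2
    have h1 : HasFDerivAt (fun s => Θ ((T z).1, s)) ((frame 𝕜 G z).comp B) (T z).2 := by
      have h2 := hzΦ (fun s => Φ ((T z).1, s)) (T z).2 B rfl (hB.const_mul 𝕜 (ex G ((T z).1 : E)))
      have h3 : lg E ((Φ ∘ T) z) = z := hz
      rw [h3] at h2
      exact h2
    have h2 : HasFDerivAt (fun s => T (Θ ((T z).1, s)))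
        ((fderiv 𝕜 T z).comp ((frame 𝕜 G z).comp B)) (T z).2 := by
      refine HasFDerivAt.comp (T z).2 (g := T) ?_ h1
      rw [show Θ ((T z).1, (T z).2) = z from hz]
      exact hTz
    have h3 : HasFDerivAt (fun s => T (Θ ((T z).1, s))) (ContinuousLinearMap.inr 𝕜 q p) (T z).2 := by
      refine (hasFDerivAt_prodMk_right (T z).1 (T z).2).congr_of_eventuallyEq ?_
      have ht : Tendsto (fun s => ((T z).1, s)) (𝓝 (T z).2) (𝓝 (T z)) :=
        (Continuous.prodMk_right (T z).1).tendsto _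
      filter_upwards [ht.eventually hzl] with s hs using hs
    have h4 := h2.unique h3
    -- `B` is an injective endomorphism of `p`, hence surjective
    let B' : p →ₗ[𝕜] p := LinearMap.codRestrict p (B : p →ₗ[𝕜] E) hBp
    have hinj : Function.Injective B' := by
      rw [injective_iff_map_eq_zero]
      intro h hh
      have h5 : B h = 0 := congrArg Subtype.val hh
      have h6 := DFunLike.congr_fun h4 h
      simp only [ContinuousLinearMap.comp_apply, h5, _root_.map_zero,
        ContinuousLinearMap.inr_apply] at h6
      exact (congrArg Prod.snd h6).symm
    obtain ⟨h, hh⟩ := LinearMap.surjective_of_injective hinj ⟨v, hv⟩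
    have hBh : B h = v := congrArg Subtype.val hh
    rw [hY.fderiv, ← hBh]
    exact congrArg (fun x : q × p => (x.1 : E)) (DFunLike.congr_fun h4 h)
  · have h1 : T z = (0, (T z).2) := Prod.ext (Subtype.ext h0) rfl
    rw [h1] at hz
    simpa [Θ, Φ] using hz

/-- The filter of neighbourhoods of the identity in the leaf topology. -/
def leafFilter {p : Submodule 𝕜 E} (φ : p → G) : Filter G := map φ (𝓝 0)

/-- A map through `1` whose logarithmic derivatives take values in `p` stays in the leaf, because
its transversal coordinate is constant; so it factors locally through the leaf chart. -/
theorem IsLeafChart.exists_retraction {p : Submodule 𝕜 E} {φ : p → G} (hφ : IsLeafChart φ) :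
    ∃ S : E → p, S 0 = 0 ∧ ContDiffAt 𝕜 ∞ S 0 ∧ (∀ v : p, fderiv 𝕜 S 0 v = v) ∧
      ∀ {K : Type*} [RCLike K] [NormedAlgebra K 𝕜] [NormedSpace K E] [IsScalarTower K 𝕜 E]
        {F : Type*} [NormedAddCommGroup F] [NormedSpace K F] {f : F → G} {x : F}, f x = 1 →
        (∀ᶠ y in 𝓝 x, ∃ A : F →L[K] E, HasLog f y A ∧ ∀ h, A h ∈ p) →
        ∀ᶠ y in 𝓝 x, f y = φ (S (lg E (f y))) := by
  obtain ⟨Y, S, hY0, hS0, hS, hSd, hYS⟩ := hφ.exists_foliated_chart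
  refine ⟨S, hS0, hS, hSd, ?_⟩
  intro K _ _ _ _ F _ _ f x hfx hf
  let _ : NormedSpace ℝ F := NormedSpace.restrictScalars ℝ K F
  have hft : Tendsto f (𝓝 x) (𝓝 1) := by
    obtain ⟨A, hA, -⟩ := hf.self_of_nhds
    simpa [hfx] using hA.1.tendsto
  have hlt : Tendsto (fun y => lg E (f y)) (𝓝 x) (𝓝 0) := by
    have h : Tendsto (lg E) (𝓝 (1 : G)) (𝓝 0) := by
      simpa using (continuousAt_lg E G 𝕜).tendsto
    exact h.comp hft
  have hφt : Tendsto (fun y => φ (S (lg E (f y)))) (𝓝 x) (𝓝 1) := by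
    have h1 : Tendsto S (𝓝 0) (𝓝 0) := by simpa [hS0] using hS.continuousAt.tendsto
    have h2 : Tendsto φ (𝓝 0) (𝓝 1) := by
      simpa [hφ.map_zero] using hφ.log_zero.continuousAt.tendsto
    exact h2.comp (h1.comp hlt)
  obtain ⟨δ, hδ, hball⟩ := Metric.eventually_nhds_iff_ball.1 (hf.and
    ((hft.eventually (eventually_lg_comp 𝕜 E G (K := K) F)).and (hlt.eventually hYS)))
  have hder : ∀ y ∈ Metric.ball x δ, HasFDerivAt (fun y => Y (lg E (f y))) (0 : F →L[K] E) y := by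
    intro y hy
    obtain ⟨⟨A, hA, hAp⟩, h1, h2, h3, -⟩ := hball y hy
    have h4 := HasFDerivAt.comp y (h2.hasFDerivAt.restrictScalars K) (h1 f y A rfl hA)
    refine h4.congr_fderiv ?_
    refine ContinuousLinearMap.ext fun h => ?_
    simpa using h3 _ (hAp h)
  have hconst : ∀ y ∈ Metric.ball x δ, Y (lg E (f y)) = 0 := by
    intro y hy
    have h4 : Y (lg E (f y)) = Y (lg E (f x)) :=
      Metric.isOpen_ball.is_const_of_fderiv_eq_zero (𝕜 := K)
        (f := fun y => Y (lg E (f y))) (convex_ball x δ).isPreconnected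
        (fun z hz => (hder z hz).differentiableAt.differentiableWithinAt)
        (fun z hz => (hder z hz).fderiv) hy (Metric.mem_ball_self hδ)
    rw [h4, hfx, lg_one, hY0]
  filter_upwards [Metric.ball_mem_nhds x hδ, hft.eventually (eventually_ex_lg E G),
    hφt.eventually (eventually_ex_lg E G)] with y hy h1 h2
  have h3 := (hball y hy).2.2.2.2 (hconst y hy)
  exact h1.symm.trans ((congrArg (ex G) h3.symm).trans h2)

/-- A map whose logarithmic derivatives take values in `p` is continuous for the leaf topology. -/
theorem IsLeafChart.tendsto_leafFilter {p : Submodule 𝕜 E} {φ : p → G} (hφ : IsLeafChart φ)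
    {K : Type*} [RCLike K] [NormedAlgebra K 𝕜] [NormedSpace K E] [IsScalarTower K 𝕜 E]
    {F : Type*} [NormedAddCommGroup F] [NormedSpace K F] {f : F → G} {x : F} (hfx : f x = 1)
    (hf : ∀ᶠ y in 𝓝 x, ∃ A : F →L[K] E, HasLog f y A ∧ ∀ h, A h ∈ p) :
    Tendsto f (𝓝 x) (leafFilter φ) := by
  obtain ⟨S, hS0, hS, -, h⟩ := hφ.exists_retraction
  have hft : Tendsto f (𝓝 x) (𝓝 1) := by
    obtain ⟨A, hA, -⟩ := hf.self_of_nhds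
    simpa [hfx] using hA.1.tendsto
  have h1 : Tendsto (lg E) (𝓝 (1 : G)) (𝓝 0) := by
    simpa using (continuousAt_lg E G 𝕜).tendsto
  have h2 : Tendsto S (𝓝 0) (𝓝 0) := by simpa [hS0] using hS.continuousAt.tendsto
  have h3 : Tendsto (fun y => φ (S (lg E (f y)))) (𝓝 x) (leafFilter φ) :=
    tendsto_map.comp (h2.comp (h1.comp hft))
  refine h3.congr' ?_
  filter_upwards [h hfx hf] with y hy using hy.symm

section Tangent

variable {F : Type*} [NormedAddCommGroup F] [NormedSpace 𝕜 F] {p : Submodule 𝕜 E} {φ : p → G}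

/-- Tangent maps are continuous for the leaf topology. -/
theorem IsLeafChart.tendsto_pure_mul (hφ : IsLeafChart φ) {f : F → G}
    (hf : IsTangentMap p f) (x : F) : Tendsto f (𝓝 x) (pure (f x) * leafFilter φ) := by
  have h1 : Tendsto (fun y => (f x)⁻¹ * f y) (𝓝 x) (leafFilter φ) := by
    refine hφ.tendsto_leafFilter (K := 𝕜) (by simp) (Eventually.of_forall fun y => ?_)
    obtain ⟨A, hA, hAp⟩ := hf.log y
    exact ⟨A, hA.const_mul 𝕜 _, hAp⟩
  rw [Filter.pure_mul]
  refine (tendsto_map.comp h1).congr fun y => ?_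
  simp

/-- A tangent map whose logarithmic derivative maps onto `p` is open for the leaf topology. -/
theorem IsLeafChart.map_nhds_eq [CompleteSpace F] (hφ : IsLeafChart φ) {f : F → G}
    (hf : IsTangentMap p f) {x : F} {A : F →L[𝕜] E} (hA : HasLog f x A)
    (hsurj : ∀ v ∈ p, ∃ h, A h = v) : map f (𝓝 x) = pure (f x) * leafFilter φ := by
  have := FiniteDimensional.complete 𝕜 E
  have := topologicalGroup_of_lieGroup 𝓘(𝕜, E) ∞ (G := G)
  have hcp : CompleteSpace p := FiniteDimensional.complete 𝕜 p
  obtain ⟨S, hS0, hS, hSd, h⟩ := hφ.exists_retraction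
  let g : F → G := fun y => (f x)⁻¹ * f y
  have hgx : g x = 1 := by simp [g]
  have hgs : ContMDiffAt 𝓘(𝕜, F) 𝓘(𝕜, E) ∞ g x := contMDiffAt_const.mul (hf.contMDiff x)
  have h1 : ContDiffAt 𝕜 ∞ (fun y => lg E (g y)) x := contDiffAt_lg_comp hgs hgx
  have hgx' : lg E (g x) = 0 := by rw [hgx, lg_one]
  have hS' : ContDiffAt 𝕜 ∞ S (lg E (g x)) := by rwa [hgx']
  have hs : ContDiffAt 𝕜 ∞ (fun y => S (lg E (g y))) x := hS'.comp x h1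
  have hd : HasFDerivAt (fun y => S (lg E (g y))) ((fderiv 𝕜 S 0).comp A) x := by
    refine HasFDerivAt.comp x (g := S) ?_ hA.2
    rw [show lg E ((f x)⁻¹ * f x) = 0 from hgx']
    exact (hS.differentiableAt (by simp)).hasFDerivAt
  have hAp : ∀ u, A u ∈ p := by
    obtain ⟨B, hB, hBp⟩ := hf.log x
    rwa [hA.unique hB]
  have hmap : map (fun y => S (lg E (g y))) (𝓝 x) = 𝓝 0 := by
    have h2 := (hs.hasStrictFDerivAt' hd (by simp)).map_nhds_eq_of_surj (by
      refine LinearMap.range_eq_top.2 fun v => ?_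
      obtain ⟨u, hu⟩ := hsurj v v.2
      refine ⟨u, ?_⟩
      show fderiv 𝕜 S 0 (A u) = v
      rw [hu, hSd])
    rw [h2, hgx', hS0]
  have h2 : ∀ᶠ y in 𝓝 x, g y = φ (S (lg E (g y))) := by
    refine h (K := 𝕜) hgx (Eventually.of_forall fun y => ?_)
    obtain ⟨B, hB, hBp⟩ := hf.log y
    exact ⟨B, hB.const_mul 𝕜 _, hBp⟩
  have h3 : map f (𝓝 x) = map (fun y => f x * φ (S (lg E (g y)))) (𝓝 x) := by
    refine map_congr ?_
    filter_upwards [h2] with y hy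
    rw [← hy]
    simp [g]
  rw [h3, Filter.pure_mul, leafFilter, ← hmap, map_map, map_map]
  rfl

omit [FiniteDimensional 𝕜 E] in
/-- Injectivity of the logarithmic derivative of a smooth map is an open condition. -/
theorem HasLog.eventually_injective [CompleteSpace E] [FiniteDimensional 𝕜 F] {f : F → G} {x : F}
    (hf : ContMDiffAt 𝓘(𝕜, F) 𝓘(𝕜, E) ∞ f x) {A : F →L[𝕜] E} (hA : HasLog f x A)
    (hinj : Function.Injective A) :
    ∀ᶠ y in 𝓝 x, ∀ B : F →L[𝕜] E, HasLog f y B → Function.Injective B := by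
  let g : F → G := fun y => (f x)⁻¹ * f y
  have hgx : g x = 1 := by simp [g]
  have hgs : ContMDiffAt 𝓘(𝕜, F) 𝓘(𝕜, E) ∞ g x := contMDiffAt_const.mul hf
  have hgt : Tendsto g (𝓝 x) (𝓝 1) := by simpa [hgx] using hgs.continuousAt.tendsto
  have h1 : ContDiffAt 𝕜 ∞ (fun y => lg E (g y)) x := contDiffAt_lg_comp hgs hgx
  have hc : ContinuousAt (fderiv 𝕜 (fun y => lg E (g y))) x :=
    (h1.fderiv_right (m := 0) (by simp)).continuousAt
  have h2 : fderiv 𝕜 (fun y => lg E (g y)) x = A := hA.2.fderiv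
  have h3 : ∀ᶠ y in 𝓝 x, fderiv 𝕜 (fun y => lg E (g y)) y ∈
      {L : F →L[𝕜] E | Function.Injective L} :=
    hc.eventually (ContinuousLinearMap.isOpen_injective.mem_nhds (by rw [h2]; exact hinj))
  filter_upwards [h3, hgt.eventually (eventually_lg_comp 𝕜 E G (K := 𝕜) F)] with y hy h4 B hB
  have h5 := (h4 g y B rfl (hB.const_mul 𝕜 _)).fderiv
  rw [h5] at hy
  exact Function.Injective.of_comp hy

/-- A tangent map which is an immersion into the leaf, of the same dimension, is a local
homeomorphism for the leaf topology. -/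
theorem IsLeafChart.eventually_map_nhds_eq [FiniteDimensional 𝕜 F] (hφ : IsLeafChart φ)
    {f : F → G} (hf : IsTangentMap p f) {x : F} {A : F →L[𝕜] E} (hA : HasLog f x A)
    (hinj : Function.Injective A) (hdim : Module.finrank 𝕜 F = Module.finrank 𝕜 p) :
    ∀ᶠ y in 𝓝 x, map f (𝓝 y) = pure (f y) * leafFilter φ := by
  have := FiniteDimensional.complete 𝕜 E
  have := FiniteDimensional.complete 𝕜 F
  filter_upwards [hA.eventually_injective (hf.contMDiff x) hinj] with y hy
  obtain ⟨B, hB, hBp⟩ := hf.log y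
  refine hφ.map_nhds_eq hf hB fun v hv => ?_
  let B' : F →ₗ[𝕜] p := LinearMap.codRestrict p (B : F →ₗ[𝕜] E) hBp
  have hB' : Function.Injective B' := fun u w h => hy B hB (congrArg Subtype.val h)
  obtain ⟨h, hh⟩ := (LinearMap.injective_iff_surjective_of_finrank_eq_finrank hdim).1 hB' ⟨v, hv⟩
  exact ⟨h, congrArg Subtype.val hh⟩

end Tangent

end Leaf

section LeafFilter

variable {𝕜 : Type*} [RCLike 𝕜] {E : Type*} [NormedAddCommGroup E] [NormedSpace 𝕜 E]
  {G : Type*} [TopologicalSpace G] [ChartedSpace E G] [Group G] [LieGroup 𝓘(𝕜, E) ∞ G]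

/-! ### The adjoint representation preserves the bracket -/

/-- `Ad g` is a Lie algebra homomorphism: differentiate
`Ad (g x g⁻¹) (Ad g w) = Ad g (Ad x w)` at `x = 1`. -/
theorem Ad_brk [FiniteDimensional 𝕜 E] (g : G) (v w : E) :
    Ad 𝕜 E g (brk 𝕜 E G v w) = brk 𝕜 E G (Ad 𝕜 E g v) (Ad 𝕜 E g w) := by
  have := FiniteDimensional.complete 𝕜 E
  have h1 : HasLog (fun x : E => ex G x) 0 (ContinuousLinearMap.id 𝕜 E) := by
    refine (eventually_hasLog_ex 𝕜 E G (K := 𝕜) E).self_of_nhds (fun x => x) 0 _ rfl ?_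
    rw [frame_zero]
    exact hasFDerivAt_id 0
  have h2 : HasLog (fun x : E => g * ex G x * g⁻¹) 0 (Ad 𝕜 E g) := by
    refine ((h1.const_mul 𝕜 g).mul (𝕜 := 𝕜) (hasLog_const g⁻¹ 0)).congr_log ?_
    ext x
    simp
  obtain ⟨L, hL, hLd⟩ := h1.Ad_apply (𝕜 := 𝕜) w
  obtain ⟨L', hL', hLd'⟩ := h2.Ad_apply (𝕜 := 𝕜) (Ad 𝕜 E g w)
  have h3 : HasFDerivAt (fun x : E => Ad 𝕜 E g (Ad 𝕜 E (ex G x) w)) ((Ad 𝕜 E g).comp L) 0 :=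
    HasFDerivAt.comp 0 (Ad 𝕜 E g).hasFDerivAt hLd
  have h4 : (fun x : E => Ad 𝕜 E (g * ex G x * g⁻¹) (Ad 𝕜 E g w)) =
      fun x : E => Ad 𝕜 E g (Ad 𝕜 E (ex G x) w) := by
    funext x
    rw [Ad_mul_apply, Ad_mul_apply, Ad_inv_apply_self]
  rw [h4] at hLd'
  have h5 := DFunLike.congr_fun (h3.unique hLd') v
  simpa [hL, hL', Ad_one] using h5

variable (G) in
/-- The subalgebra of all `v ∈ p` with `Ad g v ∈ p`. -/
def stabSubspace (p : Submodule 𝕜 E) (g : G) : Submodule 𝕜 E :=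
  p ⊓ p.comap (Ad 𝕜 E g : E →ₗ[𝕜] E)

theorem IsBracketClosed.stabSubspace [FiniteDimensional 𝕜 E] {p : Submodule 𝕜 E}
    (hp : IsBracketClosed G p) (g : G) : IsBracketClosed G (stabSubspace G p g) := by
  rintro v ⟨hv, hv'⟩ w ⟨hw, hw'⟩
  refine ⟨hp v hv w hw, ?_⟩
  show Ad 𝕜 E g (brk 𝕜 E G v w) ∈ p
  rw [Ad_brk]
  exact hp _ hv' _ hw'

/-! ### The leaf topology -/

variable [FiniteDimensional 𝕜 E] {p : Submodule 𝕜 E} {φ : p → G}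

omit [LieGroup 𝓘(𝕜, E) ∞ G] [FiniteDimensional 𝕜 E] in
theorem IsLeafChart.pure_one_le (hφ : IsLeafChart φ) : pure 1 ≤ leafFilter φ := by
  rw [leafFilter, ← hφ.map_zero, ← Filter.map_pure]
  exact map_mono (pure_le_nhds 0)

theorem IsLeafChart.leafFilter_mul_self (hφ : IsLeafChart φ) (hp : IsBracketClosed G p) :
    leafFilter φ * leafFilter φ = leafFilter φ := by
  refine le_antisymm ?_ ?_
  · have h1 : IsTangentMap p (fun x : p × p => φ x.1 * φ x.2) :=
      (hφ.tangent.comp (ContinuousLinearMap.fst 𝕜 p p)).mul hp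
        (hφ.tangent.comp (ContinuousLinearMap.snd 𝕜 p p))
    have h2 := hφ.tendsto_pure_mul h1 (0, 0)
    rw [leafFilter, ← map₂_mul, map₂_map_left, map₂_map_right, ← map_prod_eq_map₂,
      ← nhds_prod_eq]
    have h3 : φ (0, 0).1 * φ (0, 0).2 = 1 := by simp [hφ.map_zero]
    rw [h3, Filter.pure_one, one_mul] at h2
    exact h2
  · conv_lhs => rw [← one_mul (leafFilter φ)]
    exact mul_le_mul_left hφ.pure_one_le _

/-- If `Ad g j ≤ p`, then conjugation by `g` carries maps tangent to `j` to maps which are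
continuous for the leaf topology of `p`. -/
theorem IsLeafChart.pure_mul_map_le (hφ : IsLeafChart φ) {g : G} {j : Submodule 𝕜 E}
    {F : Type*} [NormedAddCommGroup F] [NormedSpace 𝕜 F] {f : F → G}
    (hf : IsTangentMap j f) {x : F} (hfx : f x = 1) (hj : ∀ v ∈ j, Ad 𝕜 E g v ∈ p) :
    pure g * map f (𝓝 x) ≤ leafFilter φ * pure g := by
  have h1 : Tendsto (fun y => g * f y * g⁻¹) (𝓝 x) (leafFilter φ) := by
    refine hφ.tendsto_leafFilter (K := 𝕜) (by simp [hfx]) (Eventually.of_forall fun y => ?_)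
    obtain ⟨A, hA, hAp⟩ := hf.log y
    refine ⟨_, (hA.const_mul 𝕜 g).mul (𝕜 := 𝕜) (hasLog_const g⁻¹ y), fun h => ?_⟩
    simpa using hj _ (hAp h)
  have h2 : Tendsto (fun y => g * f y) (𝓝 x) (map (· * g) (leafFilter φ)) := by
    refine (tendsto_map.comp h1).congr fun y => ?_
    simp
  rw [Filter.pure_mul, map_map, Filter.mul_pure]
  exact h2

theorem IsLeafChart.pure_mul_comm (hφ : IsLeafChart φ) (hp : IsBracketClosed G p) {a : G}
    (ha : a ∈ expSubgroup G p) : pure a * leafFilter φ = leafFilter φ * pure a := by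
  have key : ∀ a ∈ expSubgroup G p, pure a * leafFilter φ ≤ leafFilter φ * pure a :=
    fun a ha => hφ.pure_mul_map_le hφ.tangent hφ.map_zero fun v hv => hp.Ad_mem ha hv
  refine le_antisymm (key a ha) ?_
  have h1 := key a⁻¹ (inv_mem ha)
  have h2 := mul_le_mul_left (mul_le_mul_right h1 (pure a)) (pure a)
  have h3 : (pure a * pure a⁻¹ : Filter G) = 1 := by simp
  have h4 : (pure a⁻¹ * pure a : Filter G) = 1 := by simp
  rwa [← mul_assoc (pure a) (pure a⁻¹), h3, one_mul, ← mul_assoc, mul_assoc, h4, mul_one] at h2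

/-- The filter of neighbourhoods of `g` in the leaf topology of the double cosets. -/
def cosetFilter (φ : p → G) (g : G) : Filter G := leafFilter φ * pure g * leafFilter φ

theorem IsLeafChart.cosetFilter_mul (hφ : IsLeafChart φ) (hp : IsBracketClosed G p) {a b : G}
    (ha : a ∈ expSubgroup G p) (hb : b ∈ expSubgroup G p) (g : G) :
    cosetFilter φ (a * g * b) = pure a * cosetFilter φ g * pure b := by
  simp only [cosetFilter, ← Filter.pure_mul_pure, mul_assoc, ← hφ.pure_mul_comm hp hb]
  simp only [← mul_assoc, ← hφ.pure_mul_comm hp ha]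

omit [LieGroup 𝓘(𝕜, E) ∞ G] [FiniteDimensional 𝕜 E] in
theorem IsLeafChart.mem_leafFilter_expSubgroup (hφ : IsLeafChart φ) :
    (expSubgroup G p : Set G) ∈ leafFilter φ :=
  Filter.mem_map.2 (univ_mem' fun x => hφ.tangent.mem x)

/-- The filters `cosetFilter φ g` are the neighbourhood filters of a topology on `G`; this is its
restriction to a set `X`. -/
theorem IsLeafChart.exists_topology (hφ : IsLeafChart φ) (hp : IsBracketClosed G p) (X : Set G) :
    ∃ τ : TopologicalSpace X, ∀ y, @nhds X τ y = comap Subtype.val (cosetFilter φ (y : G)) := by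
  refine ⟨@TopologicalSpace.induced X G Subtype.val (TopologicalSpace.mkOfNhds (cosetFilter φ)),
    fun y => ?_⟩
  rw [@nhds_induced G X (TopologicalSpace.mkOfNhds (cosetFilter φ)) Subtype.val y]
  congr 1
  refine TopologicalSpace.nhds_mkOfNhds _ (y : G) (fun g => ?_) ?_
  · calc pure g = pure 1 * pure g * pure 1 := by simp
      _ ≤ _ := mul_le_mul' (mul_le_mul' hφ.pure_one_le le_rfl) hφ.pure_one_le
  · intro g s hs
    have h1 : s ∈ leafFilter φ * (leafFilter φ * pure g * leafFilter φ) * leafFilter φ := by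
      rw [← mul_assoc, ← mul_assoc, hφ.leafFilter_mul_self hp, mul_assoc, hφ.leafFilter_mul_self hp]
      exact hs
    obtain ⟨u, ⟨u1, hu1, u2, hu2, hu⟩, v, hv, huv⟩ := h1
    refine mem_of_superset hu2 fun y hy => ?_
    refine ⟨u1 * {y}, Filter.mul_mem_mul hu1 (by simp), v, hv, ?_⟩
    exact (Set.mul_subset_mul_right ((Set.mul_subset_mul_left (by simpa using hy)).trans hu)).trans
      huv

theorem map_mul_nhds_prod {G : Type*} [Group G] {X Y : Type*} [TopologicalSpace X]
    [TopologicalSpace Y] (f : X → G) (g : G) (h : Y → G) (z : X × Y) :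
    map (fun z : X × Y => f z.1 * g * h z.2) (𝓝 z) = map f (𝓝 z.1) * pure g * map h (𝓝 z.2) := by
  rw [Filter.mul_pure, map_map, ← map₂_mul, map₂_map_left, map₂_map_right, nhds_prod_eq,
    ← map_prod_eq_map₂]
  rfl

theorem IsLeafChart.map_mul_le_cosetFilter (hφ : IsLeafChart φ) (hp : IsBracketClosed G p)
    {F : Type*} [NormedAddCommGroup F] [NormedSpace 𝕜 F] {F' : Type*} [NormedAddCommGroup F']
    [NormedSpace 𝕜 F'] {f : F → G} {h : F' → G} (hf : IsTangentMap p f) (hh : IsTangentMap p h)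
    (g : G) (z : F × F') :
    map (fun z : F × F' => f z.1 * g * h z.2) (𝓝 z) ≤ cosetFilter φ (f z.1 * g * h z.2) := by
  have h1 : map f (𝓝 z.1) ≤ _ := hφ.tendsto_pure_mul hf z.1
  have h2 : map h (𝓝 z.2) ≤ _ := hφ.tendsto_pure_mul hh z.2
  calc map (fun z : F × F' => f z.1 * g * h z.2) (𝓝 z)
      = map f (𝓝 z.1) * pure g * map h (𝓝 z.2) := map_mul_nhds_prod f g h z
    _ ≤ pure (f z.1) * leafFilter φ * pure g * (pure (h z.2) * leafFilter φ) :=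
        mul_le_mul' (mul_le_mul' h1 le_rfl) h2
    _ = _ := by
        rw [hφ.pure_mul_comm hp (hf.mem z.1), cosetFilter]
        simp only [← Filter.pure_mul_pure, mul_assoc]

/-- A parametrization `(x, y) ↦ φ x * g * χ y` of the double coset of `g` near `g`: an immersion
into `G`, and a local homeomorphism for the leaf topology. Here `y` runs through a complement `m` in
`p` of the infinitesimal stabilizer `stabSubspace G p g`. -/
theorem IsLeafChart.exists_slice (hφ : IsLeafChart φ) (hp : IsBracketClosed G p) (g : G) :
    ∃ (m : Submodule 𝕜 E) (χ : m → G), χ 0 = 1 ∧ IsTangentMap p χ ∧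
      HasLog (fun x : p × m => φ x.1 * g * χ x.2) 0
        ((Ad 𝕜 E g⁻¹).comp (p.subtypeL.comp (ContinuousLinearMap.fst 𝕜 p m)) +
          m.subtypeL.comp (ContinuousLinearMap.snd 𝕜 p m)) ∧
      Function.Injective ((Ad 𝕜 E g⁻¹).comp (p.subtypeL.comp (ContinuousLinearMap.fst 𝕜 p m)) +
          m.subtypeL.comp (ContinuousLinearMap.snd 𝕜 p m)) ∧
      ∀ᶠ x in 𝓝 (0 : p × m), map (fun x : p × m => φ x.1 * g * χ x.2) (𝓝 x) =
        cosetFilter φ (φ x.1 * g * χ x.2) := by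
  have hj := hp.stabSubspace g
  set j := stabSubspace G p g with hjdef
  have hjp : j ≤ p := inf_le_left
  have hjg : ∀ v ∈ j, Ad 𝕜 E g v ∈ p := fun v hv => hv.2
  -- a complement of `j` in `p`
  obtain ⟨m, hm⟩ : ∃ m : Submodule 𝕜 E, m ≤ p ∧ Disjoint j m ∧ j ⊔ m = p := by
    obtain ⟨m', hm'⟩ := j.exists_isCompl
    refine ⟨m' ⊓ p, inf_le_right, hm'.disjoint.mono_right inf_le_left, ?_⟩
    rw [sup_inf_assoc_of_le m' hjp |>.symm, hm'.sup_eq_top, top_inf_eq]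
  obtain ⟨hmp, hjm, hsup⟩ := hm
  obtain ⟨χ, hχ0, hχ, hχlog⟩ := exists_isTangentMap (G := G) hp hmp
  obtain ⟨σ, hσ0, hσ, hσlog⟩ := exists_isTangentMap (G := G) hj le_rfl
  have hσp : IsTangentMap p σ := by
    refine ⟨hσ.contMDiff, fun x => ?_, fun x => ?_⟩
    · refine Subgroup.closure_mono ?_ (hσ.mem x)
      rintro _ ⟨v, hv, h⟩
      exact ⟨v, hjp hv, h⟩
    · obtain ⟨A, hA, hAp⟩ := hσ.log x
      exact ⟨A, hA, fun h => hjp (hAp h)⟩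
  refine ⟨m, χ, hχ0, hχ, ?_, ?_, ?_⟩
  · have h1 : HasLog (fun x : p × m => φ x.1) 0
        (p.subtypeL.comp (ContinuousLinearMap.fst 𝕜 p m)) :=
      HasLog.comp (h := fun x : p × m => x.1) hφ.log_zero
        (ContinuousLinearMap.fst 𝕜 p m).hasFDerivAt
    have h2 : HasLog (fun x : p × m => χ x.2) 0
        (m.subtypeL.comp (ContinuousLinearMap.snd 𝕜 p m)) :=
      HasLog.comp (h := fun x : p × m => x.2) hχlog
        (ContinuousLinearMap.snd 𝕜 p m).hasFDerivAt
    refine ((h1.mul (𝕜 := 𝕜) (hasLog_const g 0)).mul (𝕜 := 𝕜) h2).congr_log ?_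
    ext x <;> simp [hχ0, Ad_one]
  · rw [injective_iff_map_eq_zero]
    rintro ⟨x, y⟩ hxy
    have h1 : Ad 𝕜 E g⁻¹ (x : E) + y = 0 := hxy
    have h2 : (x : E) + Ad 𝕜 E g y = 0 := by
      have := congrArg (Ad 𝕜 E g) h1
      simpa using this
    have h3 : Ad 𝕜 E g (y : E) ∈ p := by
      rw [← neg_eq_of_add_eq_zero_right h2]
      exact p.neg_mem x.2
    have h4 : (y : E) = 0 := by
      refine (Submodule.disjoint_def.1 hjm) y ⟨hmp y.2, h3⟩ y.2
    have h5 : (x : E) = 0 := by simpa [h4] using h2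
    exact Prod.ext (Subtype.ext h5) (Subtype.ext h4)
  · -- `κ` is a second chart of the leaf; it splits a small element of the subgroup into a factor
    -- that moves past `g` to the left, and a factor in the direction of `m`
    let κ : j × m → G := fun x => σ x.1 * χ x.2
    have hκ : IsTangentMap p κ := (hσp.comp (ContinuousLinearMap.fst 𝕜 j m)).mul hp
      (hχ.comp (ContinuousLinearMap.snd 𝕜 j m))
    have hκlog : HasLog κ 0 (j.subtypeL.comp (ContinuousLinearMap.fst 𝕜 j m) +
        m.subtypeL.comp (ContinuousLinearMap.snd 𝕜 j m)) := by
      have h1 : HasLog (fun x : j × m => σ x.1) 0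
          (j.subtypeL.comp (ContinuousLinearMap.fst 𝕜 j m)) :=
        HasLog.comp (h := fun x : j × m => x.1) hσlog
          (ContinuousLinearMap.fst 𝕜 j m).hasFDerivAt
      have h2 : HasLog (fun x : j × m => χ x.2) 0
          (m.subtypeL.comp (ContinuousLinearMap.snd 𝕜 j m)) :=
        HasLog.comp (h := fun x : j × m => x.2) hχlog
          (ContinuousLinearMap.snd 𝕜 j m).hasFDerivAt
      refine (h1.mul (𝕜 := 𝕜) h2).congr_log ?_
      ext x <;> simp [hχ0, Ad_one]
    have hκmap := hφ.eventually_map_nhds_eq hκ hκlog (by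
      rw [injective_iff_map_eq_zero]
      rintro ⟨x, y⟩ hxy
      have h1 : (x : E) + y = 0 := hxy
      have h2 : (y : E) = 0 := by
        refine (Submodule.disjoint_def.1 hjm) y ?_ y.2
        rw [← neg_eq_of_add_eq_zero_right h1]
        exact j.neg_mem x.2
      have h3 : (x : E) = 0 := by simpa [h2] using h1
      exact Prod.ext (Subtype.ext h3) (Subtype.ext h2)) (by
      rw [Module.finrank_prod, ← Submodule.finrank_sup_add_finrank_inf_eq, hsup,
        disjoint_iff.1 hjm, finrank_bot, add_zero])
    have hφmap := hφ.eventually_map_nhds_eq hφ.tangent hφ.log_zero Subtype.val_injective rfl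
    have ht1 : Tendsto (fun x : p × m => x.1) (𝓝 0) (𝓝 0) := continuous_fst.tendsto _
    have ht2 : Tendsto (fun x : p × m => ((0 : j), x.2)) (𝓝 0) (𝓝 0) :=
      (Continuous.prodMk_right (0 : j)).comp continuous_snd |>.tendsto _
    filter_upwards [ht1.eventually hφmap, ht2.eventually hκmap] with ⟨x, y⟩ h1 h2
    have hx := hφ.tangent.mem x
    simp only at h1 h2
    apply le_antisymm (hφ.map_mul_le_cosetFilter hp hφ.tangent hχ g (x, y))
    rw [map_mul_nhds_prod]
    · have h3 : map κ (𝓝 (0, y)) = map σ (𝓝 0) * map χ (𝓝 y) := by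
        rw [← map₂_mul, map₂_map_left, map₂_map_right, nhds_prod_eq, ← map_prod_eq_map₂]
      have h4 : κ (0, y) = χ y := by simp [κ, hσ0]
      rw [h4] at h2
      calc cosetFilter φ (φ x * g * χ y)
          = leafFilter φ * pure (φ x) * pure g * (pure (χ y) * leafFilter φ) := by
            rw [cosetFilter]
            simp only [← Filter.pure_mul_pure, mul_assoc]
        _ = leafFilter φ * pure (φ x) * (pure g * map σ (𝓝 0)) * map χ (𝓝 y) := by
            rw [← h2, h3]
            simp only [mul_assoc]
        _ ≤ leafFilter φ * pure (φ x) * (leafFilter φ * pure g) * map χ (𝓝 y) :=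
            mul_le_mul_left (mul_le_mul_right (hφ.pure_mul_map_le hσ hσ0 hjg) _) _
        _ = map φ (𝓝 x) * pure g * map χ (𝓝 y) := by
            rw [h1, ← hφ.pure_mul_comm hp hx, mul_assoc (pure (φ x)), ← mul_assoc (leafFilter φ)
              (leafFilter φ), hφ.leafFilter_mul_self hp, ← mul_assoc (pure (φ x))]

end LeafFilter

section ImmersedSubmanifold

variable {𝕜 : Type*} [RCLike 𝕜] {E : Type*} [NormedAddCommGroup E] [NormedSpace 𝕜 E]

/-! ### Immersed submanifolds from local parametrizations -/

/-- An immersion has smooth local left inverses. -/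
theorem exists_contDiffAt_leftInverse [FiniteDimensional 𝕜 E] {F : Type*} [NormedAddCommGroup F]
    [NormedSpace 𝕜 F] [FiniteDimensional 𝕜 F] {h : F → E} {x : F}
    (hh : ∀ᶠ z in 𝓝 x, ContDiffAt 𝕜 ∞ h z) {A : F →L[𝕜] E} (hA : HasFDerivAt h A x)
    (hinj : Function.Injective A) :
    ∃ ρ : E → F, ∀ᶠ z in 𝓝 x, ContDiffAt 𝕜 ∞ ρ (h z) ∧ ρ (h z) = z := by
  have := FiniteDimensional.complete 𝕜 E
  have := FiniteDimensional.complete 𝕜 F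
  obtain ⟨ℓ', hℓ'⟩ := LinearMap.exists_leftInverse_of_injective (A : F →ₗ[𝕜] E)
    (LinearMap.ker_eq_bot.2 hinj)
  let ℓ : E →L[𝕜] F := ℓ'.toContinuousLinearMap
  let k : F → F := fun z => ℓ (h z)
  have hk : ∀ᶠ z in 𝓝 x, ContDiffAt 𝕜 ∞ k z := by
    filter_upwards [hh] with z hz using ℓ.contDiff.contDiffAt.comp z hz
  have hkd : HasFDerivAt k ((ContinuousLinearEquiv.refl 𝕜 F : F ≃L[𝕜] F) : F →L[𝕜] F) x := by
    refine (HasFDerivAt.comp x ℓ.hasFDerivAt hA).congr_fderiv ?_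
    refine ContinuousLinearMap.ext fun v => ?_
    exact DFunLike.congr_fun hℓ' v
  have hk0 := hk.self_of_nhds
  have hs := hk0.hasStrictFDerivAt' hkd (by simp)
  let e := hs.toOpenPartialHomeomorph k
  have hc : ContinuousAt (fderiv 𝕜 k) x := (hk0.fderiv_right (m := 0) (by simp)).continuousAt
  have hinv : ∀ᶠ z in 𝓝 x, fderiv 𝕜 k z ∈
      range ((↑) : (F ≃L[𝕜] F) → F →L[𝕜] F) := by
    refine hc.eventually ?_
    rw [hkd.fderiv]
    exact ContinuousLinearEquiv.nhds _
  refine ⟨fun w => e.symm (ℓ w), ?_⟩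
  filter_upwards [hk, hinv, e.open_source.mem_nhds hs.mem_toOpenPartialHomeomorph_source]
    with z hz ⟨A', hA'⟩ hze
  have h1 : e.symm (k z) = z := e.left_inv hze
  refine ⟨?_, h1⟩
  have h2 : ContDiffAt 𝕜 ∞ e.symm (k z) := by
    refine e.contDiffAt_symm (f₀' := A') (e.map_source hze) ?_ ?_
    · rw [h1, hA']
      exact (hz.differentiableAt (by simp)).hasFDerivAt
    · rw [h1]
      exact hz
  exact ContDiffAt.comp (h z) (g := e.symm) h2 ℓ.contDiff.contDiffAt

universe v

/-- Local parametrizations, open for the topology of `N` and with smooth local left inverses on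
`M`, make an injection `N → M` an immersion. -/
theorem isImmersedSubmanifold_range {M : Type v} [TopologicalSpace M] [ChartedSpace E M]
    [IsManifold 𝓘(𝕜, E) ∞ M] {N : Type v} [TopologicalSpace N] [SigmaCompactSpace N] {ι : N → M}
    (hι : Function.Injective ι) {d : ℕ}
    (H : ∀ y : N, ∃ (ψ : EuclideanSpace 𝕜 (Fin d) → N) (ρ : M → EuclideanSpace 𝕜 (Fin d)),
      ψ 0 = y ∧ ∀ᶠ z in 𝓝 0,
        ContMDiffAt 𝓘(𝕜, EuclideanSpace 𝕜 (Fin d)) 𝓘(𝕜, E) ∞ (fun z => ι (ψ z)) z ∧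
        ContMDiffAt 𝓘(𝕜, E) 𝓘(𝕜, EuclideanSpace 𝕜 (Fin d)) ∞ ρ (ι (ψ z)) ∧
        ρ (ι (ψ z)) = z ∧ map ψ (𝓝 z) = 𝓝 (ψ z)) :
    IsImmersedSubmanifold 𝕜 E (range ι) := by
  choose ψ ρ hψ0 H using H
  have H' : ∀ y, ∃ U : Set (EuclideanSpace 𝕜 (Fin d)), (∀ z ∈ U,
      ContMDiffAt 𝓘(𝕜, EuclideanSpace 𝕜 (Fin d)) 𝓘(𝕜, E) ∞ (fun z => ι (ψ y z)) z ∧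
        ContMDiffAt 𝓘(𝕜, E) 𝓘(𝕜, EuclideanSpace 𝕜 (Fin d)) ∞ (ρ y) (ι (ψ y z)) ∧
        ρ y (ι (ψ y z)) = z ∧ map (ψ y) (𝓝 z) = 𝓝 (ψ y z)) ∧ IsOpen U ∧ 0 ∈ U :=
    fun y => eventually_nhds_iff.1 (H y)
  choose U hU hUo hU0 using H'
  let e : N → OpenPartialHomeomorph N (EuclideanSpace 𝕜 (Fin d)) := fun y =>
    { toFun := fun n => ρ y (ι n)
      invFun := ψ y
      source := ψ y '' U y
      target := U y
      map_source' := by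
        rintro _ ⟨z, hz, rfl⟩
        rw [(hU y z hz).2.2.1]
        exact hz
      map_target' := fun z hz => mem_image_of_mem _ hz
      left_inv' := by
        rintro _ ⟨z, hz, rfl⟩
        rw [(hU y z hz).2.2.1]
      right_inv' := fun z hz => (hU y z hz).2.2.1
      open_source := by
        rw [isOpen_iff_mem_nhds]
        rintro _ ⟨z, hz, rfl⟩
        rw [← (hU y z hz).2.2.2]
        exact image_mem_map ((hUo y).mem_nhds hz)
      open_target := hUo y
      continuousOn_toFun := by
        rintro _ ⟨z, hz, rfl⟩
        refine ContinuousAt.continuousWithinAt ?_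
        rw [ContinuousAt, ← (hU y z hz).2.2.2, (hU y z hz).2.2.1, tendsto_map'_iff]
        refine tendsto_id.congr' ?_
        filter_upwards [(hUo y).mem_nhds hz] with w hw using (hU y w hw).2.2.1.symm
      continuousOn_invFun := fun z hz =>
        ContinuousAt.continuousWithinAt (hU y z hz).2.2.2.le }
  let cs : ChartedSpace (EuclideanSpace 𝕜 (Fin d)) N :=
    { atlas := range e
      chartAt := e
      mem_chart_source := fun y => ⟨0, hU0 y, hψ0 y⟩
      chart_mem_atlas := fun y => mem_range_self y }
  -- the transition maps are `ρ y' ∘ ι ∘ ψ y`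
  have hM : IsManifold 𝓘(𝕜, EuclideanSpace 𝕜 (Fin d)) ∞ N := by
    refine isManifold_of_contDiffOn _ _ _ ?_
    rintro _ _ ⟨y, rfl⟩ ⟨y', rfl⟩ z hz
    have hz1 : z ∈ U y := hz.1.1
    obtain ⟨z', hz', hzz'⟩ : ψ y z ∈ ψ y' '' U y' := hz.1.2
    have h1 : ContMDiffAt 𝓘(𝕜, E) 𝓘(𝕜, EuclideanSpace 𝕜 (Fin d)) ∞ (ρ y') (ι (ψ y z)) := by
      rw [← hzz']
      exact (hU y' z' hz').2.1
    exact (ContMDiffAt.comp z h1 (hU y z hz1).1).contDiffAt.contDiffWithinAt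
  have hem : ∀ y, ContMDiffAt 𝓘(𝕜, EuclideanSpace 𝕜 (Fin d)) 𝓘(𝕜, EuclideanSpace 𝕜 (Fin d)) ∞
      (fun n => ρ y (ι n)) y := fun y =>
    contMDiffOn_chart.contMDiffAt ((e y).open_source.mem_nhds ⟨0, hU0 y, hψ0 y⟩)
  have hsm : ∀ y, ContMDiffAt 𝓘(𝕜, EuclideanSpace 𝕜 (Fin d)) 𝓘(𝕜, EuclideanSpace 𝕜 (Fin d)) ∞
      (ψ y) 0 := fun y =>
    (contMDiffOn_chart_symm (x := y) (I := 𝓘(𝕜, EuclideanSpace 𝕜 (Fin d)))).contMDiffAt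
      ((hUo y).mem_nhds (hU0 y))
  have hleft : ∀ y, ∀ᶠ n in 𝓝 y, ψ y (ρ y (ι n)) = n := fun y => by
    filter_upwards [(e y).open_source.mem_nhds ⟨0, hU0 y, hψ0 y⟩] with n hn
    exact (e y).left_inv hn
  have hρy : ∀ y, ρ y (ι y) = 0 := fun y => by
    have := (hU y 0 (hU0 y)).2.2.1
    rwa [hψ0] at this
  have hιs : ContMDiff 𝓘(𝕜, EuclideanSpace 𝕜 (Fin d)) 𝓘(𝕜, E) ∞ ι := by
    intro y
    have h1 : ContMDiffAt 𝓘(𝕜, EuclideanSpace 𝕜 (Fin d)) 𝓘(𝕜, E) ∞ (fun z => ι (ψ y z))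
        (ρ y (ι y)) := by
      rw [hρy]
      exact (hU y 0 (hU0 y)).1
    refine (ContMDiffAt.comp y h1 (hem y)).congr_of_eventuallyEq ?_
    filter_upwards [hleft y] with n hn
    exact congrArg ι hn.symm
  refine ⟨d, N, inferInstance, cs, ι, ?_, hM, hιs, ?_, hι, rfl⟩
  · exact ChartedSpace.secondCountable_of_sigmaCompact (EuclideanSpace 𝕜 (Fin d)) N
  · intro y
    have h1 : MDifferentiableAt 𝓘(𝕜, EuclideanSpace 𝕜 (Fin d)) 𝓘(𝕜, E) ι y :=
      (hιs y).mdifferentiableAt (by simp)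
    have h2 : HasMFDerivAt 𝓘(𝕜, E) 𝓘(𝕜, EuclideanSpace 𝕜 (Fin d)) (ρ y) (ι y)
        (mfderiv 𝓘(𝕜, E) 𝓘(𝕜, EuclideanSpace 𝕜 (Fin d)) (ρ y) (ι y)) := by
      have := (hU y 0 (hU0 y)).2.1
      rw [hψ0] at this
      exact (this.mdifferentiableAt (by simp)).hasMFDerivAt
    have h3 : HasMFDerivAt 𝓘(𝕜, EuclideanSpace 𝕜 (Fin d)) 𝓘(𝕜, EuclideanSpace 𝕜 (Fin d)) (ψ y)
        (ρ y (ι y)) (mfderiv 𝓘(𝕜, EuclideanSpace 𝕜 (Fin d)) 𝓘(𝕜, EuclideanSpace 𝕜 (Fin d)) (ψ y)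
        (ρ y (ι y))) := by
      rw [hρy]
      exact ((hsm y).mdifferentiableAt (by simp)).hasMFDerivAt
    -- the composite `ψ y ∘ ρ y ∘ ι` is the identity near `y`, so the derivative of `ι` is injective
    have h4 := h3.comp y (h2.comp y h1.hasMFDerivAt)
    have h5 := (hasMFDerivAt_id (I := 𝓘(𝕜, EuclideanSpace 𝕜 (Fin d))) y).congr_of_eventuallyEq
      (f₁ := ψ y ∘ ρ y ∘ ι) (hleft y)
    have h6 := hasMFDerivAt_unique h4 h5
    intro v w hvw
    have h7 := DFunLike.congr_fun h6 v
    have h8 := DFunLike.congr_fun h6 w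
    simp only [ContinuousLinearMap.comp_apply] at h7 h8
    exact h7.symm.trans ((congrArg (fun u => mfderiv 𝓘(𝕜, EuclideanSpace 𝕜 (Fin d))
      𝓘(𝕜, EuclideanSpace 𝕜 (Fin d)) (ψ y) (ρ y (ι y)) (mfderiv 𝓘(𝕜, E)
      𝓘(𝕜, EuclideanSpace 𝕜 (Fin d)) (ρ y) (ι y) u)) hvw).trans h8)

end ImmersedSubmanifold

section DoubleCoset

open ContinuousLinearMap (toSpanSingleton)

variable {𝕜 : Type*} [RCLike 𝕜] {E : Type*} [NormedAddCommGroup E] [NormedSpace 𝕜 E]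
  [FiniteDimensional 𝕜 E]
  {G : Type*} [TopologicalSpace G] [ChartedSpace E G] [Group G] [LieGroup 𝓘(𝕜, E) ∞ G]

omit [FiniteDimensional 𝕜 E] in
theorem eventually_contMDiffAt_lg :
    ∀ᶠ g in 𝓝 (1 : G), ContMDiffAt 𝓘(𝕜, E) 𝓘(𝕜, E) ∞ (lg E) g := by
  filter_upwards [chart_source_mem_nhds E (1 : G)] with g hg
  have h1 : ContMDiffAt 𝓘(𝕜, E) 𝓘(𝕜, E) ∞ (chartAt E (1 : G)) g :=
    contMDiffOn_chart.contMDiffAt ((chartAt E (1 : G)).open_source.mem_nhds hg)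
  have h2 : ContMDiffAt 𝓘(𝕜, E) 𝓘(𝕜, E) ∞ (fun y : E => y - chartAt E (1 : G) 1)
      (chartAt E (1 : G) g) := (contDiff_id.sub contDiff_const).contDiffAt.contMDiffAt
  exact h2.comp g h1

/-! ### Double cosets are immersed submanifolds -/

variable {p : Submodule 𝕜 E} {φ : p → G}

/-- The subgroup is generated, as a monoid, by the range of the leaf chart. -/
theorem IsLeafChart.exists_list_prod (hφ : IsLeafChart φ) {a : G}
    (ha : a ∈ expSubgroup G p) : ∃ (k : ℕ) (x : Fin k → p),
      (List.ofFn fun i => φ (x i)).prod = a := by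
  have key : ∀ γ : 𝕜 → G, ∀ v ∈ p, γ 0 = 1 → (∀ t, HasLog γ t (toSpanSingleton 𝕜 v)) →
      γ 1 ∈ Submonoid.closure (range φ) := by
    intro γ v hv hγ0 hγ
    have h1 : Tendsto γ (𝓝 0) (leafFilter φ) :=
      hφ.tendsto_leafFilter (K := 𝕜) hγ0 (Eventually.of_forall fun t =>
        ⟨_, hγ t, fun h => by simpa using p.smul_mem h hv⟩)
    have h2 : Tendsto (fun n : ℕ => (((n : ℕ) + 1 : ℕ) : 𝕜)⁻¹) atTop (𝓝 0) :=
      (tendsto_inv_atTop_nhds_zero_nat (𝕜 := 𝕜)).comp (tendsto_add_atTop_nat 1)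
    have h3 : range φ ∈ leafFilter φ := Filter.mem_map.2 (univ_mem' fun x => mem_range_self x)
    -- `γ 1` is the `n`-th power of `γ (1 / n)`, which is in the range of the chart for large `n`
    obtain ⟨n, hn⟩ := ((h1.comp h2).eventually_mem h3).exists
    have hpow : ∀ (k : ℕ) (s : 𝕜), γ (k * s) = γ s ^ k := by
      intro k s
      induction k with
      | zero => simp [hγ0]
      | succ k ih =>
        rw [pow_succ, ← ih, ← map_add_of_hasLog (𝕜 := 𝕜) hγ0 hγ]
        congr 1
        push_cast
        ring
    have h4 := hpow (n + 1) (((n + 1 : ℕ) : 𝕜)⁻¹)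
    rw [mul_inv_cancel₀ (Nat.cast_ne_zero.2 n.succ_ne_zero)] at h4
    rw [h4]
    exact pow_mem (Submonoid.subset_closure hn) _
  have h1 : a ∈ Submonoid.closure (range φ) := by
    have h2 : a ∈ Submonoid.closure (expSet G p ∪ (expSet G p)⁻¹) := by
      rw [← Subgroup.closure_toSubmonoid]
      exact ha
    refine (Submonoid.closure_le.2 ?_) h2
    rintro b (⟨v, hv, γ, hγ0, hγ, rfl⟩ | ⟨v, hv, γ, hγ0, hγ, hb⟩)
    · exact key γ v hv hγ0 hγ
    · have h3 : γ (-1) * γ 1 = 1 := by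
        rw [← map_add_of_hasLog (𝕜 := 𝕜) hγ0 hγ, neg_add_cancel, hγ0]
      have h4 : b = γ (-1) := by
        rw [eq_inv_of_mul_eq_one_left h3, hb, inv_inv]
      rw [h4]
      refine key (fun t => γ (-t)) (-v) (p.neg_mem hv) (by simpa using hγ0) fun t => ?_
      refine ((hγ (-t)).comp (h := fun t => -t) (hasFDerivAt_id t).neg).congr_log ?_
      ext
      simp
  obtain ⟨l, hl, rfl⟩ := Submonoid.exists_list_of_mem_closure h1
  choose! x hx using hl
  refine ⟨l.length, fun i => x l[i], ?_⟩
  congr 1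
  refine List.ext_getElem (by simp) fun i h1 h2 => ?_
  simpa using hx _ (List.getElem_mem h2)

theorem IsLeafChart.isTangentMap_list_prod (hφ : IsLeafChart φ) (hp : IsBracketClosed G p)
    (k : ℕ) : IsTangentMap p (fun x : Fin k → p => (List.ofFn fun i => φ (x i)).prod) := by
  induction k with
  | zero => simpa using IsTangentMap.const p
  | succ k ih =>
    simp only [List.ofFn_succ, List.prod_cons]
    exact (hφ.tangent.comp
      (ContinuousLinearMap.proj (R := 𝕜) (φ := fun _ : Fin (k + 1) => p) 0)).mul hp (ih.comp (ContinuousLinearMap.pi fun i : Fin k =>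
        ContinuousLinearMap.proj (R := 𝕜) (φ := fun _ : Fin (k + 1) => p) i.succ))

/-- The double cosets of the connected subgroup with Lie algebra `p` are immersed submanifolds. -/
theorem IsBracketClosed.isImmersedSubmanifold_doubleCoset (hp : IsBracketClosed G p) (t : G) :
    IsImmersedSubmanifold 𝕜 E
      (DoubleCoset.doubleCoset t (expSubgroup G p : Set G) (expSubgroup G p)) := by
  have := FiniteDimensional.complete 𝕜 E
  obtain ⟨φ, hφ⟩ := exists_isLeafChart hp
  let X : Set G := DoubleCoset.doubleCoset t (expSubgroup G p : Set G) (expSubgroup G p)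
  have hX : ∀ {g}, g ∈ X ↔ ∃ a ∈ expSubgroup G p, ∃ b ∈ expSubgroup G p, g = a * t * b :=
    DoubleCoset.mem_doubleCoset
  obtain ⟨τX, hn⟩ := hφ.exists_topology hp X
  have : IsManifold 𝓘(𝕜, E) ∞ G := inferInstance
  -- `X` is the union of countably many continuous images of finite-dimensional spaces
  have : SigmaCompactSpace X := by
    have hw := hφ.isTangentMap_list_prod hp
    let w : ∀ k : ℕ × ℕ, (Fin k.1 → p) × (Fin k.2 → p) → X := fun k x =>
      ⟨(List.ofFn fun i => φ (x.1 i)).prod * t * (List.ofFn fun i => φ (x.2 i)).prod,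
        hX.2 ⟨_, (hw k.1).mem x.1, _, (hw k.2).mem x.2, rfl⟩⟩
    have hc : ∀ k, Continuous (w k) := fun k => by
      rw [continuous_iff_continuousAt]
      intro x
      rw [ContinuousAt, hn, tendsto_comap_iff]
      exact hφ.map_mul_le_cosetFilter hp (hw k.1) (hw k.2) t x
    have hU : ⋃ k, range (w k) = univ := by
      refine eq_univ_of_forall fun ⟨g, hg⟩ => ?_
      obtain ⟨a, ha, b, hb, rfl⟩ := hX.1 hg
      obtain ⟨k, x, rfl⟩ := hφ.exists_list_prod ha
      obtain ⟨l, y, rfl⟩ := hφ.exists_list_prod hb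
      exact mem_iUnion.2 ⟨(k, l), (x, y), rfl⟩
    refine ⟨?_⟩
    rw [← hU]
    refine isSigmaCompact_iUnion _ fun k => ?_
    have : ProperSpace p := FiniteDimensional.proper 𝕜 p
    exact isSigmaCompact_range (hc k)
  obtain ⟨m, χ, hχ0, hχ, hlog, hinj, hmap⟩ := hφ.exists_slice hp t
  set A := (Ad 𝕜 E t⁻¹).comp (p.subtypeL.comp (ContinuousLinearMap.fst 𝕜 p m)) +
    m.subtypeL.comp (ContinuousLinearMap.snd 𝕜 p m)
  let s : p × m → G := fun x => φ x.1 * t * χ x.2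
  have hs : ContMDiff 𝓘(𝕜, p × m) 𝓘(𝕜, E) ∞ s :=
    ((hφ.tangent.comp (ContinuousLinearMap.fst 𝕜 p m)).contMDiff.mul contMDiff_const).mul
      (hχ.comp (ContinuousLinearMap.snd 𝕜 p m)).contMDiff
  have hs0 : s 0 = t := by simp [s, hφ.map_zero, hχ0]
  have hst : Tendsto (fun x => t⁻¹ * s x) (𝓝 0) (𝓝 1) := by
    have h1 : ContMDiff 𝓘(𝕜, p × m) 𝓘(𝕜, E) ∞ (fun x => t⁻¹ * s x) := contMDiff_const.mul hs
    simpa [hs0] using h1.continuous.tendsto 0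
  have hlgs : ∀ᶠ x in 𝓝 (0 : p × m), ContMDiffAt 𝓘(𝕜, E) 𝓘(𝕜, E) ∞ (lg E) (t⁻¹ * s x) :=
    hst.eventually eventually_contMDiffAt_lg
  have hcd : ∀ᶠ x in 𝓝 (0 : p × m), ContDiffAt 𝕜 ∞ (fun x => lg E (t⁻¹ * s x)) x := by
    filter_upwards [hlgs] with x hx
    exact (ContMDiffAt.comp x hx (contMDiff_const.mul hs x)).contDiffAt
  have hd : HasFDerivAt (fun x => lg E (t⁻¹ * s x)) A 0 := by
    have := hlog.2
    rwa [show φ (0 : p × m).1 * t * χ (0 : p × m).2 = t from hs0] at this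
  obtain ⟨ρ, hρ⟩ := exists_contDiffAt_leftInverse hcd hd hinj
  let d := Module.finrank 𝕜 (p × m)
  let e : EuclideanSpace 𝕜 (Fin d) ≃L[𝕜] p × m :=
    ContinuousLinearEquiv.ofFinrankEq (by simp [d])
  have he : Tendsto e (𝓝 0) (𝓝 0) := by simpa using e.continuous.tendsto 0
  have hrange : range (Subtype.val : X → G) = X := Subtype.range_val
  show IsImmersedSubmanifold 𝕜 E X
  rw [← hrange]
  refine isImmersedSubmanifold_range Subtype.val_injective (d := d) ?_
  rintro ⟨g, hg⟩
  obtain ⟨a, ha, b, hb, rfl⟩ := hX.1 hg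
  -- the parametrization of the slice at `t`, translated by `a` and `b`
  refine ⟨fun z => ⟨a * s (e z) * b, hX.2 ⟨a * φ (e z).1, mul_mem ha (hφ.tangent.mem _),
    χ (e z).2 * b, mul_mem (hχ.mem _) hb, by simp only [s, mul_assoc]⟩⟩,
    fun h => e.symm (ρ (lg E (t⁻¹ * (a⁻¹ * h * b⁻¹)))), ?_, ?_⟩
  · simp [hs0]
  filter_upwards [he.eventually hlgs, he.eventually hρ, he.eventually hmap] with z h1 ⟨h2, h3⟩ h4
  have hc : a⁻¹ * (a * s (e z) * b) * b⁻¹ = s (e z) := by group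
  refine ⟨?_, ?_, ?_, ?_⟩
  · exact (contMDiff_const.mul (hs.comp e.contDiff.contMDiff)).mul contMDiff_const z
  · have h5 : ContMDiffAt 𝓘(𝕜, E) 𝓘(𝕜, E) ∞ (fun h : G => t⁻¹ * (a⁻¹ * h * b⁻¹))
        (a * s (e z) * b) :=
      contMDiffAt_const.mul ((contMDiffAt_const.mul contMDiffAt_id).mul contMDiffAt_const)
    rw [← hc] at h1
    have h2' := h2.contMDiffAt
    rw [← hc] at h2'
    have h6 := ContMDiffAt.comp (a * s (e z) * b) h2'
      (ContMDiffAt.comp (a * s (e z) * b) h1 h5)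
    exact e.symm.contDiff.contMDiff.contMDiffAt.comp _ h6
  · show e.symm (ρ (lg E (t⁻¹ * (a⁻¹ * (a * s (e z) * b) * b⁻¹)))) = z
    rw [hc, h3, e.symm_apply_apply]
  · rw [hn]
    rw [← Filter.comap_map (f := map _ _) (m := (Subtype.val : X → G)) Subtype.val_injective]
    congr 1
    rw [map_map]
    have h5 : map s (𝓝 (e z)) = cosetFilter φ (s (e z)) := h4
    have h6 : map e (𝓝 z) = 𝓝 (e z) := e.toHomeomorph.map_nhds_eq z
    rw [hφ.cosetFilter_mul hp ha hb, ← h5, ← h6, Filter.pure_mul, Filter.mul_pure, map_map, map_map,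
      map_map]
    rfl

end DoubleCoset

section Flow

open ContinuousLinearMap (toSpanSingleton)

variable {𝕜 : Type*} [RCLike 𝕜] {E : Type*} [NormedAddCommGroup E] [NormedSpace 𝕜 E]
  [FiniteDimensional 𝕜 E]
  {G : Type*} [TopologicalSpace G] [ChartedSpace E G] [Group G] [LieGroup 𝓘(𝕜, E) ∞ G]
  {p : Submodule 𝕜 E}

/-! ### Curves moving along double cosets -/

/-- A curve with left logarithmic derivative `u - Ad c⁻¹ w`, where `u` and `w` take values in `p`,
locally stays in a double coset: multiply it by curves with logarithmic derivatives `w` and `u`. -/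
theorem IsBracketClosed.eventually_mem_doubleCoset [NormedSpace ℝ E] [IsScalarTower ℝ 𝕜 E]
    (hp : IsBracketClosed G p) {c : ℝ → G} {u w : ℝ → E} {s : ℝ}
    (hc : ∀ᶠ t in 𝓝 s, HasLog c t (toSpanSingleton ℝ (u t - Ad 𝕜 E (c t)⁻¹ (w t))))
    (hu : ∀ᶠ t in 𝓝 s, ContinuousAt u t ∧ u t ∈ p)
    (hw : ∀ᶠ t in 𝓝 s, ContinuousAt w t ∧ w t ∈ p) :
    ∀ᶠ t in 𝓝 s, ∃ a ∈ expSubgroup G p, ∃ b ∈ expSubgroup G p, c t = a * c s * b := by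
  have := FiniteDimensional.complete 𝕜 E
  obtain ⟨φ, hφ⟩ := exists_isLeafChart hp
  have hs : Tendsto (fun t : ℝ => s + t) (𝓝 0) (𝓝 s) := by
    simpa using (continuous_const_add s).tendsto 0
  have hcont : ∀ t, ContinuousAt (fun t : ℝ => s + t) t := fun t =>
    (continuous_const_add s).continuousAt
  -- a curve in the subgroup with a given continuous logarithmic derivative
  have key : ∀ v : ℝ → E, (∀ᶠ t in 𝓝 s, ContinuousAt v t ∧ v t ∈ p) → ∃ b : ℝ → G, b 0 = 1 ∧
      (∀ᶠ t in 𝓝 0, HasLog b t (toSpanSingleton ℝ (v (s + t)))) ∧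
      ∀ᶠ t in 𝓝 0, b t ∈ expSubgroup G p := by
    intro v hv
    have hv' := hs.eventually hv
    obtain ⟨b, hb0, hb⟩ := exists_hasLog_curve 𝕜 (G := G) (u := fun t => v (s + t))
      (hv'.mono fun t ht => ContinuousAt.comp (f := fun t : ℝ => s + t) ht.1 (hcont t))
    refine ⟨b, hb0, hb, ?_⟩
    have h1 : Tendsto b (𝓝 0) (leafFilter φ) := by
      refine hφ.tendsto_leafFilter (K := ℝ) hb0 ?_
      filter_upwards [hb, hv'] with t ht htp
      refine ⟨_, ht, fun h => ?_⟩
      have h2 : ((h : 𝕜) • v (s + t)) ∈ p := p.smul_mem _ htp.2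
      have h3 : (h : 𝕜) • v (s + t) = h • v (s + t) := by
        rw [← algebraMap_smul 𝕜 h (v (s + t))]
      rw [h3] at h2
      exact h2
    exact h1.eventually_mem hφ.mem_leafFilter_expSubgroup
  obtain ⟨α, hα0, hα, hαP⟩ := key w hw
  obtain ⟨b, hb0, hb, hbP⟩ := key u hu
  -- `α c b⁻¹` has vanishing logarithmic derivative
  have hzero : ∀ᶠ t in 𝓝 (0 : ℝ), HasLog (fun t => α t * c (s + t) * (b t)⁻¹) t
      (0 : ℝ →L[ℝ] E) := by
    filter_upwards [hα, hb, hs.eventually hc] with t h1 h2 h3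
    have h4 : HasLog (fun t => c (s + t)) t
        (toSpanSingleton ℝ (u (s + t) - Ad 𝕜 E (c (s + t))⁻¹ (w (s + t)))) := by
      refine (h3.comp (h := fun t : ℝ => s + t) ((hasFDerivAt_id t).const_add s)).congr_log ?_
      ext
      simp
    refine ((h1.mul (𝕜 := 𝕜) h4).mul (𝕜 := 𝕜) (h2.inv (𝕜 := 𝕜))).congr_log ?_
    ext
    simp
  have hs' : Tendsto (fun t : ℝ => t - s) (𝓝 s) (𝓝 0) := by
    simpa using (continuous_sub_right s).tendsto s
  filter_upwards [hs'.eventually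
    ((HasLog.eventually_eq_of_zero (𝕜 := 𝕜) hzero).and (hαP.and hbP))] with t ⟨h1, h2, h3⟩
  refine ⟨_, inv_mem h2, _, h3, ?_⟩
  simp only [add_sub_cancel, hα0, hb0, add_zero, one_mul, inv_one, mul_one] at h1
  rw [← h1]
  group

/-- The global form of `IsBracketClosed.eventually_mem_doubleCoset`, for real or complex times. -/
theorem IsBracketClosed.mem_doubleCoset_of_hasLog (hp : IsBracketClosed G p) {γ : 𝕜 → G}
    {u w : 𝕜 → E} {s : Set 𝕜} (hs : IsOpen s) (hsc : IsPreconnected s)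
    (hγ : ∀ τ ∈ s, HasLog γ τ (toSpanSingleton 𝕜 (u τ - Ad 𝕜 E (γ τ)⁻¹ (w τ))))
    (hu : ContinuousOn u s) (hup : ∀ τ ∈ s, u τ ∈ p) (hw : ContinuousOn w s)
    (hwp : ∀ τ ∈ s, w τ ∈ p) {τ₀ τ : 𝕜} (hτ₀ : τ₀ ∈ s) (hτ : τ ∈ s) :
    ∃ a ∈ expSubgroup G p, ∃ b ∈ expSubgroup G p, γ τ = a * γ τ₀ * b := by
  let _ : NormedSpace ℝ E := NormedSpace.restrictScalars ℝ 𝕜 E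
  have _ : IsScalarTower ℝ 𝕜 E := RestrictScalars.isScalarTower ℝ 𝕜 E
  have htrans : ∀ x y z : G,
      (∃ a ∈ expSubgroup G p, ∃ b ∈ expSubgroup G p, y = a * x * b) →
      (∃ a ∈ expSubgroup G p, ∃ b ∈ expSubgroup G p, z = a * y * b) →
      ∃ a ∈ expSubgroup G p, ∃ b ∈ expSubgroup G p, z = a * x * b := by
    rintro x _ _ ⟨a, ha, b, hb, rfl⟩ ⟨a', ha', b', hb', rfl⟩
    exact ⟨a' * a, mul_mem ha' ha, b * b', mul_mem hb hb', by group⟩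
  have hsymm : ∀ x y : G,
      (∃ a ∈ expSubgroup G p, ∃ b ∈ expSubgroup G p, y = a * x * b) →
      ∃ a ∈ expSubgroup G p, ∃ b ∈ expSubgroup G p, x = a * y * b := by
    rintro x _ ⟨a, ha, b, hb, rfl⟩
    exact ⟨a⁻¹, inv_mem ha, b⁻¹, inv_mem hb, by group⟩
  refine hsc.induction₂ (fun τ₁ τ₂ => ∃ a ∈ expSubgroup G p, ∃ b ∈ expSubgroup G p,
    γ τ₂ = a * γ τ₁ * b) (fun τ₁ hτ₁ => ?_) (fun _ _ _ _ _ _ => htrans _ _ _)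
    (fun _ _ _ _ => hsymm _ _) hτ₀ hτ
  refine mem_nhdsWithin_of_mem_nhds ?_
  obtain ⟨δ, hδ, hball⟩ := Metric.isOpen_iff.1 hs τ₁ hτ₁
  filter_upwards [Metric.ball_mem_nhds τ₁ hδ] with τ₂ hτ₂
  -- move from `τ₁` to `τ₂` along the real line segment
  let ℓ : ℝ → 𝕜 := fun σ => τ₁ + (σ : 𝕜) * (τ₂ - τ₁)
  have hℓ : Continuous ℓ := by
    have := RCLike.continuous_ofReal (K := 𝕜)
    fun_prop
  have hℓs : ∀ σ ∈ Icc (0 : ℝ) 1, ℓ σ ∈ s := fun σ hσ => by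
    refine hball ?_
    rw [mem_ball_iff_norm] at hτ₂ ⊢
    simp only [ℓ, add_sub_cancel_left, norm_mul, RCLike.norm_ofReal, abs_of_nonneg hσ.1]
    exact (mul_le_of_le_one_left (norm_nonneg _) hσ.2).trans_lt hτ₂
  have hℓd : ∀ σ, HasFDerivAt ℓ (toSpanSingleton ℝ (τ₂ - τ₁)) σ := fun σ => by
    have h1 := (((RCLike.ofRealCLM (K := 𝕜)).hasFDerivAt (x := σ)).mul_const (τ₂ - τ₁)).const_add τ₁
    refine h1.congr_fderiv ?_
    ext
    simp
  have h01 := isPreconnected_Icc (a := (0 : ℝ)) (b := 1).induction₂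
    (fun σ₁ σ₂ => ∃ a ∈ expSubgroup G p, ∃ b ∈ expSubgroup G p,
      γ (ℓ σ₂) = a * γ (ℓ σ₁) * b) (fun σ hσ => ?_) (fun _ _ _ _ _ _ => htrans _ _ _)
    (fun _ _ _ _ => hsymm _ _) (left_mem_Icc.2 zero_le_one) (right_mem_Icc.2 zero_le_one)
  · simpa [ℓ] using h01
  refine mem_nhdsWithin_of_mem_nhds ?_
  have hev : ∀ᶠ σ' in 𝓝 σ, ℓ σ' ∈ s := hℓ.continuousAt.eventually (hs.mem_nhds (hℓs σ hσ))
  have hcomp : ∀ v : 𝕜 → E, ContinuousOn v s → (∀ τ ∈ s, v τ ∈ p) → ∀ᶠ σ' in 𝓝 σ,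
      ContinuousAt (fun σ => (τ₂ - τ₁) • v (ℓ σ)) σ' ∧ (τ₂ - τ₁) • v (ℓ σ') ∈ p := by
    intro v hv hvp
    filter_upwards [hev] with σ' hσ'
    exact ⟨(ContinuousAt.comp (f := ℓ) (hv.continuousAt (hs.mem_nhds hσ'))
      hℓ.continuousAt).const_smul _, p.smul_mem _ (hvp _ hσ')⟩
  refine hp.eventually_mem_doubleCoset (c := fun σ => γ (ℓ σ)) ?_ (hcomp u hu hup) (hcomp w hw hwp)
  filter_upwards [hev] with σ' hσ'
  have h1 := (hγ _ hσ').restrictScalars (K := ℝ)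
  have h2 := HasLog.comp (f := γ) (h := ℓ) h1 (hℓd σ')
  refine HasLog.congr_log h2 (ContinuousLinearMap.ext fun x => ?_)
  show (x • (τ₂ - τ₁)) • (u (ℓ σ') - Ad 𝕜 E (γ (ℓ σ'))⁻¹ (w (ℓ σ'))) =
    x • ((τ₂ - τ₁) • u (ℓ σ') - Ad 𝕜 E (γ (ℓ σ'))⁻¹ ((τ₂ - τ₁) • w (ℓ σ')))
  rw [map_smul, ← smul_sub, smul_assoc]

/-! ### Hamiltonian curves -/

variable (E) in
/-- The differential of `f` at `g`, pulled back to the Lie algebra by left translation. -/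
def leftDifferential (f : G → 𝕜) (g : G) : E →L[𝕜] 𝕜 :=
  fderiv 𝕜 (fun x : E => f (g * ex G x)) 0

omit [FiniteDimensional 𝕜 E] in
theorem leftDifferential_eq {f : G → 𝕜} {g : G} {D : E →L[𝕜] 𝕜}
    (hf : HasMFDerivAt 𝓘(𝕜, E) 𝓘(𝕜, 𝕜) f g D) : D.comp (dL 𝕜 E g) = leftDifferential E f g := by
  have h1 : HasMFDerivAt 𝓘(𝕜, E) 𝓘(𝕜, 𝕜) f (g * ex G (0 : E)) D := hf.of_eq (by simp)
  have h2 : HasMFDerivAt 𝓘(𝕜, E) 𝓘(𝕜, E) (fun h : G => g * h) (ex G (0 : E)) (dL 𝕜 E g) :=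
    (hasMFDerivAt_dL (𝕜 := 𝕜) (E := E) g).of_eq (by simp)
  have h3 := HasMFDerivAt.comp (0 : E) h1 (HasMFDerivAt.comp (0 : E) h2
    (hasMFDerivAt_ex (𝕜 := 𝕜) (E := E) (G := G)))
  have h4 : HasMFDerivAt 𝓘(𝕜, E) 𝓘(𝕜, 𝕜) (fun x : E => f (g * ex G x)) 0 (D.comp (dL 𝕜 E g)) := h3
  have h5 : HasFDerivAt (fun x : E => f (g * ex G x)) (D.comp (dL 𝕜 E g)) 0 :=
    hasMFDerivAt_iff_hasFDerivAt.1 h4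
  exact h5.fderiv.symm

omit [FiniteDimensional 𝕜 E] in
theorem continuousAt_leftDifferential {f : G → 𝕜} {g : G}
    (hf : ContMDiffAt 𝓘(𝕜, E) 𝓘(𝕜, 𝕜) ∞ f g) : ContinuousAt (leftDifferential E f) g := by
  have := topologicalGroup_of_lieGroup 𝓘(𝕜, E) ∞ (G := G)
  have h1 : ContMDiffAt 𝓘(𝕜, E × E) 𝓘(𝕜, E) ∞ (fun z : E × E => g * ex G z.1 * ex G z.2) (0, 0) :=
    (contMDiffAt_const.mul (contMDiffAt_ex_comp contDiffAt_fst rfl)).mul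
      (contMDiffAt_ex_comp contDiffAt_snd rfl)
  have h2 : ContDiffAt 𝕜 ∞ (fun z : E × E => f (g * ex G z.1 * ex G z.2)) (0, 0) := by
    refine ContMDiffAt.contDiffAt (ContMDiffAt.comp (0, 0) (g := f) ?_ h1)
    simpa using hf
  have h3 : ContDiffAt 𝕜 0 (fun z : E => fderiv 𝕜 (fun x : E => f (g * ex G z * ex G x)) 0) 0 :=
    ContDiffAt.fderiv (f := fun z x => f (g * ex G z * ex G x)) (g := fun _ => 0) h2
      contDiffAt_const (by simp)
  have h4 : Tendsto (fun g' => g⁻¹ * g') (𝓝 g) (𝓝 1) := by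
    simpa using (continuous_const_mul g⁻¹).tendsto g
  have h5 : Tendsto (fun g' => lg E (g⁻¹ * g')) (𝓝 g) (𝓝 0) := by
    have : Tendsto (lg E) (𝓝 (1 : G)) (𝓝 0) := by
      simpa using (continuousAt_lg E G 𝕜).tendsto
    exact this.comp h4
  have h6 := h3.continuousAt.tendsto.comp h5
  simp only [ex_zero, mul_one] at h6
  refine h6.congr' ?_
  filter_upwards [h4.eventually (eventually_ex_lg E G)] with g' hg'
  simp [hg', leftDifferential]

end Flow

/-! ### The Yang--Baxter equation and the span of the components of `r` -/

section Contraction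

variable {𝕜 V : Type*} [Field 𝕜] [AddCommGroup V] [Module 𝕜 V]

theorem covectorContract_tmul (ξ : Module.Dual 𝕜 V) (a b : V) :
    covectorContract ξ (a ⊗ₜ[𝕜] b) = ξ a • b := by
  simp [covectorContract]

theorem covectorContract_zero (ξ : Module.Dual 𝕜 V) : covectorContract ξ (0 : V ⊗[𝕜] V) = 0 := by
  simp [covectorContract]

theorem covectorContract_add (ξ : Module.Dual 𝕜 V) (x y : V ⊗[𝕜] V) :
    covectorContract ξ (x + y) = covectorContract ξ x + covectorContract ξ y := by
  simp [covectorContract]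

theorem covectorContract_sub (ξ : Module.Dual 𝕜 V) (x y : V ⊗[𝕜] V) :
    covectorContract ξ (x - y) = covectorContract ξ x - covectorContract ξ y := by
  simp [covectorContract]

theorem covectorContract_mem_componentSpan (ξ : Module.Dual 𝕜 V) (r : V ⊗[𝕜] V) :
    covectorContract ξ r ∈ componentSpan r :=
  Submodule.subset_span ⟨ξ, rfl⟩

theorem covectorContract_map {W : Type*} [AddCommGroup W] [Module 𝕜 W] (L : V →ₗ[𝕜] W)
    (ξ : Module.Dual 𝕜 W) (r : V ⊗[𝕜] V) :
    covectorContract ξ (TensorProduct.map L L r) = L (covectorContract (ξ ∘ₗ L) r) := by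
  induction r using TensorProduct.induction_on with
  | zero => simp [covectorContract_zero]
  | tmul a b => simp [covectorContract_tmul]
  | add x y hx hy => simp [covectorContract_add, hx, hy]

/-- Contraction of the tensor `r` as a linear function of the covector. -/
def contractLinear (r : V ⊗[𝕜] V) : Module.Dual 𝕜 V →ₗ[𝕜] V where
  toFun ξ := covectorContract ξ r
  map_add' ξ η := by simp [covectorContract, TensorProduct.map_add_left]
  map_smul' c ξ := by simp [covectorContract, TensorProduct.map_smul_left]

end Contraction

section YangBaxterSpan

variable {𝕜 L : Type*} [Field 𝕜] [LieRing L] [LieAlgebra 𝕜 L]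

/-- The contraction `ξ ⊗ η ⊗ id` of a tensor of degree three. -/
def contractTwo (ξ η : Module.Dual 𝕜 L) : L ⊗[𝕜] (L ⊗[𝕜] L) →ₗ[𝕜] L :=
  (TensorProduct.lid 𝕜 L).toLinearMap ∘ₗ TensorProduct.map ξ
    ((TensorProduct.lid 𝕜 L).toLinearMap ∘ₗ TensorProduct.map η LinearMap.id)

theorem exists_contractTwo_bracket1213 (ξ η : Module.Dual 𝕜 L) (r s : L ⊗[𝕜] L) :
    ∃ ζ : Module.Dual 𝕜 L,
      contractTwo ξ η (bracket1213 𝕜 L (r ⊗ₜ[𝕜] s)) = covectorContract ζ s := by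
  let D : L ⊗[𝕜] L →ₗ[𝕜] L :=
    (TensorProduct.rid 𝕜 L).toLinearMap ∘ₗ TensorProduct.map LinearMap.id η
  refine ⟨ξ ∘ₗ LieAlgebra.ad 𝕜 L (D r), ?_⟩
  induction s using TensorProduct.induction_on with
  | zero => simp [covectorContract_zero]
  | add x y hx hy => rw [TensorProduct.tmul_add, map_add, map_add, hx, hy, covectorContract_add]
  | tmul c d =>
    rw [covectorContract_tmul]
    induction r using TensorProduct.induction_on with
    | zero => simp
    | add x y hx hy => simp only [TensorProduct.add_tmul, map_add, hx, hy, LinearMap.comp_apply,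
        LinearMap.add_apply, add_smul]
    | tmul a b => simp [bracket1213_tmul, contractTwo, D, smul_smul, mul_comm]

theorem exists_contractTwo_bracket1223 (ξ η : Module.Dual 𝕜 L) (r s : L ⊗[𝕜] L) :
    ∃ ζ : Module.Dual 𝕜 L,
      contractTwo ξ η (bracket1223 𝕜 L (r ⊗ₜ[𝕜] s)) = covectorContract ζ s := by
  refine ⟨η ∘ₗ LieAlgebra.ad 𝕜 L (covectorContract ξ r), ?_⟩
  induction s using TensorProduct.induction_on with
  | zero => simp [covectorContract_zero]
  | add x y hx hy => rw [TensorProduct.tmul_add, map_add, map_add, hx, hy, covectorContract_add]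
  | tmul c d =>
    rw [covectorContract_tmul]
    induction r using TensorProduct.induction_on with
    | zero => simp [covectorContract_zero]
    | add x y hx hy => simp only [TensorProduct.add_tmul, map_add, hx, hy, LinearMap.comp_apply,
        LinearMap.add_apply, add_smul, covectorContract_add]
    | tmul a b => simp [bracket1223_tmul, contractTwo, covectorContract_tmul, smul_smul, mul_comm]

theorem contractTwo_bracket1323 (ξ η : Module.Dual 𝕜 L) (r s : L ⊗[𝕜] L) :
    contractTwo ξ η (bracket1323 𝕜 L (r ⊗ₜ[𝕜] s)) =
      ⁅covectorContract ξ r, covectorContract η s⁆ := by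
  induction s using TensorProduct.induction_on with
  | zero => simp [covectorContract_zero]
  | add x y hx hy => rw [TensorProduct.tmul_add, map_add, map_add, hx, hy, covectorContract_add,
      lie_add]
  | tmul c d =>
    induction r using TensorProduct.induction_on with
    | zero => simp [covectorContract_zero]
    | add x y hx hy => rw [TensorProduct.add_tmul, map_add, map_add, hx, hy, covectorContract_add,
        add_lie]
    | tmul a b => simp [bracket1323_tmul, contractTwo, covectorContract_tmul]

/-- Contracting the Yang--Baxter equation with `ξ ⊗ η ⊗ id` expresses the bracket of two
components of `r` as a component of `r`. -/
theorem lie_mem_componentSpan {r : L ⊗[𝕜] L} (hr : yangBaxterElement r = 0) {v w : L}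
    (hv : v ∈ componentSpan r) (hw : w ∈ componentSpan r) : ⁅v, w⁆ ∈ componentSpan r := by
  induction hv, hw using Submodule.span_induction₂ with
  | mem_mem x y hx hy =>
    obtain ⟨ξ, rfl⟩ := hx
    obtain ⟨η, rfl⟩ := hy
    obtain ⟨ζ₁, h₁⟩ := exists_contractTwo_bracket1213 ξ η r r
    obtain ⟨ζ₂, h₂⟩ := exists_contractTwo_bracket1223 ξ η r r
    have h := congrArg (contractTwo ξ η) hr
    rw [yangBaxterElement, map_add, map_add, h₁, h₂, contractTwo_bracket1323, map_zero] at h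
    rw [eq_neg_of_add_eq_zero_right h]
    exact Submodule.neg_mem _ (Submodule.add_mem _ (covectorContract_mem_componentSpan _ _)
      (covectorContract_mem_componentSpan _ _))
  | zero_left y hy => simp
  | zero_right x hx => simp
  | add_left x y z _ _ _ hx hy => simpa using Submodule.add_mem _ hx hy
  | add_right x y z _ _ _ hx hy => simpa using Submodule.add_mem _ hx hy
  | smul_left c x y _ _ h => simpa using Submodule.smul_mem _ c h
  | smul_right c x y _ _ h => simpa using Submodule.smul_mem _ c h

end YangBaxterSpan

section TriangularGroup

open ContinuousLinearMap (toSpanSingleton)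

variable {𝕜 : Type*} [RCLike 𝕜] {E : Type*} [NormedAddCommGroup E] [NormedSpace 𝕜 E]
  {G : Type*} [TopologicalSpace G] [ChartedSpace E G] [Group G] [LieGroup 𝓘(𝕜, E) ∞ G]

/-! ### Hamiltonian vector fields in the left trivialization -/

/-- `x g = g (g⁻¹ x g)`, differentiated at `x = 1`. -/
theorem rightTranslation_apply [CompleteSpace E] (g : G) (v : E) :
    (rightTranslation (𝕜 := 𝕜) (E := E) g v : E) = dL 𝕜 E g (Ad 𝕜 E g⁻¹ v) := by
  let D : E →L[𝕜] E := mfderiv 𝓘(𝕜, E) 𝓘(𝕜, E) (fun h : G => h * g) 1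
  have hD : HasMFDerivAt 𝓘(𝕜, E) 𝓘(𝕜, E) (fun h : G => h * g) 1 D :=
    (contMDiff_mul_right.contMDiffAt.mdifferentiableAt (n := ∞) (by simp)).hasMFDerivAt
  have hD' : HasMFDerivAt 𝓘(𝕜, E) 𝓘(𝕜, E) (fun h : G => h * g) (ex G (0 : E)) D :=
    hD.of_eq (by simp)
  have h1 : HasMFDerivAt 𝓘(𝕜, E) 𝓘(𝕜, E) (fun x : E => ex G x * g) 0
      (D.comp (ContinuousLinearMap.id 𝕜 E)) :=
    HasMFDerivAt.comp (0 : E) hD' (hasMFDerivAt_ex (𝕜 := 𝕜) (E := E) (G := G))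
  have h2 : HasLog (fun x : E => ex G x) 0 (ContinuousLinearMap.id 𝕜 E) := by
    refine (eventually_hasLog_ex 𝕜 E G (K := 𝕜) E).self_of_nhds (fun x => x) 0 _ rfl ?_
    rw [frame_zero]
    exact hasFDerivAt_id 0
  have h3 : HasLog (fun x : E => ex G x * g) 0 (Ad 𝕜 E g⁻¹) := by
    refine (h2.mul (𝕜 := 𝕜) (hasLog_const g 0)).congr_log ?_
    ext x
    simp
  have h4 : HasMFDerivAt 𝓘(𝕜, E) 𝓘(𝕜, E) (fun x : E => ex G x * g) 0
      ((dL 𝕜 E g).comp (Ad 𝕜 E g⁻¹)) := by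
    have h5 := h3.hasMFDerivAt
    rwa [show ex G (0 : E) * g = g by simp] at h5
  exact DFunLike.congr_fun (hasMFDerivAt_unique h1 h4) v

theorem hasMFDerivAt_iff_hasLog {γ : 𝕜 → G} {t : 𝕜} {v : E} {D : 𝕜 →L[𝕜] E}
    (hD : D = (dL 𝕜 E (γ t)).comp (toSpanSingleton 𝕜 v)) :
    HasMFDerivAt 𝓘(𝕜, 𝕜) 𝓘(𝕜, E) γ t D ↔ HasLog γ t (toSpanSingleton 𝕜 v) := by
  subst hD
  exact ⟨hasLog_of_hasMFDerivAt, HasLog.hasMFDerivAt⟩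

/-- The exponential image is described by left logarithmic derivatives. -/
theorem expImage_eq (p : Submodule 𝕜 E) :
    expImage (𝕜 := 𝕜) (E := E) (G := G) p = expSet G p := by
  have key : ∀ (v : E) (γ : 𝕜 → G) (t : 𝕜), HasMFDerivAt 𝓘(𝕜, 𝕜) 𝓘(𝕜, E) γ t
      ((1 : 𝕜 →L[𝕜] 𝕜).smulRight (dL 𝕜 E (γ t) v)) ↔ HasLog γ t (toSpanSingleton 𝕜 v) :=
    fun v γ t => hasMFDerivAt_iff_hasLog (D := (1 : 𝕜 →L[𝕜] 𝕜).smulRight (dL 𝕜 E (γ t) v)) (by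
      ext
      simp)
  ext g
  constructor
  · rintro ⟨v, hv, γ, h0, hγ, h1⟩
    exact ⟨v, hv, γ, h0, fun t => (key v γ t).1 (hγ t (mem_univ t)), h1⟩
  · rintro ⟨v, hv, γ, h0, hγ, h1⟩
    exact ⟨v, hv, γ, h0, fun t _ => (key v γ t).2 (hγ t), h1⟩

/-- The contraction of `r` with a continuous covector, as a linear map. -/
def contract (r : E ⊗[𝕜] E) : (E →L[𝕜] 𝕜) →ₗ[𝕜] E :=
  contractLinear r ∘ₗ ContinuousLinearMap.coeLM 𝕜

theorem contract_mem (r : E ⊗[𝕜] E) (ξ : E →L[𝕜] 𝕜) : contract r ξ ∈ componentSpan r :=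
  covectorContract_mem_componentSpan _ r

/-- The Hamiltonian field in the left trivialization. -/
theorem hamiltonianField_eq [CompleteSpace E] {r : E ⊗[𝕜] E} {f : G → 𝕜} {g : G}
    (hf : ContMDiffAt 𝓘(𝕜, E) 𝓘(𝕜, 𝕜) ∞ f g) :
    (hamiltonianField (𝕜 := 𝕜) (E := E) (triangularBivector r) f g : E) =
      dL 𝕜 E g (contract r (leftDifferential E f g) -
        Ad 𝕜 E g⁻¹ (contract r ((leftDifferential E f g).comp (Ad 𝕜 E g⁻¹)))) := by
  let D : E →L[𝕜] 𝕜 := mfderiv 𝓘(𝕜, E) 𝓘(𝕜, 𝕜) f g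
  have hD : HasMFDerivAt 𝓘(𝕜, E) 𝓘(𝕜, 𝕜) f g D := (hf.mdifferentiableAt (by simp)).hasMFDerivAt
  let R : E →ₗ[𝕜] E := rightTranslation (𝕜 := 𝕜) (E := E) g
  have hR : ∀ v, R v = dL 𝕜 E g (Ad 𝕜 E g⁻¹ v) := rightTranslation_apply g
  have h1 : (hamiltonianField (𝕜 := 𝕜) (E := E) (triangularBivector r) f g : E) =
      covectorContract (D : E →ₗ[𝕜] 𝕜)
        (TensorProduct.map (dL 𝕜 E g : E →ₗ[𝕜] E) (dL 𝕜 E g : E →ₗ[𝕜] E) r -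
          TensorProduct.map R R r) := rfl
  rw [h1, covectorContract_sub, covectorContract_map, covectorContract_map, hR, map_sub,
    ← leftDifferential_eq hD]
  congr 4
  refine LinearMap.ext fun v => ?_
  show D (R v) = D (dL 𝕜 E g (Ad 𝕜 E g⁻¹ v))
  rw [hR]

theorem isHamiltonianFlowStable_doubleCoset [FiniteDimensional 𝕜 E] {r : E ⊗[𝕜] E}
    (hp : IsBracketClosed G (componentSpan r)) (t : G) :
    IsHamiltonianFlowStable (𝕜 := 𝕜) (E := E) (triangularBivector (𝕜 := 𝕜) (E := E) (G := G) r)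
      (DoubleCoset.doubleCoset t (expSubgroup G (componentSpan r) : Set G)
        (expSubgroup G (componentSpan r))) := by
  have := FiniteDimensional.complete 𝕜 E
  intro U f hU hf γ s hs hsc hmaps hγ τ₀ hτ₀ hX τ hτ
  have hfγ : ∀ τ ∈ s, ContMDiffAt 𝓘(𝕜, E) 𝓘(𝕜, 𝕜) ∞ f (γ τ) := fun τ hτ =>
    hf.contMDiffAt (hU.mem_nhds (hmaps hτ))
  let ξ : 𝕜 → E →L[𝕜] 𝕜 := fun τ => leftDifferential E f (γ τ)
  let A : 𝕜 → E →L[𝕜] E := fun τ => Ad 𝕜 E (γ τ)⁻¹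
  have hlog : ∀ τ ∈ s, HasLog γ τ (toSpanSingleton 𝕜
      (contract r (ξ τ) - Ad 𝕜 E (γ τ)⁻¹ (contract r ((ξ τ).comp (A τ))))) := by
    intro τ hτ
    let X : E := hamiltonianField (𝕜 := 𝕜) (E := E) (triangularBivector r) f (γ τ)
    have hX : X = dL 𝕜 E (γ τ) (contract r (ξ τ) -
        Ad 𝕜 E (γ τ)⁻¹ (contract r ((ξ τ).comp (A τ)))) := hamiltonianField_eq (hfγ τ hτ)
    refine (hasMFDerivAt_iff_hasLog (D := (1 : 𝕜 →L[𝕜] 𝕜).smulRight X) ?_).1 (hγ τ hτ)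
    rw [hX]
    refine ContinuousLinearMap.ext fun x => ?_
    rw [ContinuousLinearMap.comp_apply, ContinuousLinearMap.toSpanSingleton_apply, map_smul]
    rfl
  have hξ : ContinuousOn ξ s := fun τ hτ => ContinuousAt.continuousWithinAt
    (ContinuousAt.comp (f := γ) (continuousAt_leftDifferential (hfγ τ hτ))
      (hlog τ hτ).continuousAt)
  have hA : ContinuousOn A s := by
    rw [continuousOn_clm_apply]
    intro v τ hτ
    obtain ⟨L, -, hL⟩ := ((hlog τ hτ).inv (𝕜 := 𝕜)).Ad_apply (𝕜 := 𝕜) v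
    exact hL.continuousAt.continuousWithinAt
  have hcon : Continuous (contract r) := LinearMap.continuous_of_finiteDimensional _
  obtain ⟨a, ha, b, hb, hab⟩ := hp.mem_doubleCoset_of_hasLog hs hsc hlog
    (hcon.comp_continuousOn hξ) (fun τ _ => contract_mem r _)
    (hcon.comp_continuousOn (hξ.clm_comp hA)) (fun τ _ => contract_mem r _) hτ₀ hτ
  obtain ⟨a', ha', b', hb', hX⟩ := DoubleCoset.mem_doubleCoset.1 hX
  refine DoubleCoset.mem_doubleCoset.2 ⟨a * a', mul_mem ha ha', b' * b, mul_mem hb' hb, ?_⟩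
  rw [hab, hX]
  group

end TriangularGroup

end

theorem lemma3p3 {𝕜 : Type*} [RCLike 𝕜]
    {E : Type*} [NormedAddCommGroup E] [NormedSpace 𝕜 E] [FiniteDimensional 𝕜 E]
    {G : Type*} [TopologicalSpace G] [ChartedSpace E G] [Group G] [LieGroup 𝓘(𝕜, E) ∞ G]
    (r : GroupLieAlgebra 𝓘(𝕜, E) G ⊗[𝕜] GroupLieAlgebra 𝓘(𝕜, E) G)
    (hr : IsTriangular r) (t : G) :
    IsCompletePoissonSubmanifold (triangularBivector r)
      (DoubleCoset.doubleCoset t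
        (connectedSubgroup (componentSpan r) : Set G)
        (connectedSubgroup (componentSpan r) : Set G)) := by
  have := FiniteDimensional.complete 𝕜 E
  let r' : E ⊗[𝕜] E := r
  have hp : IsBracketClosed G (componentSpan r') := fun v hv w hw =>
    lie_mem_componentSpan (L := GroupLieAlgebra 𝓘(𝕜, E) G) hr.yangBaxter hv hw
  have hP : connectedSubgroup (componentSpan r) = expSubgroup G (componentSpan r') :=
    congrArg Subgroup.closure (expImage_eq (componentSpan r'))
  rw [hP]
  exact ⟨hp.isImmersedSubmanifold_doubleCoset t, isHamiltonianFlowStable_doubleCoset hp t⟩
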